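/- Let $(\mathcal S,\omega,\langle\cdot,\cdot\rangle)$ be a finite-dimensional real symplectic vector space with an inner product, of dimension $2N$. Let $E$ be the invertible operator with $\omega(v_1,v_2)=\langle v_1,E^{-1}v_2\rangle$, put $|E|=\sqrt{E^*E}$, and let $J=-E^{-1}|E|$ be the resulting complex structure. The Poisson bracket $\{f_1,f_2\}=\varpi(\mathrm df_1,\mathrm df_2)$ is the inverse of $\omega$: in a $\langle\cdot,\cdot\rangle$-orthonormal basis the matrices of $\omega$ and $\varpi$ are those of $E^{-1}$ and $E$. Let $\mathrm{vol}=|\omega^N/N!|$ be the symplectic volume and, for $\hbar>0$, let $\nabla_\hbar=\mathrm d+\frac{\mathrm i}{\hbar}\theta$ with $\theta_x(v)=-\frac12\omega(x,v)$ (so $\omega=-\mathrm d\theta$) be the connection of the trivial quantization bundle. Let $\mathcal H_\hbar\subset L^2(\mathcal S,\mathrm{vol})$ be the (Fock) Hilbert space spanned by the square-integrable holomorphic sections, i.e. the smooth $\psi$ with $\nabla_{\hbar,\,v+\mathrm iJv}\psi=0$ for all $v\in\mathcal S$, let $\Pi_\hbar:L^2(\mathcal S,\mathrm{vol})\to\mathcal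 H_\hbar$ be the orthogonal projector, and let $T_\hbar(f)\psi=\Pi_\hbar(f\psi)$, $\psi\in\mathcal H_\hbar$, be the Berezin–Toeplitz quantization of a complex-valued Schwartz function $f$ on $\mathcal S$. Let $\mathfrak A_0=C_0(\mathcal S,\mathbb C)$ and $\mathfrak A_\hbar=\mathcal K(\mathcal H_\hbar)$ (compact operators) for $\hbar>0$, and write $T(f)$ for the family with $T(f)(0)=f$ and $T(f)(\hbar)=T_\hbar(f)$ for $\hbar>0$. Then $\mathcal S$ has complex coordinates $z=(z^1,\dots,z^N)$, complex linear for $J$, in which $\omega=\mathrm i\sum_{i}\mathrm dz^i\wedge\mathrm d\bar z^{i}$, and, for every such choice of coordinates, Berezin–Toeplitz quantization on Schwartz functions, with the star product $$f_1\star_T f_2=f_1\exp\Bigl(-\hbar\,\overset{\leftarrow}{\tfrac{\partial}{\partial z^{i}}}\,\delta^{i\bar\imath}\,\overset{\rightarrow}{\tfrac{\partial}{\partial\bar z^{\bar\imath}}}\Bigr)f_2=\sum_{k\ge0}B_k(f_1,f_2)\hbar^k,\qquad B_k(f_1,f_2)=\frac{(-1)^k}{k!}\sum_{i_1,\dots,i_k=1}^N\frac{\partial^kf_1}{\partial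 z^{i_1}\cdots\partial z^{i_k}}\,\frac{\partial^kf_2}{\partial\bar z^{i_1}\cdots\partial\bar z^{i_k}},$$ is an infinite order strict deformation quantization. That is: 1. For every $\hbar>0$, $T_\hbar$ is a linear map from the Schwartz functions to $\mathcal K(\mathcal H_\hbar)$ with $T_\hbar(\bar f)=T_\hbar(f)^*$ (and it is unital if the algebra of Schwartz functions has a unit, i.e. if $\mathcal S=0$). 2. There is a continuous field of C*-algebras over $[0,\infty)$ with fibres $(\mathfrak A_\hbar)_{\hbar\in[0,\infty)}$ such that $T(f)$ is a continuous section for every Schwartz function $f$. 3. $\star_T$ is a star product: the $B_k$ are bilinear on smooth functions, $B_0(f_1,f_2)=f_1f_2$, and $\star_T$ is associative on formal power series in $\hbar$ over $C^\infty(\mathcal S,\mathbb C)$. It is the star product of the quantization: every $B_k$ maps pairs of Schwartz functions to Schwartz functions, and for all Schwartz functions $f_1,f_2$ and all $k\in\mathbb N$, $$\lim_{\hbar\to0}\frac1{\hbar^k}\Bigl\|T_\hbar(f_1)T_\hbar(f_2)-\sum_{j=0}^kT_\hbar\bigl(B_j(f_1,f_2)\bigr)\hbar^j\Bigr\|=0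 .$$ 4. $\star_T$ is Poisson compatible: $B_1(f_1,f_2)-B_1(f_2,f_1)=\mathrm i\{f_1,f_2\}$ for smooth $f_1,f_2$. -/

import Mathlib

open MeasureTheory Filter Topology
open scoped NNReal ENNReal SchwartzMap ZeroAtInfty InnerProductSpace

noncomputable section

namespace BerezinToeplitz

universe u

/-! ### Symplectic vector spaces with an inner product -/

section LinearAlgebra

/-- A symplectic form on a real vector space. -/
structure SymplecticForm (V : Type u) [AddCommGroup V] [Module ℝ V] where
  form : V →ₗ[ℝ] V →ₗ[ℝ] ℝ
  alt : ∀ v, form v v = 0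
  nondegenerate : ∀ w, (∀ v, form v w = 0) → w = 0

variable {V : Type u} [NormedAddCommGroup V] [InnerProductSpace ℝ V] [FiniteDimensional ℝ V]

/-- The operator `E⁻¹` determined by `ω(v, w) = ⟪v, E⁻¹ w⟫`. -/
def SymplecticForm.structureOperator (ω : SymplecticForm V) : V →ₗ[ℝ] V where
  toFun w := (InnerProductSpace.toDual ℝ V).symm (LinearMap.toContinuousLinearMap (ω.form.flip w))
  map_add' := by intro v w; simp
  map_smul' := by intro c v; simp

theorem SymplecticForm.inner_structureOperator (ω : SymplecticForm V) (v w : V) :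
    ⟪v, ω.structureOperator w⟫_ℝ = ω.form v w := by
  rw [real_inner_comm]
  simp [SymplecticForm.structureOperator]

/-- The (Pauli–Jordan) operator `E`, the inverse of `structureOperator`. -/
def SymplecticForm.E (ω : SymplecticForm V) : V ≃ₗ[ℝ] V :=
  (LinearEquiv.ofInjectiveEndo ω.structureOperator (by
    rw [← LinearMap.ker_eq_bot, LinearMap.ker_eq_bot']
    intro w hw
    refine ω.nondegenerate w fun v => ?_
    rw [← ω.inner_structureOperator, hw, inner_zero_right])).symm

/-- The modulus `|T| = √(T* T)`: the positive operator which acts as multiplication by `√μ` on the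
`μ`-eigenspace of the positive symmetric operator `T* T`. -/
def modulus (T : V →ₗ[ℝ] V) : V →ₗ[ℝ] V :=
  ∑ i, √(T.isSymmetric_adjoint_comp_self.eigenvalues rfl i) •
    ((innerSL ℝ (T.isSymmetric_adjoint_comp_self.eigenvectorBasis rfl i)).toLinearMap.smulRight
      (T.isSymmetric_adjoint_comp_self.eigenvectorBasis rfl i))

/-- The complex structure `J = - E⁻¹ |E|` derived from the symplectic form and the inner product. -/
def SymplecticForm.J (ω : SymplecticForm V) : V →ₗ[ℝ] V :=
  -(ω.E.symm.toLinearMap ∘ₗ modulus ω.E.toLinearMap)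

/-- Smooth complex-valued functions. -/
abbrev Smooth (f : V → ℂ) : Prop := ContDiff ℝ ((⊤ : ℕ∞) : WithTop ℕ∞) f

/-- The Poisson bracket `{f, g} = ϖ(df, dg)`, where the Poisson bivector `ϖ` is the inverse of `ω`:
in an orthonormal basis `b` of the inner product, the matrix of `ω` is that of `E⁻¹` and the matrix
of `ϖ` is that of `E`. -/
def poissonBracket (ω : SymplecticForm V) (f g : V → ℂ) (x : V) : ℂ :=
  ∑ a, fderiv ℝ f x (ω.E (stdOrthonormalBasis ℝ V a)) * fderiv ℝ g x (stdOrthonormalBasis ℝ V a)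

/-- Complex coordinates `z = (z¹, …, z^N)` of the complex vector space `(V, J)` in which the
symplectic form is `ω = i ∑ₖ dz^k ∧ dz̄^k`. -/
structure ComplexCoordinates (ω : SymplecticForm V) (N : ℕ) where
  z : V ≃ₗ[ℝ] (Fin N → ℂ)
  map_J : ∀ v, z (ω.J v) = Complex.I • z v
  form_eq : ∀ v w, (ω.form v w : ℂ) =
    Complex.I * ∑ k, (z v k * star (z w k) - star (z v k) * z w k)

variable {ω : SymplecticForm V} {N : ℕ}

/-- The derivative `∂f/∂z^k = ½ (∂f/∂x^k - i ∂f/∂y^k)`, where `z^k = x^k + i y^k`. -/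
def ComplexCoordinates.dz (c : ComplexCoordinates ω N) (k : Fin N) (f : V → ℂ) (x : V) : ℂ :=
  (1 / 2 : ℂ) * (fderiv ℝ f x (c.z.symm (Pi.single k 1)) -
    Complex.I * fderiv ℝ f x (c.z.symm (Pi.single k Complex.I)))

/-- The derivative `∂f/∂z̄^k = ½ (∂f/∂x^k + i ∂f/∂y^k)`. -/
def ComplexCoordinates.dzbar (c : ComplexCoordinates ω N) (k : Fin N) (f : V → ℂ) (x : V) : ℂ :=
  (1 / 2 : ℂ) * (fderiv ℝ f x (c.z.symm (Pi.single k 1)) +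
    Complex.I * fderiv ℝ f x (c.z.symm (Pi.single k Complex.I)))

/-- The coefficient of `ħ^k` in `f₁ exp(-ħ ←∂_{z^i} δ^{i ī} →∂_{z̄^ī}) f₂`, that is
`(-1)^k / k! ∑_{i₁, …, i_k} (∂_{z^{i₁}} ⋯ ∂_{z^{i_k}} f₁) (∂_{z̄^{i₁}} ⋯ ∂_{z̄^{i_k}} f₂)`. -/
def ComplexCoordinates.starCoeff (c : ComplexCoordinates ω N) (k : ℕ) (f₁ f₂ : V → ℂ) (x : V) : ℂ :=
  ((-1) ^ k / (k.factorial : ℂ)) * ∑ i : Fin k → Fin N,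
    (List.ofFn i).foldr c.dz f₁ x * (List.ofFn i).foldr c.dzbar f₂ x

end LinearAlgebra

/-! ### Continuous fields, quantizations and star products -/

/-- A continuous field of C*-algebras over `I` with fibres `𝔄 i`; its (continuous) sections form a
linear subspace of `∏ i, 𝔄 i` that is closed under multiplication and involution. -/
structure ContinuousField (I : Type*) [TopologicalSpace I] (𝔄 : I → Type*)
    [∀ i, NonUnitalCStarAlgebra (𝔄 i)] where
  sections : NonUnitalStarSubalgebra ℂ (∀ i, 𝔄 i)
  dense : ∀ i, Dense {a : 𝔄 i | ∃ A ∈ sections, A i = a}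
  continuous_norm : ∀ A ∈ sections, Continuous fun i => ‖A i‖
  mem_of_locally_approx : ∀ A' : ∀ i, 𝔄 i,
    (∀ i, ∀ δ > (0 : ℝ), ∃ U ∈ 𝓝 i, ∃ A ∈ sections, ∀ j ∈ U, ‖A' j - A j‖ ≤ δ) → A' ∈ sections

/-- The non-zero values `I_* = (0, ∞)` of the quantization parameter in `I = [0, ∞)`. -/
abbrev PosParam : Type := Set.Ioi (0 : ℝ≥0)

section Fibres

variable (V : Type u) [TopologicalSpace V] (𝔄 : PosParam → Type u)

/-- Auxiliary to `Fibre`. -/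
def FibreAux (ħ : ℝ≥0) : Decidable (0 < ħ) → Type u
  | .isTrue h => 𝔄 ⟨ħ, h⟩
  | .isFalse _ => C₀(V, ℂ)

instance FibreAux.instCStar [∀ ħ, NonUnitalCStarAlgebra (𝔄 ħ)] (ħ : ℝ≥0) :
    ∀ d : Decidable (0 < ħ), NonUnitalCStarAlgebra (FibreAux V 𝔄 ħ d)
  | .isTrue h => inferInstanceAs (NonUnitalCStarAlgebra (𝔄 ⟨ħ, h⟩))
  | .isFalse _ => inferInstanceAs (NonUnitalCStarAlgebra C₀(V, ℂ))

/-- The family of C*-algebras over `I = [0, ∞)` which is `C₀(V)` at `ħ = 0` and `𝔄 ħ` at `ħ > 0`. -/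
def Fibre (ħ : ℝ≥0) : Type u := FibreAux V 𝔄 ħ (Classical.propDecidable _)

instance Fibre.instCStar [∀ ħ, NonUnitalCStarAlgebra (𝔄 ħ)] (ħ : ℝ≥0) :
    NonUnitalCStarAlgebra (Fibre V 𝔄 ħ) :=
  FibreAux.instCStar V 𝔄 ħ _

end Fibres

section Quantization

variable {V : Type u} [NormedAddCommGroup V] [InnerProductSpace ℝ V] [FiniteDimensional ℝ V]
variable {𝔄 : PosParam → Type u} [∀ ħ, NonUnitalCStarAlgebra (𝔄 ħ)]

/-- Auxiliary to `quantizationSection`. -/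
def quantizationSectionAux (Q : ∀ ħ, 𝓢(V, ℂ) →ₗ[ℂ] 𝔄 ħ) (f : 𝓢(V, ℂ)) (ħ : ℝ≥0) :
    ∀ d : Decidable (0 < ħ), FibreAux V 𝔄 ħ d
  | .isTrue h => Q ⟨ħ, h⟩ f
  | .isFalse _ => SchwartzMap.toZeroAtInftyCLM ℂ V ℂ f

/-- The section `Q(f)` of the family of C*-algebras, with value `f` at `ħ = 0` and `Q_ħ(f)` at
`ħ > 0`. -/
def quantizationSection (Q : ∀ ħ, 𝓢(V, ℂ) →ₗ[ℂ] 𝔄 ħ) (f : 𝓢(V, ℂ)) (ħ : ℝ≥0) : Fibre V 𝔄 ħ :=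
  quantizationSectionAux Q f ħ _

/-- A family of linear maps `Q_ħ` from the Schwartz functions to C*-algebras `𝔄 ħ` is a
quantization: it respects the involution, and it is unital if the algebra of Schwartz functions has
a unit (which happens only for `V = 0`). -/
structure IsQuantization (Q : ∀ ħ, 𝓢(V, ℂ) →ₗ[ℂ] 𝔄 ħ) : Prop where
  star_eq : ∀ ħ (f g : 𝓢(V, ℂ)), (∀ x, g x = star (f x)) → Q ħ g = star (Q ħ f)
  unital : ∀ e : 𝓢(V, ℂ), (∀ (f : 𝓢(V, ℂ)) x, e x * f x = f x) →
    ∀ ħ (a : 𝔄 ħ), Q ħ e * a = a ∧ a * Q ħ e = a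

/-- The maps `B k` are the coefficients of a star product `f ⋆ g = ∑ₖ B k f g ħ^k` on the formal
power series over the smooth functions. Associativity is spelled out on the coefficients of `ħ^n` of
`(f ⋆ g) ⋆ h` and `f ⋆ (g ⋆ h)`. -/
structure IsStarProduct (B : ℕ → (V → ℂ) → (V → ℂ) → V → ℂ) : Prop where
  smooth : ∀ k f g, Smooth f → Smooth g → Smooth (B k f g)
  add_left : ∀ k f f' g, Smooth f → Smooth f' → Smooth g →
    B k (f + f') g = B k f g + B k f' g
  smul_left : ∀ k (a : ℂ) f g, Smooth f → Smooth g → B k (a • f) g = a • B k f g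
  add_right : ∀ k f g g', Smooth f → Smooth g → Smooth g' →
    B k f (g + g') = B k f g + B k f g'
  smul_right : ∀ k (a : ℂ) f g, Smooth f → Smooth g → B k f (a • g) = a • B k f g
  assoc : ∀ n f g h, Smooth f → Smooth g → Smooth h →
    ∑ j ∈ Finset.range (n + 1), B j (B (n - j) f g) h =
      ∑ j ∈ Finset.range (n + 1), B j f (B (n - j) g h)
  coeff_zero : ∀ f g, Smooth f → Smooth g → B 0 f g = f * g

/-- The star product with coefficients `B k` is the star product of the quantization `Q`: the `B k`
map pairs of Schwartz functions to Schwartz functions, and for all Schwartz functions `f, g` and all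
orders `k`, `ħ^{-k} ‖Q_ħ(f) Q_ħ(g) - ∑_{j ≤ k} Q_ħ(B j f g) ħ^j‖ → 0` as `ħ → 0`. -/
structure IsQuantizationStarProduct (Q : ∀ ħ, 𝓢(V, ℂ) →ₗ[ℂ] 𝔄 ħ)
    (B : ℕ → (V → ℂ) → (V → ℂ) → V → ℂ) : Prop where
  isStarProduct : IsStarProduct B
  schwartz : ∀ k (f g : 𝓢(V, ℂ)), ∃ h : 𝓢(V, ℂ), ⇑h = B k f g
  tendsto_remainder : ∀ (k : ℕ) (f g : 𝓢(V, ℂ)) (b : ℕ → 𝓢(V, ℂ)), (∀ j, ⇑(b j) = B j f g) →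
    Tendsto (fun ħ : PosParam =>
        1 / ((ħ : ℝ≥0) : ℝ) ^ k *
          ‖Q ħ f * Q ħ g - ∑ j ∈ Finset.range (k + 1), ((((ħ : ℝ≥0) : ℝ) : ℂ) ^ j) • Q ħ (b j)‖)
      (comap (fun ħ : PosParam => (ħ : ℝ≥0)) (𝓝 0)) (𝓝 0)

/-- `Q` is an infinite order strict deformation quantization, over the Schwartz functions on the
symplectic vector space `V`, whose star product has the coefficients `B k`: the sections `Q(f)`
belong to a continuous field of C*-algebras with fibres `C₀(V)` at `ħ = 0` and `𝔄 ħ` at `ħ > 0`,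
the `B k` form the star product of `Q`, and this star product is Poisson compatible. -/
structure IsInfiniteOrderStrictDeformationQuantization
    (ω : SymplecticForm V) (Q : ∀ ħ, 𝓢(V, ℂ) →ₗ[ℂ] 𝔄 ħ)
    (B : ℕ → (V → ℂ) → (V → ℂ) → V → ℂ) : Prop where
  isQuantization : IsQuantization Q
  exists_field : ∃ Γ : ContinuousField ℝ≥0 (Fibre V 𝔄),
    ∀ f : 𝓢(V, ℂ), quantizationSection Q f ∈ Γ.sections
  isQuantizationStarProduct : IsQuantizationStarProduct Q B
  poisson_compatible : ∀ f g, Smooth f → Smooth g →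
    B 1 f g - B 1 g f = Complex.I • poissonBracket ω f g

end Quantization

/-! ### The C*-algebra of compact operators -/

section Compact

variable (H : Type u) [NormedAddCommGroup H] [InnerProductSpace ℂ H] [CompleteSpace H]

variable {H} in
theorem isCompactOperator_adjoint {T : H →L[ℂ] H} (hT : IsCompactOperator T) :
    IsCompactOperator (ContinuousLinearMap.adjoint T) := by
  set A := ContinuousLinearMap.adjoint T with hA
  have hS : IsCompactOperator ((T ∘L A).toLinearMap) := hT.comp_clm _
  have h1 : TotallyBounded ((T ∘L A).toLinearMap '' Metric.closedBall 0 1) :=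
    ((isCompactOperator_iff_isCompact_closure_image_closedBall (T ∘L A).toLinearMap one_pos).1
      hS).totallyBounded.subset subset_closure
  refine (isCompactOperator_iff_isCompact_closure_image_closedBall A.toLinearMap one_pos).2 ?_
  refine TotallyBounded.isCompact_of_isClosed (TotallyBounded.closure ?_) isClosed_closure
  rw [Metric.totallyBounded_iff]
  intro ε hε
  obtain ⟨t, hts, htf, ht⟩ := Metric.finite_approx_of_totallyBounded h1 (ε ^ 2 / 4) (by positivity)
  have hts' : ∀ y ∈ t, ∃ x ∈ Metric.closedBall (0 : H) 1, (T ∘L A).toLinearMap x = y :=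
    fun y hy => hts hy
  choose! p hp hpe using hts'
  refine ⟨(fun y => A (p y)) '' t, htf.image _, ?_⟩
  rintro _ ⟨x, hx, rfl⟩
  obtain ⟨y, hy, hxy⟩ := Set.mem_iUnion₂.1 (ht ⟨x, hx, rfl⟩)
  refine Set.mem_iUnion₂.2 ⟨A (p y), ⟨y, hy, rfl⟩, ?_⟩
  rw [Metric.mem_ball, dist_eq_norm] at hxy ⊢
  have hn : ‖x - p y‖ ≤ 2 := by
    have := norm_sub_le x (p y)
    have h2 := mem_closedBall_zero_iff.1 hx
    have h3 := mem_closedBall_zero_iff.1 (hp y hy)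
    linarith
  have h4 : ‖T (A (x - p y))‖ ≤ ε ^ 2 / 4 := by
    have : T (A (x - p y)) = (T ∘L A).toLinearMap x - y := by
      have h := hpe y hy
      simp only [ContinuousLinearMap.coe_coe, ContinuousLinearMap.comp_apply, map_sub] at h ⊢
      rw [h]
    rw [this]; exact hxy.le
  have h5 : ‖A (x - p y)‖ ^ 2 ≤ ‖x - p y‖ * ‖T (A (x - p y))‖ := by
    rw [← inner_self_eq_norm_sq (𝕜 := ℂ), hA, ContinuousLinearMap.adjoint_inner_left]
    exact (RCLike.re_le_norm _).trans (norm_inner_le_norm _ _)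
  have h6 : ‖A (x - p y)‖ ^ 2 < ε ^ 2 := by
    have : ‖x - p y‖ * ‖T (A (x - p y))‖ ≤ 2 * (ε ^ 2 / 4) :=
      mul_le_mul hn h4 (norm_nonneg _) (by norm_num)
    nlinarith [sq_pos_of_pos hε]
  have h7 := lt_of_pow_lt_pow_left₀ 2 hε.le h6
  simpa using h7

/-- The C*-algebra of compact operators on a Hilbert space. -/
def compactOperators : NonUnitalStarSubalgebra ℂ (H →L[ℂ] H) where
  carrier := {T | IsCompactOperator T}
  add_mem' ha hb := ha.add hb
  zero_mem' := isCompactOperator_zero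
  mul_mem' {_ b} ha _ := ha.comp_clm b
  smul_mem' c _ ha := ha.smul c
  star_mem' ha := isCompactOperator_adjoint ha

/-- The compact operators on `H` as a type. -/
abbrev CompactOperators : Type u := compactOperators H

instance : IsClosed (compactOperators H : Set (H →L[ℂ] H)) :=
  isClosed_setOfPred_isCompactOperator

end Compact

/-! ### Geometric quantization and Toeplitz operators -/

section Toeplitz

variable {V : Type u} [NormedAddCommGroup V] [InnerProductSpace ℝ V] [FiniteDimensional ℝ V]
variable [MeasurableSpace V] [BorelSpace V]

/-- The symplectic volume `|ω^N / N!|` on the `2N`-dimensional space `V`. It is the volume of the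
inner product times the absolute value `√(det E⁻¹)` of the Pfaffian of the matrix of `ω` in an
orthonormal basis. -/
def symplecticVolume (ω : SymplecticForm V) : Measure V :=
  ENNReal.ofReal √(LinearMap.det ω.structureOperator) • volume

/-- The connection `∇_ħ = d + (i/ħ) θ` of the trivial quantization bundle, in the gauge
`θ_x(v) = -½ ω(x, v)` of the symplectic potential (so that `ω = -dθ`). -/
def connection (ω : SymplecticForm V) (ħ : ℝ) (ψ : V → ℂ) (x v : V) : ℂ :=
  fderiv ℝ ψ x v + Complex.I / (ħ : ℂ) * ((-(1 / 2) * ω.form x v : ℝ) : ℂ) * ψ x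

/-- Sections which are holomorphic for `J`: smooth and annihilated by `∇_{ħ, v + i J v}` for all
`v ∈ V`. -/
def IsHolomorphicSection (ω : SymplecticForm V) (ħ : ℝ) (ψ : V → ℂ) : Prop :=
  Smooth ψ ∧
    ∀ x v, connection ω ħ ψ x v + Complex.I * connection ω ħ ψ x (ω.J v) = 0

/-- The physical Hilbert space `H_ħ` (Fock space): the closed subspace of `L²(V)`, with respect to
the symplectic volume, spanned by the square-integrable holomorphic sections. -/
def physicalSpace (ω : SymplecticForm V) (ħ : ℝ) : Submodule ℂ (Lp ℂ 2 (symplecticVolume ω)) :=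
  (Submodule.span ℂ {ψ : Lp ℂ 2 (symplecticVolume ω) | ∃ φ : V → ℂ, IsHolomorphicSection ω ħ φ ∧
    ⇑ψ =ᵐ[symplecticVolume ω] φ}).topologicalClosure

instance (ω : SymplecticForm V) (ħ : ℝ) : CompleteSpace (physicalSpace ω ħ) :=
  Submodule.topologicalClosure.completeSpace _

/-- Multiplication by a Schwartz function on `L²`. -/
def multiplication (μ : Measure V) : 𝓢(V, ℂ) →ₗ[ℂ] (Lp ℂ 2 μ →L[ℂ] Lp ℂ 2 μ) where
  toFun f := (ContinuousLinearMap.mul ℂ ℂ).holderL μ ∞ 2 2 (f.memLp_top μ).toLp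
  map_add' f g := by
    rw [← map_add]
    congr 1
  map_smul' c f := by
    rw [RingHom.id_apply, ← map_smul]
    congr 1

/-- The Toeplitz operator `T_ħ(f) ψ = Π_ħ(f ψ)` on `H_ħ`. -/
def toeplitz (ω : SymplecticForm V) (ħ : ℝ) :
    𝓢(V, ℂ) →ₗ[ℂ] (physicalSpace ω ħ →L[ℂ] physicalSpace ω ħ) where
  toFun f := (physicalSpace ω ħ).orthogonalProjectionOnto ∘L
    multiplication (symplecticVolume ω) f ∘L (physicalSpace ω ħ).subtypeL
  map_add' f g := by ext; simp
  map_smul' c f := by ext; simp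

/-- The quantum algebra at `ħ > 0`: the C*-algebra of compact operators on `H_ħ`. -/
abbrev QuantumAlgebra (ω : SymplecticForm V) (ħ : PosParam) : Type u :=
  CompactOperators (physicalSpace ω (ħ : ℝ≥0))

/-- Toeplitz quantization as a family of maps to the C*-algebras of compact operators on `H_ħ`,
given that all Toeplitz operators of Schwartz functions are compact. -/
def toeplitzQuantization (ω : SymplecticForm V)
    (hT : ∀ (ħ : PosParam) (f : 𝓢(V, ℂ)), IsCompactOperator (toeplitz ω (ħ : ℝ≥0) f))
    (ħ : PosParam) : 𝓢(V, ℂ) →ₗ[ℂ] QuantumAlgebra ω ħ where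
  toFun f := ⟨toeplitz ω (ħ : ℝ≥0) f, hT ħ f⟩
  map_add' f g := by ext1; simp
  map_smul' c f := by ext1; simp

end Toeplitz

end BerezinToeplitz

end

open BerezinToeplitz

open BerezinToeplitz

set_option linter.style.haveILetI false
set_option linter.unusedSectionVars false

namespace BerezinToeplitz

/-! ### The modulus of `E`, the complex structure `J`, unitary coordinates and the Poisson bivector
-/

section LinearAlgebra

variable {V : Type*} [NormedAddCommGroup V] [InnerProductSpace ℝ V] [FiniteDimensional ℝ V]

/-! Write h(x, y) = ∑ z^k(x) z̄^k(y), so that ω(x, y) = i (h(x, y) - h(y, x)). Such coordinates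
exist because ω(·, J·) is ⟨·, |E|⁻¹ ·⟩, a symmetric positive definite form. Holomorphic sections are
holomorphic functions times exp(-h(x, x)/2ħ). The mean value property on complex lines, integrated
against a Gaussian, shows that the coherent states e_y(x) = exp((h(x, y) - h(x, x)/2 - h(y, y)/2)/ħ)
reproduce the whole Hilbert space: ⟨e_x, ψ⟩ is a constant times ψ(x) (`integral_star_coh_mul`,
`ae_eq_inner_cohVec`). Hence they are total, and T_ħ(f) is a norm convergent integral of rank one
operators weighted by f, which is compact.

The product formula is computed on characters χ_u(x) = exp(h(x, u) - h(u, x)). Their Toeplitz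
operators W(u) are contractions that move coherent states to multiples of coherent states, and W(u)
W(v) = exp(ħ h(v, u)) W(u + v) (`weyl_mul_weyl`). Fourier inversion writes T_ħ(f) weakly as a
superposition of the W(u). Since ∂/∂z^k and ∂/∂z̄^k multiply χ_u by z̄^k(u) and -z^k(u), the j-th
term of the series of exp(ħ h(v, u)) is exactly ħ^j T_ħ(B_j(f, g)). The exponential may be large,
but its remainder is at most |w|^n/n! · max(1, e^{Re w}), and e^w times a matrix element of W(u + v)
is a matrix element of a product of two contractions. So the remainder after n terms is at most
(ħM)^n/n! times n-th Fourier moments of f and g (`norm_toeplitz_mul_sub_le`); n = k + 1 gives the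
expansion to order k.

The continuous field consists of all families that are locally uniformly approximated by sections
T(f) (`exists_continuousField`). Three facts are needed. Products of such sections are approximable:
for band limited functions the remainder tends to 0 as n → ∞, locally uniformly in ħ
(`exists_mul_approx`). Norms are continuous: for ħ > 0 a dilation converts a change of ħ into a
change of f, and at ħ = 0 the bound by the supremum norm is matched from below by the Berezin
transform. The images are dense: the closure of the range is an algebra, contains the coherent state
projections as limits of concentrated f, hence their products |e_x⟩⟨e_y|, hence all compact
operators.

Associativity of the star product is an algebraic recursion obtained by differentiating in ħ, and
Poisson compatibility is a computation of the bivector in the coordinates z. -/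

theorem modulus_apply (T : V →ₗ[ℝ] V) (v : V) :
    modulus T v = ∑ i, √(T.isSymmetric_adjoint_comp_self.eigenvalues rfl i) •
      ⟪T.isSymmetric_adjoint_comp_self.eigenvectorBasis rfl i, v⟫_ℝ •
        T.isSymmetric_adjoint_comp_self.eigenvectorBasis rfl i := by
  simp [modulus]

/-- By symmetry of T*T, an eigenvector is orthogonal to the basis vectors with other eigenvalues, so
only terms with one and the same eigenvalue survive. This frees the modulus from the eigenbasis
chosen in its definition. -/
theorem modulus_eq_of_eigenvector (T : V →ₗ[ℝ] V) {v : V} {m : ℝ}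
    (hv : (LinearMap.adjoint T ∘ₗ T) v = m • v) : modulus T v = √m • v := by
  rw [modulus_apply]
  conv_rhs => rw [← (T.isSymmetric_adjoint_comp_self.eigenvectorBasis rfl).sum_repr' v,
    Finset.smul_sum]
  refine Finset.sum_congr rfl fun i _ => ?_
  set b := T.isSymmetric_adjoint_comp_self.eigenvectorBasis rfl with hb
  have h1 : ⟪(LinearMap.adjoint T ∘ₗ T) (b i), v⟫_ℝ = ⟪b i, (LinearMap.adjoint T ∘ₗ T) v⟫_ℝ :=
    T.isSymmetric_adjoint_comp_self _ _
  rw [hv, hb, T.isSymmetric_adjoint_comp_self.apply_eigenvectorBasis rfl i, ← hb,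
    inner_smul_right, real_inner_smul_left] at h1
  by_cases h0 : ⟪b i, v⟫_ℝ = 0
  · simp [h0]
  · have h2 := mul_right_cancel₀ h0 h1
    simp only [RCLike.ofReal_real_eq_id, id_eq] at h2
    rw [h2]

theorem modulus_modulus (T : V →ₗ[ℝ] V) (v : V) :
    modulus T (modulus T v) = LinearMap.adjoint T (T v) := by
  have : modulus T ∘ₗ modulus T = LinearMap.adjoint T ∘ₗ T := by
    refine (T.isSymmetric_adjoint_comp_self.eigenvectorBasis rfl).toBasis.ext fun i => ?_
    have h := T.isSymmetric_adjoint_comp_self.apply_eigenvectorBasis rfl i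
    have h0 : 0 ≤ T.isSymmetric_adjoint_comp_self.eigenvalues rfl i := by
      have h1 := congrArg
        (fun w => ⟪T.isSymmetric_adjoint_comp_self.eigenvectorBasis rfl i, w⟫_ℝ) h
      simp only [LinearMap.comp_apply, inner_smul_right, LinearMap.adjoint_inner_right] at h1
      rw [real_inner_self_eq_norm_sq, real_inner_self_eq_norm_sq, OrthonormalBasis.norm_eq_one] at h1
      simp at h1
      rw [← h1]; positivity
    simp only [OrthonormalBasis.coe_toBasis]
    rw [h, LinearMap.comp_apply, modulus_eq_of_eigenvector T h, map_smul,
      modulus_eq_of_eigenvector T h, smul_smul]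
    simp only [RCLike.ofReal_real_eq_id, id_eq]
    rw [Real.mul_self_sqrt h0]
  exact LinearMap.congr_fun this v

/-- An operator that commutes with T*T preserves its eigenspaces, on which the modulus is a scalar.
-/
theorem modulus_comm (T C : V →ₗ[ℝ] V)
    (h : ∀ v, LinearMap.adjoint T (T (C v)) = C (LinearMap.adjoint T (T v))) (v : V) :
    modulus T (C v) = C (modulus T v) := by
  have : modulus T ∘ₗ C = C ∘ₗ modulus T := by
    refine (T.isSymmetric_adjoint_comp_self.eigenvectorBasis rfl).toBasis.ext fun i => ?_
    have h1 := T.isSymmetric_adjoint_comp_self.apply_eigenvectorBasis rfl i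
    simp only [OrthonormalBasis.coe_toBasis, LinearMap.comp_apply]
    rw [modulus_eq_of_eigenvector T h1, map_smul, modulus_eq_of_eigenvector T]
    rw [LinearMap.comp_apply, h, ← LinearMap.comp_apply (LinearMap.adjoint T), h1, map_smul]
  exact LinearMap.congr_fun this v

theorem modulus_symm (T : V →ₗ[ℝ] V) (v w : V) : ⟪modulus T v, w⟫_ℝ = ⟪v, modulus T w⟫_ℝ := by
  simp only [modulus_apply, sum_inner, inner_sum, real_inner_smul_left, inner_smul_right]
  refine Finset.sum_congr rfl fun i _ => ?_
  rw [real_inner_comm v]; ring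

theorem inner_modulus_nonneg (T : V →ₗ[ℝ] V) (v : V) : 0 ≤ ⟪v, modulus T v⟫_ℝ := by
  simp only [modulus_apply, inner_sum, inner_smul_right]
  refine Finset.sum_nonneg fun i _ => ?_
  rw [real_inner_comm v]; exact mul_nonneg (Real.sqrt_nonneg _) (mul_self_nonneg _)

theorem modulus_eq_zero_of_inner (T : V →ₗ[ℝ] V) (v : V) (h : ⟪v, modulus T v⟫_ℝ = 0) :
    modulus T v = 0 := by
  simp only [modulus_apply, inner_sum, inner_smul_right] at h
  rw [Finset.sum_eq_zero_iff_of_nonneg] at h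
  · rw [modulus_apply]
    refine Finset.sum_eq_zero fun i hi => ?_
    have := h i hi
    rw [real_inner_comm v] at this
    rcases mul_eq_zero.1 this with h | h
    · rw [h, zero_smul]
    · rw [real_inner_comm, mul_self_eq_zero.1 h]; simp
  · intro i _
    rw [real_inner_comm v]; exact mul_nonneg (Real.sqrt_nonneg _) (mul_self_nonneg _)

variable (ω : SymplecticForm V)

theorem SymplecticForm.neg_swap (v w : V) : ω.form v w = -ω.form w v := by
  have := ω.alt (v + w)
  simp only [map_add, LinearMap.add_apply, ω.alt] at this
  linarith

theorem SymplecticForm.structureOperator_E (v : V) : ω.structureOperator (ω.E v) = v :=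
  ω.E.symm_apply_apply v

theorem SymplecticForm.E_structureOperator (v : V) : ω.E (ω.structureOperator v) = v :=
  ω.E.apply_symm_apply v

theorem SymplecticForm.inner_E (v w : V) : ⟪ω.E v, w⟫_ℝ = -⟪v, ω.E w⟫_ℝ := by
  have h1 := ω.inner_structureOperator (ω.E v) (ω.E w)
  have h2 := ω.inner_structureOperator (ω.E w) (ω.E v)
  rw [structureOperator_E] at h1 h2
  rw [h1, ω.neg_swap, ← h2, real_inner_comm]

theorem SymplecticForm.adjoint_E (v : V) :
    LinearMap.adjoint ω.E.toLinearMap v = -ω.E v := by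
  refine ext_inner_right ℝ fun w => ?_
  rw [LinearMap.adjoint_inner_left, inner_neg_left, ω.inner_E]
  simp

theorem SymplecticForm.modulus_modulus (v : V) :
    modulus ω.E.toLinearMap (modulus ω.E.toLinearMap v) = -ω.E (ω.E v) := by
  rw [BerezinToeplitz.modulus_modulus, ω.adjoint_E]; rfl

/-- E is antisymmetric, so E*E = -E² commutes with E⁻¹, and then so does |E|. This is what makes J²
= E⁻²|E|² = -1. -/
theorem SymplecticForm.modulus_structureOperator (v : V) :
    modulus ω.E.toLinearMap (ω.structureOperator v) =
      ω.structureOperator (modulus ω.E.toLinearMap v) := by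
  refine modulus_comm _ _ (fun w => ?_) v
  rw [ω.adjoint_E, ω.adjoint_E]
  simp [ω.structureOperator_E, ω.E_structureOperator]

theorem SymplecticForm.J_apply (v : V) :
    ω.J v = -ω.structureOperator (modulus ω.E.toLinearMap v) := rfl

theorem SymplecticForm.J_J (v : V) : ω.J (ω.J v) = -v := by
  simp only [J_apply, map_neg, neg_neg, ω.modulus_structureOperator, ω.modulus_modulus,
    ω.structureOperator_E]

theorem SymplecticForm.modulus_surjective (v : V) : ∃ u, modulus ω.E.toLinearMap u = v :=
  ⟨modulus ω.E.toLinearMap (-ω.structureOperator (ω.structureOperator v)), by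
    simp [ω.modulus_modulus, ω.E_structureOperator]⟩

/-- J|E| = -E⁻¹|E|² = E. Since |E| is onto, this identifies ω(·, J·) with ⟨·, |E|⁻¹ ·⟩, from which
its symmetry and positivity are read off by substituting v = |E|u. -/
theorem SymplecticForm.form_modulus_J (v u : V) :
    ω.form v (ω.J (modulus ω.E.toLinearMap u)) = ⟪v, u⟫_ℝ := by
  rw [← ω.inner_structureOperator, J_apply, ω.modulus_modulus]
  simp [ω.structureOperator_E]

theorem SymplecticForm.form_J_symm (v w : V) : ω.form v (ω.J w) = ω.form w (ω.J v) := by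
  obtain ⟨u, rfl⟩ := ω.modulus_surjective v
  obtain ⟨u', rfl⟩ := ω.modulus_surjective w
  rw [form_modulus_J, form_modulus_J, modulus_symm, real_inner_comm]

theorem SymplecticForm.form_J_self_nonneg (v : V) : 0 ≤ ω.form v (ω.J v) := by
  obtain ⟨u, rfl⟩ := ω.modulus_surjective v
  rw [form_modulus_J, real_inner_comm]
  exact inner_modulus_nonneg _ _

theorem SymplecticForm.form_J_self_eq_zero (v : V) (h : ω.form v (ω.J v) = 0) : v = 0 := by
  obtain ⟨u, rfl⟩ := ω.modulus_surjective v
  rw [form_modulus_J, real_inner_comm] at h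
  exact modulus_eq_zero_of_inner _ _ h

/-- A real vector space with a complex structure and a compatible, positive symplectic form has
complex coordinates in which the form is the standard one. -/
theorem exists_unitary_coordinates {W : Type*} [AddCommGroup W] [Module ℝ W]
    [FiniteDimensional ℝ W] (J : W →ₗ[ℝ] W) (hJ : ∀ v, J (J v) = -v) (B : W →ₗ[ℝ] W →ₗ[ℝ] ℝ)
    (hB : ∀ v w, B v w = -B w v) (hs : ∀ v w, B v (J w) = B w (J v)) (hp : ∀ v, 0 ≤ B v (J v))
    (hd : ∀ v, B v (J v) = 0 → v = 0) :
    ∃ (N : ℕ) (z : W ≃ₗ[ℝ] (Fin N → ℂ)), (∀ v, z (J v) = Complex.I • z v) ∧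
      ∀ v w, (B v w : ℂ) = Complex.I * ∑ k, (z v k * star (z w k) - star (z v k) * z w k) := by
  -- W becomes a complex vector space in which i acts as J.
  letI mod : Module ℂ W := Module.compHom W
    (Complex.lift ⟨(J : Module.End ℝ W), by ext v; simp [hJ]⟩).toRingHom
  have smul_def : ∀ (a : ℂ) (v : W), a • v = a.re • v + a.im • J v := by
    intro a v
    change (Complex.lift ⟨(J : Module.End ℝ W), _⟩ a) v = _
    simp [Complex.lift, Complex.liftAux_apply]
  haveI : IsScalarTower ℝ ℂ W := ⟨fun r a v => by
    simp [smul_def, smul_add, mul_smul]⟩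
  haveI : FiniteDimensional ℂ W := Module.Finite.of_restrictScalars_finite ℝ ℂ W
  -- The hermitian product is ½(B(v, Jw) + i B(v, w)). The factor ½ is forced by the normalisation
  -- of the coordinates: in an orthonormal basis i ∑ (z z̄' - z̄ z') equals 2 Im ⟪v, w⟫, which has
  -- to be B(v, w).
  let core : InnerProductSpace.Core ℂ W :=
    { inner := fun v w => ⟨B v (J w) / 2, B v w / 2⟩
      conj_inner_symm := fun v w => by
        apply Complex.ext <;> simp
        · rw [hs]
        · rw [hB]; ring
      re_inner_nonneg := fun v => by
        have := hp v
        change 0 ≤ B v (J v) / 2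
        linarith
      add_left := fun u v w => by
        apply Complex.ext <;> simp <;> ring
      smul_left := fun v w a => by
        have h1 : B (J v) (J w) = B v w := by
          rw [hs, hJ, map_neg, hB]; ring
        have h2 : B (J v) w = -B v (J w) := by rw [hB, hs]
        apply Complex.ext <;> simp [smul_def, h1, h2] <;> ring
      definite := fun v h => by
        apply hd
        have := congrArg Complex.re h
        change B v (J v) / 2 = 0 at this
        linarith }
  letI : NormedAddCommGroup W := core.toNormedAddCommGroup
  letI : InnerProductSpace ℂ W := InnerProductSpace.ofCore core.toCore
  have inner_def : ∀ v w : W, ⟪v, w⟫_ℂ = ⟨B v (J w) / 2, B v w / 2⟩ := fun _ _ => rfl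
  let b := stdOrthonormalBasis ℂ W
  refine ⟨Module.finrank ℂ W, (b.repr.toLinearEquiv.trans (WithLp.linearEquiv 2 ℂ _)).restrictScalars ℝ, ?_, ?_⟩
  · intro v
    have : J v = Complex.I • v := by simp [smul_def]
    rw [this]
    simp
  · intro v w
    have h : ⟪v, w⟫_ℂ = ∑ k, star (b.repr v k) * b.repr w k := by
      rw [← b.repr.inner_map_map, PiLp.inner_apply]
      simp [mul_comm]
    have h' : ⟪w, v⟫_ℂ = ∑ k, b.repr v k * star (b.repr w k) := by
      rw [← b.repr.inner_map_map, PiLp.inner_apply]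
      simp
    change (B v w : ℂ) = Complex.I * ∑ k, (b.repr v k * star (b.repr w k) - star (b.repr v k) * b.repr w k)
    rw [Finset.sum_sub_distrib, ← h, ← h', inner_def, inner_def]
    apply Complex.ext <;> simp
    · rw [hB w v]; ring
    · rw [hs]; ring

theorem SymplecticForm.exists_complexCoordinates :
    ∃ N : ℕ, Nonempty (ComplexCoordinates ω N) := by
  obtain ⟨N, z, h1, h2⟩ := exists_unitary_coordinates ω.J ω.J_J ω.form ω.neg_swap ω.form_J_symm
    ω.form_J_self_nonneg ω.form_J_self_eq_zero
  exact ⟨N, ⟨⟨z, h1, h2⟩⟩⟩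

variable {ω} {N : ℕ} (c : ComplexCoordinates ω N)

/-- Up to a factor ±2, the real and imaginary parts of z^k are pairings under ω with coordinate
vectors. Since ω(p, Ev) = ⟨p, v⟩, this gives the coordinates of E, and later of Fourier frequencies.
-/
theorem ComplexCoordinates.form_single_one (k : Fin N) (w : V) :
    ω.form (c.z.symm (Pi.single k 1)) w = 2 * (c.z w k).im := by
  have h := c.form_eq (c.z.symm (Pi.single k 1)) w
  rw [Finset.sum_eq_single k] at h
  · have h2 := congrArg Complex.re h
    simp at h2
    linarith
  · intro j _ hj; simp [hj]
  · simp

theorem ComplexCoordinates.form_single_I (k : Fin N) (w : V) :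
    ω.form (c.z.symm (Pi.single k Complex.I)) w = -2 * (c.z w k).re := by
  have h := c.form_eq (c.z.symm (Pi.single k Complex.I)) w
  rw [Finset.sum_eq_single k] at h
  · have h2 := congrArg Complex.re h
    simp at h2
    linarith
  · intro j _ hj; simp [hj]
  · simp

theorem ComplexCoordinates.sum_single (w : V) :
    w = ∑ k, ((c.z w k).re • c.z.symm (Pi.single k 1) +
      (c.z w k).im • c.z.symm (Pi.single k Complex.I)) := by
  apply c.z.injective
  simp only [map_sum, map_add, map_smul, LinearEquiv.apply_symm_apply]
  ext j
  rw [Finset.sum_apply, Finset.sum_eq_single j]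
  · apply Complex.ext <;> simp
  · intro k _ hk; simp [Ne.symm hk]
  · simp

theorem ComplexCoordinates.E_apply (v : V) :
    ω.E v = ∑ k, ((1 / 2 * ⟪c.z.symm (Pi.single k 1), v⟫_ℝ) • c.z.symm (Pi.single k Complex.I) -
      (1 / 2 * ⟪c.z.symm (Pi.single k Complex.I), v⟫_ℝ) • c.z.symm (Pi.single k 1)) := by
  conv_lhs => rw [c.sum_single (ω.E v)]
  refine Finset.sum_congr rfl fun k _ => ?_
  have h1 := c.form_single_one k (ω.E v)
  have h2 := c.form_single_I k (ω.E v)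
  rw [← ω.inner_structureOperator, ω.structureOperator_E] at h1 h2
  rw [h1, h2, add_comm, sub_eq_add_neg, ← neg_smul]
  congr 2 <;> ring

/-- The Poisson bivector in complex coordinates. -/
theorem ComplexCoordinates.sum_E (L M : V →L[ℝ] ℂ) :
    ∑ a, L (ω.E (stdOrthonormalBasis ℝ V a)) * M (stdOrthonormalBasis ℝ V a) =
      (1 / 2 : ℂ) * ∑ k, (L (c.z.symm (Pi.single k Complex.I)) * M (c.z.symm (Pi.single k 1)) -
        L (c.z.symm (Pi.single k 1)) * M (c.z.symm (Pi.single k Complex.I))) := by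
  have hM : ∀ p : V, M p = ∑ a, (⟪p, stdOrthonormalBasis ℝ V a⟫_ℝ : ℂ) *
      M (stdOrthonormalBasis ℝ V a) := by
    intro p
    conv_lhs => rw [← (stdOrthonormalBasis ℝ V).sum_repr' p, map_sum]
    refine Finset.sum_congr rfl fun a _ => ?_
    rw [map_smul, real_inner_comm]; simp
  simp only [c.E_apply, map_sum, map_sub, map_smul, Finset.sum_mul]
  rw [Finset.sum_comm, Finset.mul_sum]
  refine Finset.sum_congr rfl fun k _ => ?_
  rw [hM (c.z.symm (Pi.single k 1)), hM (c.z.symm (Pi.single k Complex.I)), Finset.mul_sum,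
    Finset.mul_sum, ← Finset.sum_sub_distrib, Finset.mul_sum]
  refine Finset.sum_congr rfl fun a _ => ?_
  simp only [Complex.real_smul]; push_cast; ring

theorem ComplexCoordinates.starCoeff_one (f g : V → ℂ) (x : V) :
    c.starCoeff 1 f g x = -∑ k, c.dz k f x * c.dzbar k g x := by
  simp only [ComplexCoordinates.starCoeff, pow_one, Nat.factorial_one, Nat.cast_one, div_one,
    neg_mul, one_mul]
  rw [← (Equiv.funUnique (Fin 1) (Fin N)).symm.sum_comp]
  simp

/-- With z^k = x^k + i y^k, antisymmetrising -∂_{z^k} f ∂_{z̄^k} g leaves (i/2)(∂_{y^k} f ∂_{x^k} g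
- ∂_{x^k} f ∂_{y^k} g), which is i times the k-th term of the bivector in `sum_E`. -/
theorem ComplexCoordinates.poisson_compatible (f g : V → ℂ) :
    c.starCoeff 1 f g - c.starCoeff 1 g f = Complex.I • poissonBracket ω f g := by
  ext x
  rw [Pi.sub_apply, Pi.smul_apply, poissonBracket, c.sum_E, starCoeff_one, starCoeff_one,
    smul_eq_mul, ← mul_assoc, Finset.mul_sum, ← neg_add', ← sub_eq_zero]
  rw [sub_eq_add_neg, ← neg_add, neg_eq_zero, ← sub_eq_add_neg, ← Finset.sum_sub_distrib,
    ← Finset.sum_add_distrib]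
  refine Finset.sum_eq_zero fun k _ => ?_
  simp only [ComplexCoordinates.dz, ComplexCoordinates.dzbar]
  ring_nf

end LinearAlgebra

end BerezinToeplitz

noncomputable section

namespace BerezinToeplitz

/-! ### Associativity of the exponential star product in an abstract commutative algebra -/

section WickAlgebra

variable {A : Type*} [CommRing A] [Algebra ℂ A] {N : ℕ}

/-- The coefficients of the star product `f exp(-ħ ←D_i →D'_i) g` for two families of operators on
a commutative algebra. -/
def wickCoeff (D D' : Fin N → A →ₗ[ℂ] A) (k : ℕ) (f g : A) : A :=
  ((-1) ^ k / (k.factorial : ℂ)) • ∑ i : Fin k → Fin N,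
    (List.ofFn i).foldr (fun j => D j) f * (List.ofFn i).foldr (fun j => D' j) g

theorem foldr_comm (D : Fin N → A →ₗ[ℂ] A) (T : A →ₗ[ℂ] A) (h : ∀ i f, T (D i f) = D i (T f))
    (l : List (Fin N)) (f : A) :
    T (l.foldr (fun j => D j) f) = l.foldr (fun j => D j) (T f) := by
  induction l with
  | nil => rfl
  | cons a l ih => simp only [List.foldr_cons, h, ih]

theorem foldr_add (D : Fin N → A →ₗ[ℂ] A) (l : List (Fin N)) (f g : A) :
    l.foldr (fun j => D j) (f + g) = l.foldr (fun j => D j) f + l.foldr (fun j => D j) g := by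
  induction l with
  | nil => rfl
  | cons a l ih => simp only [List.foldr_cons, ih, map_add]

theorem foldr_smul (D : Fin N → A →ₗ[ℂ] A) (l : List (Fin N)) (a : ℂ) (f : A) :
    l.foldr (fun j => D j) (a • f) = a • l.foldr (fun j => D j) f := by
  induction l with
  | nil => rfl
  | cons a l ih => simp only [List.foldr_cons, ih, map_smul]

variable (D D' : Fin N → A →ₗ[ℂ] A)

theorem wickCoeff_zero (f g : A) : wickCoeff D D' 0 f g = f * g := by
  simp [wickCoeff]

theorem wickCoeff_add_left (k : ℕ) (f f' g : A) :
    wickCoeff D D' k (f + f') g = wickCoeff D D' k f g + wickCoeff D D' k f' g := by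
  simp only [wickCoeff, foldr_add, add_mul, Finset.sum_add_distrib, smul_add]

theorem wickCoeff_add_right (k : ℕ) (f g g' : A) :
    wickCoeff D D' k f (g + g') = wickCoeff D D' k f g + wickCoeff D D' k f g' := by
  simp only [wickCoeff, foldr_add, mul_add, Finset.sum_add_distrib, smul_add]

theorem wickCoeff_smul_left (k : ℕ) (a : ℂ) (f g : A) :
    wickCoeff D D' k (a • f) g = a • wickCoeff D D' k f g := by
  simp only [wickCoeff, foldr_smul, smul_mul_assoc, ← Finset.smul_sum]
  rw [smul_comm]

theorem wickCoeff_smul_right (k : ℕ) (a : ℂ) (f g : A) :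
    wickCoeff D D' k f (a • g) = a • wickCoeff D D' k f g := by
  simp only [wickCoeff, foldr_smul, mul_smul_comm, ← Finset.smul_sum]
  rw [smul_comm]

theorem wickCoeff_neg_left (k : ℕ) (f g : A) :
    wickCoeff D D' k (-f) g = -wickCoeff D D' k f g := by
  simpa using wickCoeff_smul_left D D' k (-1) f g

theorem wickCoeff_neg_right (k : ℕ) (f g : A) :
    wickCoeff D D' k f (-g) = -wickCoeff D D' k f g := by
  simpa using wickCoeff_smul_right D D' k (-1) f g

theorem wickCoeff_sum_left {ι : Type*} (s : Finset ι) (k : ℕ) (f : ι → A) (g : A) :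
    wickCoeff D D' k (∑ i ∈ s, f i) g = ∑ i ∈ s, wickCoeff D D' k (f i) g :=
  map_sum (AddMonoidHom.mk' (fun f => wickCoeff D D' k f g)
    fun a b => wickCoeff_add_left D D' k a b g) f s

theorem wickCoeff_sum_right {ι : Type*} (s : Finset ι) (k : ℕ) (f : A) (g : ι → A) :
    wickCoeff D D' k f (∑ i ∈ s, g i) = ∑ i ∈ s, wickCoeff D D' k f (g i) :=
  map_sum (AddMonoidHom.mk' (fun g => wickCoeff D D' k f g)
    fun a b => wickCoeff_add_right D D' k f a b) g s

/-- An operator commuting with the `D i` and `D' i` which is a derivation of the product is a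
derivation of all coefficients. -/
theorem wickCoeff_derivation (T : A →ₗ[ℂ] A) (hT : ∀ f g, T (f * g) = T f * g + f * T g)
    (h : ∀ i f, T (D i f) = D i (T f)) (h' : ∀ i f, T (D' i f) = D' i (T f)) (k : ℕ) (f g : A) :
    T (wickCoeff D D' k f g) = wickCoeff D D' k (T f) g + wickCoeff D D' k f (T g) := by
  simp only [wickCoeff, map_smul, map_sum, hT, foldr_comm D T h, foldr_comm D' T h',
    Finset.sum_add_distrib, smul_add]

variable (hD : ∀ i j f, D i (D j f) = D j (D i f)) (hD' : ∀ i j f, D' i (D' j f) = D' j (D' i f))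

include hD hD' in
-- This is the coefficient form of d/dħ exp(-ħP) = -exp(-ħP) P: one index is split off from each
-- tuple, and its operators are moved inside by commutativity.
theorem succ_smul_wickCoeff (k : ℕ) (f g : A) :
    ((k + 1 : ℕ) : ℂ) • wickCoeff D D' (k + 1) f g =
      -∑ i, wickCoeff D D' k (D i f) (D' i g) := by
  simp only [wickCoeff]
  rw [← (Fin.consEquiv (fun _ => Fin N)).sum_comp, Fintype.sum_prod_type, smul_smul,
    ← Finset.smul_sum, ← neg_smul]
  congr 1
  · rw [Nat.factorial_succ, pow_succ]
    push_cast
    have h1 : (k : ℂ) + 1 ≠ 0 := Nat.cast_add_one_ne_zero k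
    have h2 : (k.factorial : ℂ) ≠ 0 := Nat.cast_ne_zero.2 k.factorial_ne_zero
    field_simp
  · refine Finset.sum_congr rfl fun i _ => Finset.sum_congr rfl fun j _ => ?_
    simp only [Fin.consEquiv_apply, List.ofFn_succ, Fin.cons_zero, Fin.cons_succ, List.foldr_cons]
    rw [foldr_comm D (D i) (fun j f => hD i j f), foldr_comm D' (D' i) (fun j f => hD' i j f)]

variable (hDD' : ∀ i j f, D i (D' j f) = D' j (D i f))
  (hm : ∀ i f g, D i (f * g) = D i f * g + f * D i g)
  (hm' : ∀ i f g, D' i (f * g) = D' i f * g + f * D' i g)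

include hD hD' hDD' hm in
-- The coefficient of the ħ-derivative of (f ⋆ g) ⋆ h. Differentiating the inner product gives (D_i
-- f ⋆ D'_i g) ⋆ h; differentiating the outer one gives D_i(f ⋆ g) ⋆ D'_i h, which splits in two
-- because D_i is a derivation of ⋆.
theorem succ_smul_sum_left (n : ℕ) (f g h : A) :
    ((n + 1 : ℕ) : ℂ) • ∑ p ∈ Finset.HasAntidiagonal.antidiagonal (n + 1),
        wickCoeff D D' p.1 (wickCoeff D D' p.2 f g) h =
      -∑ i, ∑ p ∈ Finset.HasAntidiagonal.antidiagonal n,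
        (wickCoeff D D' p.1 (wickCoeff D D' p.2 (D i f) (D' i g)) h +
          wickCoeff D D' p.1 (wickCoeff D D' p.2 (D i f) g) (D' i h) +
          wickCoeff D D' p.1 (wickCoeff D D' p.2 f (D i g)) (D' i h)) := by
  -- The factor n + 1 is distributed as p.1 + p.2, so that each summand can be absorbed by the
  -- coefficient of the same index.
  have h1 : ((n + 1 : ℕ) : ℂ) • ∑ p ∈ Finset.HasAntidiagonal.antidiagonal (n + 1),
        wickCoeff D D' p.1 (wickCoeff D D' p.2 f g) h =
      ∑ p ∈ Finset.HasAntidiagonal.antidiagonal (n + 1),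
        (p.1 : ℂ) • wickCoeff D D' p.1 (wickCoeff D D' p.2 f g) h +
      ∑ p ∈ Finset.HasAntidiagonal.antidiagonal (n + 1),
        (p.2 : ℂ) • wickCoeff D D' p.1 (wickCoeff D D' p.2 f g) h := by
    rw [Finset.smul_sum, ← Finset.sum_add_distrib]
    refine Finset.sum_congr rfl fun p hp => ?_
    rw [← add_smul, ← Nat.cast_add, Finset.HasAntidiagonal.mem_antidiagonal.1 hp]
  rw [h1, Finset.Nat.sum_antidiagonal_succ, Finset.Nat.sum_antidiagonal_succ']
  simp only [Nat.cast_zero, zero_smul, zero_add]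
  rw [Finset.sum_comm, ← Finset.sum_neg_distrib, ← Finset.sum_add_distrib]
  refine Finset.sum_congr rfl fun p _ => ?_
  rw [succ_smul_wickCoeff D D' hD hD', ← wickCoeff_smul_left, succ_smul_wickCoeff D D' hD hD',
    wickCoeff_neg_left, wickCoeff_sum_left, ← neg_add, ← Finset.sum_add_distrib]
  refine congrArg Neg.neg (Finset.sum_congr rfl fun i _ => ?_)
  rw [wickCoeff_derivation D D' (D i) (hm i) (fun j f => hD i j f) (fun j f => hDD' i j f),
    wickCoeff_add_left]
  abel

include hD hD' hDD' hm' in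
theorem succ_smul_sum_right (n : ℕ) (f g h : A) :
    ((n + 1 : ℕ) : ℂ) • ∑ p ∈ Finset.HasAntidiagonal.antidiagonal (n + 1),
        wickCoeff D D' p.1 f (wickCoeff D D' p.2 g h) =
      -∑ i, ∑ p ∈ Finset.HasAntidiagonal.antidiagonal n,
        (wickCoeff D D' p.1 (D i f) (wickCoeff D D' p.2 (D' i g) h) +
          wickCoeff D D' p.1 (D i f) (wickCoeff D D' p.2 g (D' i h)) +
          wickCoeff D D' p.1 f (wickCoeff D D' p.2 (D i g) (D' i h))) := by
  have h1 : ((n + 1 : ℕ) : ℂ) • ∑ p ∈ Finset.HasAntidiagonal.antidiagonal (n + 1),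
        wickCoeff D D' p.1 f (wickCoeff D D' p.2 g h) =
      ∑ p ∈ Finset.HasAntidiagonal.antidiagonal (n + 1),
        (p.1 : ℂ) • wickCoeff D D' p.1 f (wickCoeff D D' p.2 g h) +
      ∑ p ∈ Finset.HasAntidiagonal.antidiagonal (n + 1),
        (p.2 : ℂ) • wickCoeff D D' p.1 f (wickCoeff D D' p.2 g h) := by
    rw [Finset.smul_sum, ← Finset.sum_add_distrib]
    refine Finset.sum_congr rfl fun p hp => ?_
    rw [← add_smul, ← Nat.cast_add, Finset.HasAntidiagonal.mem_antidiagonal.1 hp]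
  rw [h1, Finset.Nat.sum_antidiagonal_succ, Finset.Nat.sum_antidiagonal_succ']
  simp only [Nat.cast_zero, zero_smul, zero_add]
  rw [Finset.sum_comm, ← Finset.sum_neg_distrib, ← Finset.sum_add_distrib]
  refine Finset.sum_congr rfl fun p _ => ?_
  rw [succ_smul_wickCoeff D D' hD hD', ← wickCoeff_smul_right, succ_smul_wickCoeff D D' hD hD',
    wickCoeff_neg_right, wickCoeff_sum_right, ← neg_add, ← Finset.sum_add_distrib]
  refine congrArg Neg.neg (Finset.sum_congr rfl fun i _ => ?_)
  rw [wickCoeff_derivation D D' (D' i) (hm' i) (fun j f => (hDD' j i f).symm)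
    (fun j f => hD' i j f), wickCoeff_add_right]

include hD hD' hDD' hm hm' in
-- Both bracketings satisfy the same recursion in n: the three families of terms on the left and on
-- the right are exchanged one by one by the induction hypothesis, applied to derivatives of f, g
-- and h. Division by n + 1 finishes the step.
theorem wickCoeff_assoc_antidiagonal (n : ℕ) : ∀ f g h : A,
    ∑ p ∈ Finset.HasAntidiagonal.antidiagonal n, wickCoeff D D' p.1 (wickCoeff D D' p.2 f g) h =
      ∑ p ∈ Finset.HasAntidiagonal.antidiagonal n, wickCoeff D D' p.1 f (wickCoeff D D' p.2 g h) := by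
  induction n with
  | zero => intro f g h; simp [wickCoeff_zero, mul_assoc]
  | succ n ih =>
    intro f g h
    have h0 : ((n + 1 : ℕ) : ℂ) ≠ 0 := Nat.cast_ne_zero.2 n.succ_ne_zero
    rw [← (smul_right_injective A h0).eq_iff]
    simp only [succ_smul_sum_left D D' hD hD' hDD' hm, succ_smul_sum_right D D' hD hD' hDD' hm',
      Finset.sum_add_distrib, ih]

include hD hD' hDD' hm hm' in
theorem wickCoeff_assoc (n : ℕ) (f g h : A) :
    ∑ j ∈ Finset.range (n + 1), wickCoeff D D' j (wickCoeff D D' (n - j) f g) h =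
      ∑ j ∈ Finset.range (n + 1), wickCoeff D D' j f (wickCoeff D D' (n - j) g h) := by
  rw [← Nat.succ_eq_add_one, ← Finset.Nat.sum_antidiagonal_eq_sum_range_succ
    (fun a b => wickCoeff D D' a (wickCoeff D D' b f g) h),
    ← Finset.Nat.sum_antidiagonal_eq_sum_range_succ
    (fun a b => wickCoeff D D' a f (wickCoeff D D' b g h))]
  exact wickCoeff_assoc_antidiagonal D D' hD hD' hDD' hm hm' n f g h

theorem derivation_combination (S T : A →ₗ[ℂ] A) (hS : ∀ f g, S (f * g) = S f * g + f * S g)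
    (hT : ∀ f g, T (f * g) = T f * g + f * T g) (a b : ℂ) (f g : A) :
    (a • (S + b • T)) (f * g) = (a • (S + b • T)) f * g + f * (a • (S + b • T)) g := by
  simp only [LinearMap.smul_apply, LinearMap.add_apply, hS, hT]
  simp only [Algebra.smul_def]
  ring

theorem combination_comm (S T S' T' : A →ₗ[ℂ] A) (h1 : ∀ f, S (S' f) = S' (S f))
    (h2 : ∀ f, S (T' f) = T' (S f)) (h3 : ∀ f, T (S' f) = S' (T f))
    (h4 : ∀ f, T (T' f) = T' (T f)) (a b a' b' : ℂ) (f : A) :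
    (a • (S + b • T)) ((a' • (S' + b' • T')) f) = (a' • (S' + b' • T')) ((a • (S + b • T)) f) := by
  simp only [LinearMap.smul_apply, LinearMap.add_apply, map_smul, map_add, h1, h2, h3, h4]
  module

end WickAlgebra

/-! ### The star product on smooth functions -/

section SmoothFunctions

variable (V : Type*) [NormedAddCommGroup V] [InnerProductSpace ℝ V] [FiniteDimensional ℝ V]

/-- The algebra of smooth complex-valued functions. -/
def smoothAlgebra : Subalgebra ℂ (V → ℂ) where
  carrier := {f | Smooth f}
  mul_mem' := fun {f g} (hf : Smooth f) (hg : Smooth g) => hf.mul hg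
  add_mem' := fun {f g} (hf : Smooth f) (hg : Smooth g) => hf.add hg
  algebraMap_mem' := fun a => show Smooth fun _ => a from contDiff_const

variable {V}

theorem smoothAlgebra_smooth (f : smoothAlgebra V) : Smooth f.1 := f.2

theorem smooth_fderiv_apply {f : V → ℂ} (hf : Smooth f) (v : V) :
    Smooth fun x => fderiv ℝ f x v :=
  (hf.fderiv_right (m := ((⊤ : ℕ∞) : WithTop ℕ∞)) (by simp)).clm_apply contDiff_const

/-- The directional derivative on smooth functions. -/
def smoothDeriv (v : V) : smoothAlgebra V →ₗ[ℂ] smoothAlgebra V where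
  toFun f := ⟨fun x => fderiv ℝ f.1 x v, smooth_fderiv_apply (smoothAlgebra_smooth f) v⟩
  map_add' f g := by
    ext x
    exact congrArg (fun L => L v) (fderiv_add ((smoothAlgebra_smooth f).differentiable (by simp) x)
      ((smoothAlgebra_smooth g).differentiable (by simp) x))
  map_smul' a f := by
    ext x
    exact congrArg (fun L => L v) (fderiv_const_smul ((smoothAlgebra_smooth f).differentiable (by simp) x) a)

theorem smoothDeriv_apply (v : V) (f : smoothAlgebra V) (x : V) :
    (smoothDeriv v f).1 x = fderiv ℝ f.1 x v := rfl

theorem smoothDeriv_mul (v : V) (f g : smoothAlgebra V) :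
    smoothDeriv v (f * g) = smoothDeriv v f * g + f * smoothDeriv v g := by
  ext x
  have := congrArg (fun L => L v) (fderiv_mul (𝕜 := ℝ) ((smoothAlgebra_smooth f).differentiable (by simp) x)
      ((smoothAlgebra_smooth g).differentiable (by simp) x))
  refine this.trans ?_
  simp [smoothDeriv_apply, add_comm, mul_comm]

theorem smoothDeriv_comm (v w : V) (f : smoothAlgebra V) :
    smoothDeriv v (smoothDeriv w f) = smoothDeriv w (smoothDeriv v f) := by
  ext x
  have hd : DifferentiableAt ℝ (fderiv ℝ f.1) x :=
    ((smoothAlgebra_smooth f).fderiv_right (m := ((⊤ : ℕ∞) : WithTop ℕ∞)) (by simp)).differentiable (by simp) x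
  have h1 : ∀ a b : V, fderiv ℝ (fun y => fderiv ℝ f.1 y a) x b =
      fderiv ℝ (fderiv ℝ f.1) x b a := by
    intro a b
    rw [fderiv_clm_apply hd (differentiableAt_const a)]
    simp
  have hs : IsSymmSndFDerivAt ℝ f.1 x :=
    ((smoothAlgebra_smooth f).contDiffAt (x := x)).isSymmSndFDerivAt (by
      simpa using WithTop.coe_le_coe.2 (le_top : (2 : ℕ∞) ≤ ⊤))
  change fderiv ℝ (fun y => fderiv ℝ f.1 y w) x v = fderiv ℝ (fun y => fderiv ℝ f.1 y v) x w
  rw [h1, h1]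
  exact hs v w

variable {ω : SymplecticForm V} {N : ℕ} (c : ComplexCoordinates ω N)

/-- The operators `∂/∂z^k` on smooth functions. -/
def ComplexCoordinates.smoothDz (k : Fin N) : smoothAlgebra V →ₗ[ℂ] smoothAlgebra V :=
  (1 / 2 : ℂ) • (smoothDeriv (c.z.symm (Pi.single k 1)) +
    (-Complex.I) • smoothDeriv (c.z.symm (Pi.single k Complex.I)))

/-- The operators `∂/∂z̄^k` on smooth functions. -/
def ComplexCoordinates.smoothDzbar (k : Fin N) : smoothAlgebra V →ₗ[ℂ] smoothAlgebra V :=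
  (1 / 2 : ℂ) • (smoothDeriv (c.z.symm (Pi.single k 1)) +
    Complex.I • smoothDeriv (c.z.symm (Pi.single k Complex.I)))

theorem ComplexCoordinates.coe_smoothDz (k : Fin N) (f : smoothAlgebra V) :
    (c.smoothDz k f : V → ℂ) = c.dz k f := by
  ext x
  simp only [ComplexCoordinates.dz, sub_eq_add_neg, ← neg_mul]
  rfl

theorem ComplexCoordinates.coe_smoothDzbar (k : Fin N) (f : smoothAlgebra V) :
    (c.smoothDzbar k f : V → ℂ) = c.dzbar k f := rfl

theorem ComplexCoordinates.coe_wickCoeff (k : ℕ) (f g : smoothAlgebra V) :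
    ((wickCoeff c.smoothDz c.smoothDzbar k f g : smoothAlgebra V) : V → ℂ) = c.starCoeff k f g := by
  have h : ∀ (l : List (Fin N)) (f : smoothAlgebra V),
      ((l.foldr (fun j => c.smoothDz j) f : smoothAlgebra V) : V → ℂ) = l.foldr c.dz f := by
    intro l f
    induction l with
    | nil => rfl
    | cons a l ih => rw [List.foldr_cons, coe_smoothDz, ih, List.foldr_cons]
  have h' : ∀ (l : List (Fin N)) (f : smoothAlgebra V),
      ((l.foldr (fun j => c.smoothDzbar j) f : smoothAlgebra V) : V → ℂ) = l.foldr c.dzbar f := by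
    intro l f
    induction l with
    | nil => rfl
    | cons a l ih => rw [List.foldr_cons, coe_smoothDzbar, ih, List.foldr_cons]
  ext x
  simp only [wickCoeff, ComplexCoordinates.starCoeff, ← h, ← h']
  simp [Finset.sum_apply]

theorem ComplexCoordinates.isStarProduct : IsStarProduct c.starCoeff := by
  have hp : ∀ k (f g : V → ℂ) (hf : Smooth f) (hg : Smooth g), c.starCoeff k f g =
      (wickCoeff c.smoothDz c.smoothDzbar k ⟨f, hf⟩ ⟨g, hg⟩ : smoothAlgebra V) :=
    fun k f g hf hg => (c.coe_wickCoeff k ⟨f, hf⟩ ⟨g, hg⟩).symm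
  have hs : ∀ k f g, Smooth f → Smooth g → Smooth (c.starCoeff k f g) := by
    intro k f g hf hg
    rw [hp k f g hf hg]
    exact (wickCoeff c.smoothDz c.smoothDzbar k ⟨f, hf⟩ ⟨g, hg⟩ : smoothAlgebra V).2
  have dc := fun a b : V => smoothDeriv_comm a b
  have dm := fun a : V => smoothDeriv_mul a
  have hD : ∀ i j f, c.smoothDz i (c.smoothDz j f) = c.smoothDz j (c.smoothDz i f) :=
    fun i j f => combination_comm _ _ _ _ (dc _ _) (dc _ _) (dc _ _) (dc _ _) _ _ _ _ f
  have hD' : ∀ i j f, c.smoothDzbar i (c.smoothDzbar j f) = c.smoothDzbar j (c.smoothDzbar i f) :=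
    fun i j f => combination_comm _ _ _ _ (dc _ _) (dc _ _) (dc _ _) (dc _ _) _ _ _ _ f
  have hDD' : ∀ i j f, c.smoothDz i (c.smoothDzbar j f) = c.smoothDzbar j (c.smoothDz i f) :=
    fun i j f => combination_comm _ _ _ _ (dc _ _) (dc _ _) (dc _ _) (dc _ _) _ _ _ _ f
  have hm : ∀ i f g, c.smoothDz i (f * g) = c.smoothDz i f * g + f * c.smoothDz i g :=
    fun i f g => derivation_combination _ _ (dm _) (dm _) _ _ f g
  have hm' : ∀ i f g, c.smoothDzbar i (f * g) = c.smoothDzbar i f * g + f * c.smoothDzbar i g :=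
    fun i f g => derivation_combination _ _ (dm _) (dm _) _ _ f g
  have hsum : ∀ (s : Finset ℕ) (F : ℕ → smoothAlgebra V),
      ((∑ j ∈ s, F j : smoothAlgebra V) : V → ℂ) = ∑ j ∈ s, (F j : V → ℂ) := fun s F =>
    map_sum (smoothAlgebra V).val F s
  refine ⟨hs, ?_, ?_, ?_, ?_, ?_, ?_⟩
  · intro k f f' g hf hf' hg
    have := congrArg Subtype.val
      (wickCoeff_add_left c.smoothDz c.smoothDzbar k (⟨f, hf⟩ : smoothAlgebra V) ⟨f', hf'⟩ ⟨g, hg⟩)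
    simpa only [c.coe_wickCoeff, AddMemClass.coe_add] using this
  · intro k a f g hf hg
    have := congrArg Subtype.val
      (wickCoeff_smul_left c.smoothDz c.smoothDzbar k a (⟨f, hf⟩ : smoothAlgebra V) ⟨g, hg⟩)
    simpa only [c.coe_wickCoeff, Subalgebra.coe_smul] using this
  · intro k f g g' hf hg hg'
    have := congrArg Subtype.val
      (wickCoeff_add_right c.smoothDz c.smoothDzbar k (⟨f, hf⟩ : smoothAlgebra V) ⟨g, hg⟩ ⟨g', hg'⟩)
    simpa only [c.coe_wickCoeff, AddMemClass.coe_add] using this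
  · intro k a f g hf hg
    have := congrArg Subtype.val
      (wickCoeff_smul_right c.smoothDz c.smoothDzbar k a (⟨f, hf⟩ : smoothAlgebra V) ⟨g, hg⟩)
    simpa only [c.coe_wickCoeff, Subalgebra.coe_smul] using this
  · intro n f g h hf hg hh
    have := congrArg Subtype.val
      (wickCoeff_assoc c.smoothDz c.smoothDzbar hD hD' hDD' hm hm' n (⟨f, hf⟩ : smoothAlgebra V)
        ⟨g, hg⟩ ⟨h, hh⟩)
    rw [hsum, hsum] at this
    simpa only [c.coe_wickCoeff] using this
  · intro f g hf hg
    have := congrArg Subtype.val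
      (wickCoeff_zero c.smoothDz c.smoothDzbar (⟨f, hf⟩ : smoothAlgebra V) ⟨g, hg⟩)
    simpa only [c.coe_wickCoeff, MulMemClass.coe_mul] using this

end SmoothFunctions

/-! ### The hermitian form, the symplectic volume and Gaussian mean values -/

section Coordinates

variable {V : Type*} [NormedAddCommGroup V] [InnerProductSpace ℝ V] [FiniteDimensional ℝ V]
variable {ω : SymplecticForm V} {N : ℕ} (c : ComplexCoordinates ω N)

/-- Multiplication by a complex scalar, in complex coordinates. -/
def ComplexCoordinates.mulScalar (t : ℂ) : V →ₗ[ℝ] V :=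
  c.z.symm.toLinearMap ∘ₗ ((t • LinearMap.id : (Fin N → ℂ) →ₗ[ℂ] (Fin N → ℂ)).restrictScalars ℝ) ∘ₗ
    c.z.toLinearMap

theorem ComplexCoordinates.z_mulScalar (t : ℂ) (v : V) : c.z (c.mulScalar t v) = t • c.z v := by
  simp [ComplexCoordinates.mulScalar]

theorem ComplexCoordinates.mulScalar_I (v : V) : c.mulScalar Complex.I v = ω.J v :=
  c.z.injective (by rw [c.z_mulScalar, c.map_J])

theorem ComplexCoordinates.mulScalar_eq (t : ℂ) (v : V) :
    c.mulScalar t v = t.re • v + t.im • ω.J v := by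
  apply c.z.injective
  ext k
  rw [c.z_mulScalar, map_add, map_smul, map_smul, c.map_J]
  apply Complex.ext <;> simp [sub_eq_add_neg]

theorem ComplexCoordinates.det_mulScalar (t : ℂ) :
    LinearMap.det (c.mulScalar t) = Complex.normSq t ^ N := by
  have := LinearMap.det_conj ((t • LinearMap.id : (Fin N → ℂ) →ₗ[ℂ] (Fin N → ℂ)).restrictScalars ℝ)
    c.z.symm
  rw [ComplexCoordinates.mulScalar, ← LinearMap.comp_assoc]
  refine this.trans ?_
  rw [LinearMap.det_restrictScalars]
  simp [Algebra.norm_complex_apply]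

/-- The factor √det in the symplectic volume must not vanish. J is multiplication by i, so det J =
1. Moreover J = -E⁻¹|E| with det |E| ≥ 0, and the sign disappears because the dimension is even; a
product equal to 1 with one factor nonnegative forces the other to be positive. -/
theorem det_structureOperator_pos (ω : SymplecticForm V) :
    0 < LinearMap.det ω.structureOperator := by
  obtain ⟨N, ⟨c⟩⟩ := ω.exists_complexCoordinates
  have h1 : LinearMap.det ω.J = 1 := by
    have : ω.J = c.mulScalar Complex.I := LinearMap.ext fun v => (c.mulScalar_I v).symm
    rw [this, c.det_mulScalar]; simp
  have h2 : ω.J = (-ω.structureOperator) ∘ₗ modulus ω.E.toLinearMap := rfl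
  have h3 : LinearMap.det (-ω.structureOperator) = LinearMap.det ω.structureOperator := by
    have hf : Module.finrank ℝ V = 2 * N := by
      rw [c.z.finrank_eq, Module.finrank_pi_fintype]
      simp [mul_comm]
    rw [← neg_one_smul ℝ, LinearMap.det_smul, hf, pow_mul]
    simp
  have h4 : 0 ≤ LinearMap.det (modulus ω.E.toLinearMap) := by
    have hs : (modulus ω.E.toLinearMap).IsSymmetric := fun v w => modulus_symm _ v w
    rw [hs.det_eq_prod_eigenvalues rfl]
    refine (Finset.prod_nonneg fun i _ => ?_ : (0 : ℝ) ≤ ∏ i, hs.eigenvalues rfl i)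
    have h := inner_modulus_nonneg ω.E.toLinearMap (hs.eigenvectorBasis rfl i)
    rw [hs.apply_eigenvectorBasis, inner_smul_right, real_inner_self_eq_norm_sq] at h
    simpa using h
  rw [h2, LinearMap.det_comp, h3] at h1
  rcases lt_or_ge 0 (LinearMap.det ω.structureOperator) with h | h
  · exact h
  · nlinarith

/-- The hermitian form `∑ₖ z^k(x) z̄^k(y)`. -/
def ComplexCoordinates.herm (x y : V) : ℂ := ∑ k, c.z x k * star (c.z y k)

theorem ComplexCoordinates.herm_add_left (x y w : V) :
    c.herm (x + y) w = c.herm x w + c.herm y w := by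
  simp [ComplexCoordinates.herm, add_mul, Finset.sum_add_distrib]

theorem ComplexCoordinates.herm_add_right (x y w : V) :
    c.herm x (y + w) = c.herm x y + c.herm x w := by
  simp [ComplexCoordinates.herm, mul_add, Finset.sum_add_distrib]

theorem ComplexCoordinates.herm_smul_left (r : ℝ) (x y : V) :
    c.herm (r • x) y = r * c.herm x y := by
  simp [ComplexCoordinates.herm, mul_assoc, Finset.mul_sum]

theorem ComplexCoordinates.herm_smul_right (r : ℝ) (x y : V) :
    c.herm x (r • y) = r * c.herm x y := by
  simp [ComplexCoordinates.herm, mul_left_comm, Finset.mul_sum]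

theorem ComplexCoordinates.star_herm (x y : V) : star (c.herm x y) = c.herm y x := by
  simp [ComplexCoordinates.herm, mul_comm]

theorem ComplexCoordinates.herm_neg_left (x y : V) : c.herm (-x) y = -c.herm x y := by
  simpa using c.herm_smul_left (-1) x y

theorem ComplexCoordinates.herm_neg_right (x y : V) : c.herm x (-y) = -c.herm x y := by
  simpa using c.herm_smul_right (-1) x y

theorem ComplexCoordinates.herm_sub_left (x y w : V) :
    c.herm (x - y) w = c.herm x w - c.herm y w := by
  rw [sub_eq_add_neg, herm_add_left, herm_neg_left, sub_eq_add_neg]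

theorem ComplexCoordinates.herm_sub_right (x y w : V) :
    c.herm x (y - w) = c.herm x y - c.herm x w := by
  rw [sub_eq_add_neg, herm_add_right, herm_neg_right, sub_eq_add_neg]

theorem ComplexCoordinates.herm_zero_left (x : V) : c.herm 0 x = 0 := by
  simpa using c.herm_smul_left 0 0 x

theorem ComplexCoordinates.herm_zero_right (x : V) : c.herm x 0 = 0 := by
  simpa using c.herm_smul_right 0 x 0

theorem ComplexCoordinates.herm_J_left (x y : V) : c.herm (ω.J x) y = Complex.I * c.herm x y := by
  simp [ComplexCoordinates.herm, c.map_J, mul_assoc, Finset.mul_sum]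

theorem ComplexCoordinates.herm_J_right (x y : V) :
    c.herm x (ω.J y) = -Complex.I * c.herm x y := by
  simp [ComplexCoordinates.herm, c.map_J, mul_left_comm, Finset.mul_sum]

theorem ComplexCoordinates.form_eq_herm (x y : V) :
    (ω.form x y : ℂ) = Complex.I * (c.herm x y - c.herm y x) := by
  rw [c.form_eq, Finset.sum_sub_distrib]
  simp only [ComplexCoordinates.herm, mul_comm]

/-- The norm square `∑ₖ |z^k(x)|²`. -/
def ComplexCoordinates.normSq (x : V) : ℝ := ∑ k, ‖c.z x k‖ ^ 2

theorem ComplexCoordinates.herm_self (x : V) : c.herm x x = (c.normSq x : ℂ) := by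
  simp [ComplexCoordinates.herm, ComplexCoordinates.normSq, Complex.mul_conj, Complex.normSq_eq_norm_sq]

theorem ComplexCoordinates.normSq_nonneg (x : V) : 0 ≤ c.normSq x :=
  Finset.sum_nonneg fun _ _ => by positivity

theorem ComplexCoordinates.normSq_smul (r : ℝ) (x : V) :
    c.normSq (r • x) = r ^ 2 * c.normSq x := by
  simp [ComplexCoordinates.normSq, mul_pow, Finset.mul_sum]

theorem ComplexCoordinates.normSq_mulScalar (t : ℂ) (x : V) :
    c.normSq (c.mulScalar t x) = ‖t‖ ^ 2 * c.normSq x := by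
  simp [ComplexCoordinates.normSq, c.z_mulScalar, mul_pow, Finset.mul_sum]

theorem ComplexCoordinates.continuous_z : Continuous c.z :=
  c.z.toLinearMap.continuous_of_finiteDimensional

theorem ComplexCoordinates.contDiff_z (k : Fin N) {n : WithTop ℕ∞} :
    ContDiff ℝ n fun x => c.z x k :=
  (LinearMap.toContinuousLinearMap ((LinearMap.proj k : (Fin N → ℂ) →ₗ[ℝ] ℂ) ∘ₗ
    c.z.toLinearMap)).contDiff

theorem ComplexCoordinates.contDiff_star_z (k : Fin N) {n : WithTop ℕ∞} :
    ContDiff ℝ n fun x => star (c.z x k) :=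
  Complex.conjCLE.toContinuousLinearMap.contDiff.comp (c.contDiff_z k)

theorem ComplexCoordinates.contDiff_herm {E : Type*} [NormedAddCommGroup E] [NormedSpace ℝ E]
    {n : WithTop ℕ∞} {f g : E → V} (hf : ContDiff ℝ n f) (hg : ContDiff ℝ n g) :
    ContDiff ℝ n fun x => c.herm (f x) (g x) :=
  ContDiff.sum fun k _ => ((c.contDiff_z k).comp hf).mul ((c.contDiff_star_z k).comp hg)

theorem ComplexCoordinates.continuous_herm {X : Type*} [TopologicalSpace X]
    {f g : X → V} (hf : Continuous f) (hg : Continuous g) :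
    Continuous fun x => c.herm (f x) (g x) :=
  continuous_finsetSum _ fun k _ => (((continuous_apply k).comp c.continuous_z).comp hf).mul
    (continuous_star.comp (((continuous_apply k).comp c.continuous_z).comp hg))

theorem ComplexCoordinates.continuous_normSq : Continuous c.normSq :=
  continuous_finsetSum _ fun k _ =>
    (continuous_norm.comp ((continuous_apply k).comp c.continuous_z)).pow 2

theorem ComplexCoordinates.exists_le_normSq : ∃ m : ℝ, 0 < m ∧ ∀ x, m * ‖x‖ ^ 2 ≤ c.normSq x := by
  let L : (Fin N → ℂ) →L[ℝ] V := LinearMap.toContinuousLinearMap c.z.symm.toLinearMap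
  refine ⟨((‖L‖ + 1) ^ 2)⁻¹, by positivity, fun x => ?_⟩
  have h1 : ‖x‖ ≤ (‖L‖ + 1) * ‖c.z x‖ := by
    have : L (c.z x) = x := c.z.symm_apply_apply x
    calc ‖x‖ = ‖L (c.z x)‖ := by rw [this]
      _ ≤ ‖L‖ * ‖c.z x‖ := L.le_opNorm _
      _ ≤ _ := by gcongr; linarith
  have h2 : ‖c.z x‖ ^ 2 ≤ c.normSq x := by
    have : ‖c.z x‖ ≤ √(c.normSq x) := by
      refine (pi_norm_le_iff_of_nonneg (Real.sqrt_nonneg _)).2 fun k => ?_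
      refine Real.le_sqrt_of_sq_le ?_
      exact Finset.single_le_sum (f := fun k => ‖c.z x k‖ ^ 2) (fun _ _ => by positivity)
        (Finset.mem_univ k)
    calc ‖c.z x‖ ^ 2 ≤ √(c.normSq x) ^ 2 := by gcongr
      _ = _ := Real.sq_sqrt (c.normSq_nonneg x)
  rw [inv_mul_le_iff₀ (by positivity)]
  calc ‖x‖ ^ 2 ≤ ((‖L‖ + 1) * ‖c.z x‖) ^ 2 := by gcongr
    _ = (‖L‖ + 1) ^ 2 * ‖c.z x‖ ^ 2 := by ring
    _ ≤ _ := by gcongr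

theorem ComplexCoordinates.exists_norm_herm_le :
    ∃ M : ℝ, 0 < M ∧ ∀ x y, ‖c.herm x y‖ ≤ M * (‖x‖ * ‖y‖) := by
  let L : V →L[ℝ] (Fin N → ℂ) := LinearMap.toContinuousLinearMap c.z.toLinearMap
  refine ⟨N * ‖L‖ ^ 2 + 1, by positivity, fun x y => ?_⟩
  have h1 : ∀ x k, ‖c.z x k‖ ≤ ‖L‖ * ‖x‖ := fun x k =>
    (norm_le_pi_norm (c.z x) k).trans (L.le_opNorm x)
  calc ‖c.herm x y‖ ≤ ∑ k : Fin N, (‖L‖ * ‖x‖) * (‖L‖ * ‖y‖) := by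
        refine (norm_sum_le _ _).trans ?_
        gcongr with k
        rw [norm_mul, norm_star]
        gcongr <;> apply h1
    _ = N * ‖L‖ ^ 2 * (‖x‖ * ‖y‖) := by simp; ring
    _ ≤ _ := by nlinarith [mul_nonneg (norm_nonneg x) (norm_nonneg y)]

variable [MeasurableSpace V] [BorelSpace V]

instance instIsAddHaarMeasureSymplecticVolume (ω : SymplecticForm V) :
    (symplecticVolume ω).IsAddHaarMeasure :=
  Measure.IsAddHaarMeasure.smul _ (by
    simpa using det_structureOperator_pos ω) ENNReal.ofReal_ne_top

theorem ComplexCoordinates.measurePreserving_mulScalar (μ : Measure V) [μ.IsAddHaarMeasure] (t : ℂ)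
    (ht : ‖t‖ = 1) : MeasurePreserving (c.mulScalar t) μ μ := by
  have hd : LinearMap.det (c.mulScalar t) = 1 := by
    rw [c.det_mulScalar, Complex.normSq_eq_norm_sq, ht]; simp
  refine ⟨(c.mulScalar t).continuous_of_finiteDimensional.measurable, ?_⟩
  rw [Measure.map_linearMap_addHaar_eq_smul_addHaar μ (by rw [hd]; exact one_ne_zero), hd]
  simp

theorem ComplexCoordinates.integrable_gaussian (μ : Measure V) [μ.IsAddHaarMeasure] {a : ℝ}
    (ha : 0 < a) : Integrable (fun x => Real.exp (-a * c.normSq x)) μ := by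
  obtain ⟨m, hm, hle⟩ := c.exists_le_normSq
  have h1 : Integrable (fun x : V => Real.exp (-(a * m) * ‖x‖ ^ 2)) volume := by
    have := (GaussianFourier.integrable_cexp_neg_mul_sq_norm_add (V := V) (b := ((a * m : ℝ) : ℂ))
      (by simp; positivity) 0 0).norm
    refine this.congr (Eventually.of_forall fun x => ?_)
    simp only [Complex.norm_exp]
    norm_cast
    simp
  have h2 : Integrable (fun x : V => Real.exp (-(a * m) * ‖x‖ ^ 2)) μ := by
    rw [Measure.isAddLeftInvariant_eq_smul μ volume]
    exact h1.smul_measure (by finiteness)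
  refine h2.mono' ((Real.continuous_exp.comp
    (continuous_const.mul c.continuous_normSq)).aestronglyMeasurable) ?_
  refine Eventually.of_forall fun x => ?_
  rw [Real.norm_eq_abs, abs_of_pos (Real.exp_pos _)]
  apply Real.exp_le_exp.2
  nlinarith [hle x]

/-- A function whose differential is complex linear is holomorphic on complex lines. -/
theorem ComplexCoordinates.differentiable_mulScalar {G : V → ℂ} (hG : Differentiable ℝ G)
    (h : ∀ u v, fderiv ℝ G u v + Complex.I * fderiv ℝ G u (ω.J v) = 0) (w : V) :
    Differentiable ℂ fun t : ℂ => G (c.mulScalar t w) := by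
  intro t
  have hl : HasFDerivAt (fun t : ℂ => c.mulScalar t w)
      (Complex.reCLM.smulRight w + Complex.imCLM.smulRight (ω.J w)) t := by
    have : (fun t : ℂ => c.mulScalar t w) =
        (Complex.reCLM.smulRight w + Complex.imCLM.smulRight (ω.J w) : ℂ →L[ℝ] V) := by
      ext t; simp [c.mulScalar_eq]
    rw [this]
    exact ContinuousLinearMap.hasFDerivAt _
  have h2 := (hG (c.mulScalar t w)).hasFDerivAt.comp t hl
  refine (hasFDerivAt_of_restrictScalars ℝ (f' := ContinuousLinearMap.toSpanSingleton ℂ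
    (fderiv ℝ G (c.mulScalar t w) w)) h2 ?_).differentiableAt
  ext s
  have h3 := h (c.mulScalar t w) w
  simp only [ContinuousLinearMap.coe_restrictScalars', ContinuousLinearMap.toSpanSingleton_apply,
    ContinuousLinearMap.comp_apply, add_apply,
    ContinuousLinearMap.smulRight_apply, Complex.reCLM_apply, Complex.imCLM_apply, map_add,
    map_smul, Complex.real_smul, smul_eq_mul]
  have h4 : fderiv ℝ G (c.mulScalar t w) (ω.J w) =
      Complex.I * fderiv ℝ G (c.mulScalar t w) w := by
    linear_combination (-Complex.I) * h3 + fderiv ℝ G (c.mulScalar t w) (ω.J w) * Complex.I_mul_I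
  rw [h4]
  conv_lhs => rw [← Complex.re_add_im s]
  ring

/-- The mean value property of holomorphic functions with respect to Gaussian measures. -/
theorem ComplexCoordinates.integral_mul_gaussian (μ : Measure V) [μ.IsAddHaarMeasure] {a : ℝ}
    {G : V → ℂ} (hG : Differentiable ℝ G)
    (h : ∀ u v, fderiv ℝ G u v + Complex.I * fderiv ℝ G u (ω.J v) = 0)
    (hi : Integrable (fun u => G u * (Real.exp (-a * c.normSq u) : ℂ)) μ) :
    ∫ u, G u * (Real.exp (-a * c.normSq u) : ℂ) ∂μ =
      G 0 * ∫ u, (Real.exp (-a * c.normSq u) : ℂ) ∂μ := by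
  set K : V → ℂ := fun u => G u * (Real.exp (-a * c.normSq u) : ℂ) with hK
  have hKc : Continuous K := hG.continuous.mul (Complex.continuous_ofReal.comp
    (Real.continuous_exp.comp (continuous_const.mul c.continuous_normSq)))
  -- The circle action u ↦ e^{iθ}u preserves the measure and the Gaussian weight. Averaging the
  -- integral over θ and exchanging the integrals replaces G(u) by its mean over a circle in the
  -- complex line of u, which is G(0).
  let r : ℝ → V → V := fun θ => c.mulScalar (circleMap 0 1 θ)
  have hr : ∀ θ, MeasurePreserving (r θ) μ μ := fun θ =>
    c.measurePreserving_mulScalar μ _ (by simp)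
  have hrc : Continuous fun p : ℝ × V => r p.1 p.2 := by
    have : (fun p : ℝ × V => r p.1 p.2) = fun p =>
        (circleMap 0 1 p.1).re • p.2 + (circleMap 0 1 p.1).im • ω.J p.2 := by
      ext1 p; exact c.mulScalar_eq _ _
    rw [this]
    have hJ : Continuous ω.J := ω.J.continuous_of_finiteDimensional
    have hc := (continuous_circleMap 0 1).comp (continuous_fst : Continuous (Prod.fst : ℝ × V → ℝ))
    exact ((Complex.continuous_re.comp hc).smul continuous_snd).add
      ((Complex.continuous_im.comp hc).smul (hJ.comp continuous_snd))
  have hemb : ∀ θ, MeasurableEmbedding (r θ) := by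
    intro θ
    have hdet : LinearMap.det (c.mulScalar (circleMap 0 1 θ)) ≠ 0 := by
      rw [c.det_mulScalar, Complex.normSq_eq_norm_sq]; simp
    exact ((LinearMap.equivOfDetNeZero _ hdet).toContinuousLinearEquiv.toHomeomorph).measurableEmbedding
  have h1 : ∀ θ, ∫ u, K (r θ u) ∂μ = ∫ u, K u ∂μ := fun θ => (hr θ).integral_comp (hemb θ) K
  have h2 : ∀ u, ∫ θ in (0 : ℝ)..(2 * Real.pi), K (r θ u) =
      (2 * Real.pi : ℝ) • (G 0 * (Real.exp (-a * c.normSq u) : ℂ)) := by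
    intro u
    have hm := DiffContOnCl.circleAverage (c := 0) (R := 1)
      ((c.differentiable_mulScalar hG h u).diffContOnCl)
    rw [Real.circleAverage_def] at hm
    have h0 : c.mulScalar 0 u = 0 := by simp [c.mulScalar_eq]
    rw [h0, inv_smul_eq_iff₀ (by positivity)] at hm
    rw [← smul_mul_assoc, ← hm, ← intervalIntegral.integral_mul_const]
    refine intervalIntegral.integral_congr fun θ _ => ?_
    simp only [hK, r, c.normSq_mulScalar]
    simp
  have hint : Integrable (Function.uncurry fun θ u => K (r θ u))
      ((volume.restrict (Set.uIoc 0 (2 * Real.pi))).prod μ) := by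
    rw [integrable_prod_iff (f := Function.uncurry fun θ u => K (r θ u))
      ((hKc.comp hrc).aestronglyMeasurable)]
    refine ⟨Eventually.of_forall fun θ => (hr θ).integrable_comp_of_integrable hi, ?_⟩
    have : ∀ θ, ∫ u, ‖K (r θ u)‖ ∂μ = ∫ u, ‖K u‖ ∂μ := fun θ =>
      (hr θ).integral_comp (hemb θ) fun u => ‖K u‖
    simp only [Function.uncurry, this]
    rw [integrable_const_iff]
    right
    constructor
    simp [ENNReal.mul_lt_top]
  have h3 := intervalIntegral_integral_swap hint
  simp only [h1, h2] at h3
  rw [intervalIntegral.integral_const, sub_zero, integral_smul] at h3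
  have h4 := smul_right_injective ℂ (by positivity : (2 * Real.pi : ℝ) ≠ 0) h3
  rw [h4, integral_const_mul]

end Coordinates

/-! ### Coherent states and their reproducing property -/

section Coherent

variable {V : Type*} [NormedAddCommGroup V] [InnerProductSpace ℝ V] [FiniteDimensional ℝ V]
variable {ω : SymplecticForm V} {N : ℕ} (c : ComplexCoordinates ω N)

/-- The real linear functional `x ↦ herm x y`. -/
def ComplexCoordinates.hermLeft (y : V) : V →L[ℝ] ℂ :=
  LinearMap.toContinuousLinearMap
    { toFun := fun x => c.herm x y
      map_add' := fun x x' => c.herm_add_left x x' y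
      map_smul' := fun r x => by simp [c.herm_smul_left] }

/-- The real linear functional `y ↦ herm x y`. -/
def ComplexCoordinates.hermRight (x : V) : V →L[ℝ] ℂ :=
  LinearMap.toContinuousLinearMap
    { toFun := fun y => c.herm x y
      map_add' := fun y y' => c.herm_add_right x y y'
      map_smul' := fun r y => by simp [c.herm_smul_right] }

theorem ComplexCoordinates.hermLeft_apply (y v : V) : c.hermLeft y v = c.herm v y := rfl

theorem ComplexCoordinates.hermRight_apply (x v : V) : c.hermRight x v = c.herm x v := rfl

theorem ComplexCoordinates.hasFDerivAt_herm_left (y u : V) :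
    HasFDerivAt (fun x => c.herm x y) (c.hermLeft y) u := (c.hermLeft y).hasFDerivAt

theorem ComplexCoordinates.hasFDerivAt_herm_right (x u : V) :
    HasFDerivAt (fun y => c.herm x y) (c.hermRight x) u := (c.hermRight x).hasFDerivAt

theorem ComplexCoordinates.hasFDerivAt_herm_self (u : V) :
    HasFDerivAt (fun x => c.herm x x) (c.hermLeft u + c.hermRight u) u := by
  have hb : IsBoundedBilinearMap ℝ fun p : V × V => c.herm p.1 p.2 := by
    obtain ⟨M, hM, h⟩ := c.exists_norm_herm_le
    exact ⟨c.herm_add_left, fun r x y => by simp [c.herm_smul_left], c.herm_add_right,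
      fun r x y => by simp [c.herm_smul_right], M, hM, fun x y => by rw [mul_assoc]; exact h x y⟩
  have h : HasFDerivAt (fun x => c.herm x x) _ u := HasFDerivAt.comp (f := fun x => (x, x)) u
    (hb.hasFDerivAt (u, u)) ((hasFDerivAt_id u).prodMk (hasFDerivAt_id u))
  refine h.congr_fderiv ?_
  ext v
  simp [c.hermLeft_apply, c.hermRight_apply, IsBoundedBilinearMap.deriv, add_comm]

/-- The coherent state centred at `y`, as a function. -/
def ComplexCoordinates.coh (ħ : ℝ) (y x : V) : ℂ :=
  Complex.exp ((c.herm x y - c.herm x x / 2 - c.herm y y / 2) / ħ)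

theorem ComplexCoordinates.contDiff_coh (ħ : ℝ) (y : V) : Smooth (c.coh ħ y) := by
  have h1 := c.contDiff_herm (n := ((⊤ : ℕ∞) : WithTop ℕ∞)) contDiff_id (contDiff_const (c := y))
  have h2 := c.contDiff_herm (n := ((⊤ : ℕ∞) : WithTop ℕ∞)) (E := V) contDiff_id contDiff_id
  exact (((h1.sub (h2.div_const 2)).sub contDiff_const).div_const _).cexp

/-- Along v + iJv the terms of the potential that are complex linear in v cancel, and only the
antilinear h(x, v)/ħ remains. It is compensated by the factor exp(-h(x, x)/2ħ), so holomorphic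
sections are this factor times holomorphic functions. -/
theorem ComplexCoordinates.connection_add (ħ : ℝ) (ψ : V → ℂ) (x v : V) :
    connection ω ħ ψ x v + Complex.I * connection ω ħ ψ x (ω.J v) =
      fderiv ℝ ψ x v + Complex.I * fderiv ℝ ψ x (ω.J v) + c.herm x v / ħ * ψ x := by
  simp only [connection]
  push_cast
  rw [c.form_eq_herm, c.form_eq_herm, c.herm_J_left, c.herm_J_right]
  linear_combination (-(1 / 2) * ψ x * (ħ : ℂ)⁻¹) *
    (2 * c.herm x v - Complex.I ^ 2 * (c.herm x v + c.herm v x)) * Complex.I_mul_I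

theorem ComplexCoordinates.isHolomorphicSection_coh (ħ : ℝ) (y : V) :
    IsHolomorphicSection ω ħ (c.coh ħ y) := by
  refine ⟨c.contDiff_coh ħ y, fun x v => ?_⟩
  have h : HasFDerivAt (c.coh ħ y) _ x :=
    ((((c.hasFDerivAt_herm_left y x).sub ((c.hasFDerivAt_herm_self x).mul_const (2 : ℂ)⁻¹)).sub_const
      (c.herm y y / 2)).mul_const (ħ : ℂ)⁻¹).cexp
  rw [c.connection_add, h.fderiv]
  simp only [sub_apply, add_apply, c.hermLeft_apply,
    c.hermRight_apply, smul_eq_mul, c.herm_J_left, c.herm_J_right, ComplexCoordinates.coh,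
    div_eq_mul_inv, smul_apply, Pi.sub_apply]
  ring_nf
  simp only [Complex.I_sq]
  ring

theorem ComplexCoordinates.coh_self (ħ : ℝ) (y : V) : c.coh ħ y y = 1 := by
  rw [ComplexCoordinates.coh, sub_sub, add_halves, sub_self, zero_div, Complex.exp_zero]

theorem ComplexCoordinates.norm_coh (ħ : ℝ) (y x : V) :
    ‖c.coh ħ y x‖ = Real.exp (-(1 / (2 * ħ)) * c.normSq (x - y)) := by
  rw [ComplexCoordinates.coh, Complex.norm_exp]
  congr 1
  have h1 : (c.normSq (x - y) : ℂ) = c.herm x x + c.herm y y - c.herm x y - star (c.herm x y) := by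
    rw [← c.herm_self, c.herm_sub_left, c.herm_sub_right, c.herm_sub_right, c.star_herm]
    ring
  rw [c.herm_self, c.herm_self] at h1
  have h2 := congrArg Complex.re h1
  simp at h2
  rw [h2, c.herm_self, c.herm_self, Complex.div_ofReal_re]
  simp
  ring

/-- Separates the Gaussian exp(-|u|²/ħ) from the conjugate coherent state after translation to its
centre. When a = φ(x + u) for a holomorphic section φ, the remaining exponential is the gauge factor
that makes φ(x + u) a holomorphic function of u. -/
theorem ComplexCoordinates.star_coh_mul (ħ : ℝ) (x u : V) (a : ℂ) :
    star (c.coh ħ x (x + u)) * a =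
      a * Complex.exp ((c.herm x u / 2 - c.herm u x / 2 + c.herm u u / 2) / ħ) *
        (Real.exp (-(1 / ħ) * c.normSq u) : ℂ) := by
  rw [mul_comm, mul_assoc]
  congr 1
  rw [Complex.ofReal_exp, ← Complex.exp_add, ComplexCoordinates.coh, Complex.star_def,
    ← Complex.exp_conj]
  congr 1
  have h : ∀ x y, (starRingEnd ℂ) (c.herm x y) = c.herm y x := fun x y => c.star_herm x y
  simp only [map_div₀, map_sub, h, Complex.conj_ofReal, Complex.ofReal_mul, c.herm_add_left,
    c.herm_add_right, map_add, map_ofNat]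
  rw [← c.herm_self]
  push_cast
  ring

variable [MeasurableSpace V] [BorelSpace V]

theorem ComplexCoordinates.memLp_coh {ħ : ℝ} (hħ : 0 < ħ) (y : V) (μ : Measure V)
    [μ.IsAddHaarMeasure] : MemLp (c.coh ħ y) 2 μ := by
  rw [memLp_two_iff_integrable_sq_norm (c.contDiff_coh ħ y).continuous.aestronglyMeasurable]
  have h := (c.integrable_gaussian μ (a := 1 / ħ) (by positivity)).comp_sub_right y
  refine h.congr (Eventually.of_forall fun x => ?_)
  simp only [c.norm_coh, ← Real.exp_nat_mul]
  congr 1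
  push_cast; field_simp

/-- The integral of `exp(-|z|²/ħ)`. -/
def ComplexCoordinates.mass (ħ : ℝ) : ℝ :=
  ∫ u, Real.exp (-(1 / ħ) * c.normSq u) ∂(symplecticVolume ω)

theorem ComplexCoordinates.mass_pos {ħ : ℝ} (hħ : 0 < ħ) : 0 < c.mass ħ :=
  integral_exp_pos (c.integrable_gaussian _ (by positivity))

theorem inner_eq_integral {μ : Measure V} (φ ψ : Lp ℂ 2 μ) :
    ⟪φ, ψ⟫_ℂ = ∫ x, star (φ x) * ψ x ∂μ := by
  rw [L2.inner_def]
  simp [mul_comm]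

theorem inner_eq_integral_of_ae {μ : Measure V} {φ ψ : Lp ℂ 2 μ} {f g : V → ℂ} (hf : φ =ᵐ[μ] f)
    (hg : ψ =ᵐ[μ] g) : ⟪φ, ψ⟫_ℂ = ∫ x, star (f x) * g x ∂μ := by
  rw [inner_eq_integral]
  refine integral_congr_ae ?_
  filter_upwards [hf, hg] with x h1 h2
  rw [h1, h2]

theorem integrable_star_mul {μ : Measure V} {f g : V → ℂ} (hf : MemLp f 2 μ) (hg : MemLp g 2 μ) :
    Integrable (fun x => star (f x) * g x) μ := by
  have := hf.star.integrable_mul hg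
  exact this

/-- The reproducing property of coherent states on holomorphic sections. -/
theorem ComplexCoordinates.integral_star_coh_mul {ħ : ℝ} (hħ : 0 < ħ) {φ : V → ℂ}
    (hφ : IsHolomorphicSection ω ħ φ) (hL : MemLp φ 2 (symplecticVolume ω)) (x : V) :
    ∫ y, star (c.coh ħ x y) * φ y ∂(symplecticVolume ω) = c.mass ħ * φ x := by
  have hφd : Differentiable ℝ φ := hφ.1.differentiable (by simp)
  -- G is the section translated to x and stripped of its connection term. The equation of φ at x +
  -- u becomes the Cauchy–Riemann equation of G at u, so the Gaussian mean value property applies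
  -- and returns G(0) = φ(x).
  set G : V → ℂ := fun u => φ (x + u) *
    Complex.exp ((c.herm x u / 2 - c.herm u x / 2 + c.herm u u / 2) / ħ) with hGdef
  have hG : ∀ u, HasFDerivAt G _ u := fun u =>
    ((hφd (x + u)).hasFDerivAt.comp u ((hasFDerivAt_id u).const_add x)).mul
      (((((c.hasFDerivAt_herm_right x u).mul_const (2 : ℂ)⁻¹).sub
      ((c.hasFDerivAt_herm_left x u).mul_const (2 : ℂ)⁻¹)).add
      ((c.hasFDerivAt_herm_self u).mul_const (2 : ℂ)⁻¹)).mul_const (ħ : ℂ)⁻¹).cexp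
  have hstar : ∀ u, star (c.coh ħ x (x + u)) * φ (x + u) =
      G u * (Real.exp (-(1 / ħ) * c.normSq u) : ℂ) := fun u => by
    rw [c.star_coh_mul]
  have hi := integrable_star_mul (c.memLp_coh hħ x _) hL
  have hi' : Integrable (fun u => star (c.coh ħ x (x + u)) * φ (x + u)) (symplecticVolume ω) :=
    hi.comp_add_left x
  simp only [hstar] at hi'
  rw [← integral_add_left_eq_self _ x]
  simp only [hstar]
  rw [c.integral_mul_gaussian _ (fun u => (hG u).differentiableAt) ?_ hi']
  · simp only [hGdef, add_zero, c.herm_zero_left, c.herm_zero_right]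
    rw [integral_complex_ofReal, ComplexCoordinates.mass]
    simp [mul_comm]
  · intro u v
    have h1 := hφ.2 (x + u) v
    rw [c.connection_add] at h1
    rw [(hG u).fderiv]
    simp only [Pi.sub_apply, Pi.add_apply, sub_apply, add_apply, c.hermLeft_apply,
      c.hermRight_apply, smul_eq_mul, c.herm_J_left, c.herm_J_right, smul_apply,
      ContinuousLinearMap.comp_apply, ContinuousLinearMap.id_apply, Function.comp_apply,
      c.herm_add_left, div_eq_mul_inv] at h1 ⊢
    set e := Complex.exp ((c.herm x u * 2⁻¹ - c.herm u x * 2⁻¹ + c.herm u u * 2⁻¹) * (ħ : ℂ)⁻¹)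
    linear_combination e * h1 + (ħ : ℂ)⁻¹ * e * φ (x + u) *
      (c.herm v u - c.herm v x - c.herm x v - c.herm u v) * Complex.I_mul_I / 2

/-- The coherent state centred at `y`, as a vector of the physical Hilbert space. -/
def ComplexCoordinates.cohVec {ħ : ℝ} (hħ : 0 < ħ) (y : V) : physicalSpace ω ħ :=
  ⟨(c.memLp_coh hħ y (symplecticVolume ω)).toLp _, Submodule.le_topologicalClosure _ (Submodule.subset_span
    ⟨c.coh ħ y, c.isHolomorphicSection_coh ħ y,
      MemLp.coeFn_toLp (c.memLp_coh hħ y _)⟩)⟩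

theorem ComplexCoordinates.coeFn_cohVec {ħ : ℝ} (hħ : 0 < ħ) (y : V) :
    (c.cohVec hħ y : Lp ℂ 2 (symplecticVolume ω)) =ᵐ[symplecticVolume ω] c.coh ħ y :=
  MemLp.coeFn_toLp (c.memLp_coh hħ y _)

theorem ComplexCoordinates.inner_cohVec {ħ : ℝ} (hħ : 0 < ħ) (x y : V) :
    ⟪c.cohVec hħ x, c.cohVec hħ y⟫_ℂ = c.mass ħ * c.coh ħ y x := by
  rw [Submodule.coe_inner, inner_eq_integral_of_ae (c.coeFn_cohVec hħ x) (c.coeFn_cohVec hħ y)]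
  exact c.integral_star_coh_mul hħ (c.isHolomorphicSection_coh ħ y) (c.memLp_coh hħ y _) x

theorem ComplexCoordinates.norm_cohVec_sq {ħ : ℝ} (hħ : 0 < ħ) (x : V) :
    ‖c.cohVec hħ x‖ ^ 2 = c.mass ħ := by
  have := inner_self_eq_norm_sq_to_K (𝕜 := ℂ) (c.cohVec hħ x)
  rw [c.inner_cohVec, c.coh_self, mul_one] at this
  exact Complex.ofReal_injective (by push_cast; exact this.symm)

/-- The coherent states reproduce the vectors of the physical Hilbert space. -/
theorem ComplexCoordinates.ae_eq_inner_cohVec {ħ : ℝ} (hħ : 0 < ħ) (ψ : physicalSpace ω ħ) :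
    ∀ᵐ x ∂(symplecticVolume ω), (c.mass ħ : ℂ) * (ψ : Lp ℂ 2 (symplecticVolume ω)) x =
      ⟪c.cohVec hħ x, ψ⟫_ℂ := by
  simp only [Submodule.coe_inner]
  obtain ⟨ψ, hψ⟩ := ψ
  have hspan : ∀ φ ∈ Submodule.span ℂ {ψ : Lp ℂ 2 (symplecticVolume ω) |
      ∃ φ : V → ℂ, IsHolomorphicSection ω ħ φ ∧ ⇑ψ =ᵐ[symplecticVolume ω] φ},
      ∀ᵐ x ∂(symplecticVolume ω), (c.mass ħ : ℂ) * φ x =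
        ⟪(c.cohVec hħ x : Lp ℂ 2 (symplecticVolume ω)), φ⟫_ℂ := by
    intro φ hφ
    induction hφ using Submodule.span_induction with
    | mem φ h =>
      obtain ⟨f, hf, hfφ⟩ := h
      filter_upwards [hfφ] with x hx
      rw [inner_eq_integral_of_ae (c.coeFn_cohVec hħ x) hfφ, hx]
      exact (c.integral_star_coh_mul hħ hf ((memLp_congr_ae hfφ).1 (Lp.memLp φ)) x).symm
    | zero =>
      filter_upwards [Lp.coeFn_zero ℂ 2 (symplecticVolume ω)] with x hx
      simp
    | add φ φ' _ _ h h' =>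
      filter_upwards [h, h', Lp.coeFn_add φ φ'] with x h1 h2 h3
      rw [h3, Pi.add_apply, mul_add, h1, h2, inner_add_right]
    | smul a φ _ h =>
      filter_upwards [h, Lp.coeFn_smul a φ] with x h1 h2
      rw [h2, Pi.smul_apply, smul_eq_mul, mul_left_comm, h1, inner_smul_right]
  -- To pass to the closure, L² convergence gives convergence of the pairings, and almost everywhere
  -- convergence of the values along a subsequence.
  obtain ⟨u, hu, hlim⟩ := mem_closure_iff_seq_limit.1 hψ
  obtain ⟨ns, hns, hae⟩ := (tendstoInMeasure_of_tendsto_Lp hlim).exists_seq_tendsto_ae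
  have hall : ∀ᵐ x ∂(symplecticVolume ω), ∀ n, (c.mass ħ : ℂ) * u n x =
        ⟪(c.cohVec hħ x : Lp ℂ 2 (symplecticVolume ω)), u n⟫_ℂ :=
    ae_all_iff.2 fun n => hspan _ (hu n)
  filter_upwards [hae, hall] with x h1 h2
  refine tendsto_nhds_unique (h1.const_mul _) ?_
  simp only [h2]
  exact tendsto_const_nhds.inner (hlim.comp hns.tendsto_atTop)

/-- Coherent states are total. -/
theorem ComplexCoordinates.eq_zero_of_inner_cohVec {ħ : ℝ} (hħ : 0 < ħ) (ψ : physicalSpace ω ħ)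
    (h : ∀ x, ⟪c.cohVec hħ x, ψ⟫_ℂ = 0) : ψ = 0 := by
  have h1 := c.ae_eq_inner_cohVec hħ ψ
  have hm : (c.mass ħ : ℂ) ≠ 0 := by exact_mod_cast (c.mass_pos hħ).ne'
  refine Subtype.ext ?_
  rw [ZeroMemClass.coe_zero, Lp.eq_zero_iff_ae_eq_zero]
  filter_upwards [h1] with x hx
  rw [h x] at hx
  simpa [hm] using hx

theorem ComplexCoordinates.span_cohVec {ħ : ℝ} (hħ : 0 < ħ) :
    (Submodule.span ℂ (Set.range (c.cohVec hħ))).topologicalClosure = ⊤ := by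
  rw [Submodule.topologicalClosure_eq_top_iff, Submodule.eq_bot_iff]
  intro ψ hψ
  refine c.eq_zero_of_inner_cohVec hħ ψ fun x => ?_
  exact hψ _ (Submodule.subset_span ⟨x, rfl⟩)

theorem ComplexCoordinates.clm_ext {ħ : ℝ} (hħ : 0 < ħ) {F : Type*} [NormedAddCommGroup F]
    [NormedSpace ℂ F] {S T : physicalSpace ω ħ →L[ℂ] F}
    (h : ∀ x, S (c.cohVec hħ x) = T (c.cohVec hħ x)) : S = T :=
  ContinuousLinearMap.ext_on (Submodule.dense_iff_topologicalClosure_eq_top.2 (c.span_cohVec hħ))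
    (by rintro _ ⟨x, rfl⟩; exact h x)

/-- An `L²`-function which is reproduced by the coherent states lies in the physical Hilbert
space. -/
theorem ComplexCoordinates.mem_physicalSpace {ħ : ℝ} (hħ : 0 < ħ)
    (ψ : Lp ℂ 2 (symplecticVolume ω)) (h : ∀ᵐ x ∂(symplecticVolume ω),
      (c.mass ħ : ℂ) * ψ x = ⟪(c.cohVec hħ x : Lp ℂ 2 (symplecticVolume ω)), ψ⟫_ℂ) :
    ψ ∈ physicalSpace ω ħ := by
  -- The projection of ψ has the same pairings with coherent states as ψ and is reproduced by them
  -- too, so the two agree almost everywhere.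
  set P := (physicalSpace ω ħ).orthogonalProjectionOnto ψ with hP
  have h1 := c.ae_eq_inner_cohVec hħ P
  have hm : (c.mass ħ : ℂ) ≠ 0 := by exact_mod_cast (c.mass_pos hħ).ne'
  have h2 : ∀ x, ⟪c.cohVec hħ x, P⟫_ℂ = ⟪(c.cohVec hħ x : Lp ℂ 2 (symplecticVolume ω)), ψ⟫_ℂ :=
    fun x => by
      rw [hP]
      exact Submodule.inner_orthogonalProjectionOnto_eq_of_mem_left _ _
  have : ψ = P := by
    refine Lp.ext ?_
    filter_upwards [h, h1] with x hx hx'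
    rw [h2, ← hx] at hx'
    exact (mul_left_cancel₀ hm hx').symm
  rw [this]
  exact P.2

end Coherent

/-! ### Integrals of rank one operators -/

section RankOne

open InnerProductSpace

variable {H : Type*} [NormedAddCommGroup H] [InnerProductSpace ℂ H]

theorem isCompactOperator_rankOne (a b : H) : IsCompactOperator (rankOne ℂ a b) := by
  have h : IsCompactOperator (ContinuousLinearMap.toSpanSingleton ℂ a) :=
    (isCompactOperator_id_iff_finiteDimensional (𝕜 := ℂ) (E := ℂ)).2 inferInstance
      |>.clm_comp (ContinuousLinearMap.toSpanSingleton ℂ a)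
  exact h.comp_clm (innerSL ℂ b)

theorem isCompactOperator_smul_rankOne (s : ℂ) (a b : H) :
    IsCompactOperator (s • rankOne ℂ a b) :=
  (compactOperator (RingHom.id ℂ) H H).smul_mem s (isCompactOperator_rankOne a b)

variable [CompleteSpace H]

/-- The compact operators form a closed, hence complete, subspace, inside which the Bochner integral
can be computed. -/
theorem isCompactOperator_integral {X : Type*} [MeasurableSpace X] {μ : Measure X}
    {F : X → H →L[ℂ] H} (hF : Integrable F μ) (h : ∀ x, IsCompactOperator (F x)) :
    IsCompactOperator (∫ x, F x ∂μ : H →L[ℂ] H) := by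
  let S : Submodule ℂ (H →L[ℂ] H) := compactOperator (RingHom.id ℂ) H H
  have hS : IsClosed (S : Set (H →L[ℂ] H)) := isClosed_setOfPred_isCompactOperator
  haveI : CompleteSpace S := hS.completeSpace_coe
  let F' : X → S := fun x => ⟨F x, h x⟩
  have h1 := S.subtypeL.integral_comp_comm (φ := F') (μ := μ) ?_
  · have h2 : (∫ x, F x ∂μ) = ((∫ x, F' x ∂μ : S) : H →L[ℂ] H) := h1
    rw [h2]
    exact (∫ x, F' x ∂μ : S).2
  · refine ⟨?_, hF.2⟩
    exact Topology.IsEmbedding.subtypeVal.aestronglyMeasurable_comp_iff.1 hF.1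

theorem continuous_rankOne {X : Type*} [TopologicalSpace X] {e : X → H} (he : Continuous e) :
    Continuous fun x => rankOne ℂ (e x) (e x) := by
  have h : Continuous fun x => ContinuousLinearMap.smulRightL ℂ H H (innerSL ℂ (e x)) (e x) :=
    ((ContinuousLinearMap.smulRightL ℂ H H).continuous.comp
      ((innerSL ℂ).continuous.comp he)).clm_apply he
  exact h

variable {X : Type*} [TopologicalSpace X] [MeasurableSpace X] [BorelSpace X]
  [SecondCountableTopology X] {μ : Measure X}

theorem integrable_smul_rankOne {e : X → H} (he : Continuous e) {m : ℝ}
    (hm : ∀ x, ‖e x‖ ^ 2 = m) {f : X → ℂ} (hf : Integrable f μ) :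
    Integrable (fun x => f x • rankOne ℂ (e x) (e x)) μ := by
  refine hf.smul_bdd (C := m) (continuous_rankOne he).aestronglyMeasurable
    (Eventually.of_forall fun x => ?_)
  rw [norm_rankOne, ← sq, hm]

theorem inner_integral_smul_rankOne {e : X → H} {f : X → ℂ}
    (hi : Integrable (fun x => f x • rankOne ℂ (e x) (e x)) μ) (φ ψ : H) :
    ⟪φ, (∫ x, f x • rankOne ℂ (e x) (e x) ∂μ) ψ⟫_ℂ =
      ∫ x, f x * (⟪φ, e x⟫_ℂ * ⟪e x, ψ⟫_ℂ) ∂μ := by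
  rw [ContinuousLinearMap.integral_apply hi, ← integral_inner (hi.apply_continuousLinearMap ψ)]
  refine integral_congr_ae (Eventually.of_forall fun x => ?_)
  simp only [smul_apply, rankOne_apply, inner_smul_right]
  ring

end RankOne

/-! ### Toeplitz operators, their compactness, and the Toeplitz operators of characters -/

section Toeplitz

variable {V : Type*} [NormedAddCommGroup V] [InnerProductSpace ℝ V] [FiniteDimensional ℝ V]
variable [MeasurableSpace V] [BorelSpace V] (ω : SymplecticForm V) (ħ : ℝ)

/-- The Toeplitz operator of an essentially bounded function. -/
def toeplitzLp (f : Lp ℂ ∞ (symplecticVolume ω)) : physicalSpace ω ħ →L[ℂ] physicalSpace ω ħ :=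
  (physicalSpace ω ħ).orthogonalProjectionOnto ∘L
    (ContinuousLinearMap.mul ℂ ℂ).holderL (symplecticVolume ω) ∞ 2 2 f ∘L
      (physicalSpace ω ħ).subtypeL

theorem toeplitz_eq (f : 𝓢(V, ℂ)) :
    toeplitz ω ħ f = toeplitzLp ω ħ (f.memLp_top (symplecticVolume ω)).toLp := rfl

variable {ω ħ}

theorem inner_toeplitzLp {F : Lp ℂ ∞ (symplecticVolume ω)} {f : V → ℂ}
    (hf : F =ᵐ[symplecticVolume ω] f) (φ ψ : physicalSpace ω ħ) :
    ⟪φ, toeplitzLp ω ħ F ψ⟫_ℂ = ∫ x, star ((φ : Lp ℂ 2 (symplecticVolume ω)) x) *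
      (f x * (ψ : Lp ℂ 2 (symplecticVolume ω)) x) ∂(symplecticVolume ω) := by
  rw [toeplitzLp, ContinuousLinearMap.comp_apply,
    Submodule.inner_orthogonalProjectionOnto_eq_of_mem_left]
  refine inner_eq_integral_of_ae ae_eq_rfl ?_
  rw [ContinuousLinearMap.comp_apply, ContinuousLinearMap.holderL_apply_apply]
  filter_upwards [(ContinuousLinearMap.mul ℂ ℂ).coeFn_holder (r := 2) F
    (ψ : Lp ℂ 2 (symplecticVolume ω)), hf] with x h1 h2
  rw [← h2]
  exact h1

theorem inner_toeplitz (f : 𝓢(V, ℂ)) (φ ψ : physicalSpace ω ħ) :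
    ⟪φ, toeplitz ω ħ f ψ⟫_ℂ = ∫ x, f x * (star ((φ : Lp ℂ 2 (symplecticVolume ω)) x) *
      (ψ : Lp ℂ 2 (symplecticVolume ω)) x) ∂(symplecticVolume ω) := by
  rw [toeplitz_eq, inner_toeplitzLp (MemLp.coeFn_toLp _)]
  exact integral_congr_ae (Eventually.of_forall fun x => by ring)

theorem norm_toeplitzLp_le (F : Lp ℂ ∞ (symplecticVolume ω)) : ‖toeplitzLp ω ħ F‖ ≤ ‖F‖ := by
  refine ContinuousLinearMap.opNorm_le_bound _ (norm_nonneg _) fun ψ => ?_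
  rw [toeplitzLp, ContinuousLinearMap.comp_apply, ContinuousLinearMap.comp_apply,
    ContinuousLinearMap.holderL_apply_apply]
  refine (Submodule.norm_orthogonalProjectionOnto_apply_le _ _).trans ?_
  refine (ContinuousLinearMap.norm_holder_apply_apply_le _ _ _).trans ?_
  simp

theorem norm_toLp_top_le {f : V → ℂ} (hf : MemLp f ∞ (symplecticVolume ω)) {M : ℝ} (hM : 0 ≤ M)
    (h : ∀ x, ‖f x‖ ≤ M) : ‖hf.toLp‖ ≤ M := by
  rw [Lp.norm_toLp, eLpNorm_exponent_top]
  refine ENNReal.toReal_le_of_le_ofReal hM ?_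
  exact eLpNormEssSup_le_of_ae_bound (Eventually.of_forall h)

theorem norm_toeplitz_le (f : 𝓢(V, ℂ)) {M : ℝ} (hM : 0 ≤ M) (h : ∀ x, ‖f x‖ ≤ M) :
    ‖toeplitz ω ħ f‖ ≤ M :=
  (norm_toeplitzLp_le _).trans (norm_toLp_top_le _ hM h)

theorem adjoint_toeplitz (f g : 𝓢(V, ℂ)) (h : ∀ x, g x = star (f x)) :
    toeplitz ω ħ g = ContinuousLinearMap.adjoint (toeplitz ω ħ f) := by
  rw [ContinuousLinearMap.eq_adjoint_iff]
  intro φ ψ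
  rw [← inner_conj_symm, inner_toeplitz, inner_toeplitz, ← integral_conj]
  refine integral_congr_ae (Eventually.of_forall fun x => ?_)
  simp only [h, map_mul, Complex.star_def, Complex.conj_conj]
  ring

theorem toeplitz_one (f : 𝓢(V, ℂ)) (h : ∀ x, f x = 1) : toeplitz ω ħ f = 1 := by
  ext1 ψ
  refine ext_inner_left ℂ fun φ => ?_
  rw [inner_toeplitz, one_apply_eq_self, Submodule.coe_inner, inner_eq_integral]
  simp [h]

variable {N : ℕ} (c : ComplexCoordinates ω N)

theorem ComplexCoordinates.ext_cohVec (hħ : 0 < ħ) {φ ψ : physicalSpace ω ħ}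
    (h : ∀ x, ⟪c.cohVec hħ x, φ⟫_ℂ = ⟪c.cohVec hħ x, ψ⟫_ℂ) : φ = ψ := by
  rw [← sub_eq_zero]
  refine c.eq_zero_of_inner_cohVec hħ _ fun x => ?_
  rw [inner_sub_right, h, sub_self]

theorem ComplexCoordinates.continuous_coh (y : V) : Continuous fun x => c.coh ħ x y := by
  refine Complex.continuous_exp.comp (Continuous.div_const ?_ _)
  exact ((c.continuous_herm continuous_const continuous_id).sub continuous_const).sub
    ((c.continuous_herm continuous_id continuous_id).div_const _)

/-- All coherent vectors have the same norm, so their distance is governed by the real part of their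
inner product, an explicit continuous function. -/
theorem ComplexCoordinates.continuous_cohVec (hħ : 0 < ħ) : Continuous (c.cohVec (ω := ω) hħ) := by
  rw [continuous_iff_continuousAt]
  intro y
  rw [ContinuousAt, tendsto_iff_norm_sub_tendsto_zero]
  have h1 : ∀ x, ‖c.cohVec hħ x - c.cohVec hħ y‖ ^ 2 =
      2 * c.mass ħ - 2 * (c.mass ħ * (c.coh ħ x y).re) := by
    intro x
    rw [@norm_sub_sq ℂ, c.norm_cohVec_sq, c.norm_cohVec_sq, ← inner_conj_symm, c.inner_cohVec]
    simp
    ring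
  have h2 : Tendsto (fun x => ‖c.cohVec hħ x - c.cohVec hħ y‖ ^ 2) (𝓝 y) (𝓝 0) := by
    simp only [h1]
    have h3 := ((Complex.continuous_re.comp (c.continuous_coh (ħ := ħ) y)).const_mul
      (c.mass ħ)).const_mul 2
    have h4 := (h3.tendsto y).const_sub (2 * c.mass ħ)
    simpa [c.coh_self] using h4
  have h3 := h2.sqrt
  simpa [Real.sqrt_sq (norm_nonneg _)] using h3

/-- Toeplitz operators as superpositions of coherent state projections. -/
theorem ComplexCoordinates.inner_toeplitz_eq (hħ : 0 < ħ) (f : 𝓢(V, ℂ))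
    (φ ψ : physicalSpace ω ħ) :
    ⟪φ, toeplitz ω ħ f ψ⟫_ℂ = ∫ x, ((c.mass ħ : ℂ)⁻¹ ^ 2 * f x) *
      (⟪φ, c.cohVec hħ x⟫_ℂ * ⟪c.cohVec hħ x, ψ⟫_ℂ) ∂(symplecticVolume ω) := by
  have hm : (c.mass ħ : ℂ) ≠ 0 := by exact_mod_cast (c.mass_pos hħ).ne'
  rw [inner_toeplitz]
  refine integral_congr_ae ?_
  filter_upwards [c.ae_eq_inner_cohVec hħ φ, c.ae_eq_inner_cohVec hħ ψ] with x h1 h2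
  rw [← h2, ← inner_conj_symm φ, ← h1]
  simp only [map_mul, Complex.conj_ofReal, Complex.star_def]
  field_simp

theorem ComplexCoordinates.toeplitz_eq_integral (hħ : 0 < ħ) (f : 𝓢(V, ℂ)) :
    toeplitz ω ħ f = ∫ x, ((c.mass ħ : ℂ)⁻¹ ^ 2 * f x) •
      InnerProductSpace.rankOne ℂ (c.cohVec hħ x) (c.cohVec hħ x) ∂(symplecticVolume ω) := by
  ext1 ψ
  refine ext_inner_left ℂ fun φ => ?_
  rw [c.inner_toeplitz_eq hħ]
  exact (inner_integral_smul_rankOne (integrable_smul_rankOne (c.continuous_cohVec hħ)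
    (c.norm_cohVec_sq hħ) (f.integrable.const_mul _)) φ ψ).symm

/-- The coherent state formula is a Bochner integral of rank one operators: the projections have
constant norm and f is integrable. -/
theorem isCompactOperator_toeplitz (hħ : 0 < ħ) (f : 𝓢(V, ℂ)) :
    IsCompactOperator (toeplitz ω ħ f) := by
  obtain ⟨N, ⟨c⟩⟩ := ω.exists_complexCoordinates
  rw [c.toeplitz_eq_integral hħ f]
  exact isCompactOperator_integral (integrable_smul_rankOne (c.continuous_cohVec hħ)
    (c.norm_cohVec_sq hħ) (f.integrable.const_mul _)) fun x =>
    isCompactOperator_smul_rankOne _ _ _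

/-- The character `x ↦ exp(z(x) z̄(u) - z(u) z̄(x))`. -/
def ComplexCoordinates.character (u x : V) : ℂ := Complex.exp (c.herm x u - c.herm u x)

theorem ComplexCoordinates.norm_character (u x : V) : ‖c.character u x‖ = 1 := by
  rw [ComplexCoordinates.character, ← c.star_herm x u, Complex.norm_exp]
  simp

theorem ComplexCoordinates.continuous_character : Continuous fun p : V × V => c.character p.1 p.2 :=
  Complex.continuous_exp.comp ((c.continuous_herm continuous_snd continuous_fst).sub
    (c.continuous_herm continuous_fst continuous_snd))

theorem ComplexCoordinates.character_add (u v x : V) :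
    c.character (u + v) x = c.character u x * c.character v x := by
  rw [ComplexCoordinates.character, c.herm_add_left, c.herm_add_right,
    ComplexCoordinates.character, ComplexCoordinates.character, ← Complex.exp_add]
  ring_nf

theorem ComplexCoordinates.character_neg (u x : V) :
    c.character (-u) x = star (c.character u x) := by
  rw [ComplexCoordinates.character, ComplexCoordinates.character, Complex.star_def,
    ← Complex.exp_conj, map_sub, ← Complex.star_def, c.star_herm, c.star_herm, c.herm_neg_left,
    c.herm_neg_right]
  ring_nf

theorem ComplexCoordinates.memLp_character (u : V) :
    MemLp (c.character u) ∞ (symplecticVolume ω) :=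
  memLp_top_of_bound ((c.continuous_character.comp
    (Continuous.prodMk_right u)).aestronglyMeasurable) 1
    (Eventually.of_forall fun x => (c.norm_character u x).le)

/-- The Toeplitz operator of a character. -/
def ComplexCoordinates.weyl (ħ : ℝ) (u : V) : physicalSpace ω ħ →L[ℂ] physicalSpace ω ħ :=
  toeplitzLp ω ħ (c.memLp_character u).toLp

theorem ComplexCoordinates.inner_weyl (u : V) (φ ψ : physicalSpace ω ħ) :
    ⟪φ, c.weyl ħ u ψ⟫_ℂ = ∫ x, (star ((φ : Lp ℂ 2 (symplecticVolume ω)) x) *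
      (ψ : Lp ℂ 2 (symplecticVolume ω)) x) * c.character u x ∂(symplecticVolume ω) := by
  rw [ComplexCoordinates.weyl, inner_toeplitzLp (MemLp.coeFn_toLp _)]
  exact integral_congr_ae (Eventually.of_forall fun x => by ring)

theorem ComplexCoordinates.norm_weyl_le (u : V) : ‖c.weyl ħ u‖ ≤ 1 :=
  (norm_toeplitzLp_le _).trans (norm_toLp_top_le _ zero_le_one fun x => (c.norm_character u x).le)

theorem ComplexCoordinates.adjoint_weyl (u : V) :
    c.weyl ħ (-u) = ContinuousLinearMap.adjoint (c.weyl ħ u) := by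
  rw [ContinuousLinearMap.eq_adjoint_iff]
  intro φ ψ
  rw [← inner_conj_symm, c.inner_weyl, c.inner_weyl, ← integral_conj]
  refine integral_congr_ae (Eventually.of_forall fun x => ?_)
  simp only [c.character_neg, map_mul, Complex.star_def, Complex.conj_conj]
  ring

/-- The character is absorbed into the coherent states: pointwise, ē_x e_y χ_u is a constant times
the product of ē and e centred at x - ħu and y + ħu. The reproducing property then evaluates the
matrix element, and totality of the e_x finishes. -/
theorem ComplexCoordinates.weyl_cohVec (hħ : 0 < ħ) (u y : V) :
    c.weyl ħ u (c.cohVec hħ y) =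
      Complex.exp ((c.herm y u - c.herm u y) / 2 - ħ * c.herm u u / 2) •
        c.cohVec hħ (y + ħ • u) := by
  have hħ0 : (ħ : ℂ) ≠ 0 := by exact_mod_cast hħ.ne'
  refine c.ext_cohVec hħ fun x => ?_
  refine Eq.trans ?_ (inner_smul_right (𝕜 := ℂ) (E := physicalSpace ω ħ) _ _ _).symm
  rw [c.inner_cohVec, c.inner_weyl]
  have h1 : ∀ w, (star (c.coh ħ x w) * c.coh ħ y w) * c.character u w =
      Complex.exp ((c.herm (x - ħ • u) (x - ħ • u) - c.herm x x + c.herm (y + ħ • u) (y + ħ • u)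
        - c.herm y y) / 2 / ħ) * (star (c.coh ħ (x - ħ • u) w) * c.coh ħ (y + ħ • u) w) := by
    intro w
    have h : ∀ x y, (starRingEnd ℂ) (c.herm x y) = c.herm y x := fun x y => c.star_herm x y
    simp only [ComplexCoordinates.coh, ComplexCoordinates.character, Complex.star_def,
      ← Complex.exp_conj, ← Complex.exp_add]
    congr 1
    simp only [map_div₀, map_sub, map_mul, h, Complex.conj_ofReal, map_ofNat, c.herm_add_left,
      c.herm_add_right, c.herm_sub_left, c.herm_sub_right, c.herm_smul_left, c.herm_smul_right,
      map_mul]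
    field_simp
    ring
  have h2 : ∫ w, (star ((c.cohVec hħ x : Lp ℂ 2 (symplecticVolume ω)) w) *
      (c.cohVec hħ y : Lp ℂ 2 (symplecticVolume ω)) w) * c.character u w ∂(symplecticVolume ω) =
      Complex.exp ((c.herm (x - ħ • u) (x - ħ • u) - c.herm x x + c.herm (y + ħ • u) (y + ħ • u)
        - c.herm y y) / 2 / ħ) * (c.mass ħ * c.coh ħ (y + ħ • u) (x - ħ • u)) := by
    rw [← c.integral_star_coh_mul hħ (c.isHolomorphicSection_coh ħ _) (c.memLp_coh hħ _ _),
      ← integral_const_mul]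
    refine integral_congr_ae ?_
    filter_upwards [c.coeFn_cohVec hħ x, c.coeFn_cohVec hħ y] with w hx hy
    rw [hx, hy, h1]
  rw [h2, mul_left_comm, mul_left_comm _ (c.mass ħ : ℂ)]
  congr 1
  simp only [ComplexCoordinates.coh, ← Complex.exp_add]
  congr 1
  simp only [c.herm_add_left,
      c.herm_add_right, c.herm_sub_left, c.herm_sub_right, c.herm_smul_left, c.herm_smul_right]
  field_simp
  ring

/-- Checked on coherent states. The cocycle is the full hermitian form, not only its imaginary part:
it can exceed 1 in modulus although all Weyl operators are contractions, and its power series is the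
star product. -/
theorem ComplexCoordinates.weyl_mul_weyl (hħ : 0 < ħ) (u v : V) :
    c.weyl ħ v * c.weyl ħ u = Complex.exp (ħ * c.herm u v) • c.weyl ħ (u + v) := by
  refine c.clm_ext hħ fun y => ?_
  rw [mul_apply_eq_comp, smul_apply, c.weyl_cohVec, c.weyl_cohVec,
    map_smul, c.weyl_cohVec, smul_smul, smul_smul, smul_add, add_assoc, ← Complex.exp_add,
    ← Complex.exp_add]
  congr 2
  simp only [c.herm_add_left, c.herm_add_right, c.herm_smul_left, c.herm_smul_right]
  ring

end Toeplitz

/-! ### Taylor remainder of the exponential -/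

section Exponential

/-- The remainder of the exponential series, with the sharp growth in the left half plane. -/
theorem norm_exp_sub_sum_le (n : ℕ) (w : ℂ) :
    ‖Complex.exp w - ∑ j ∈ Finset.range n, w ^ j / (j.factorial : ℂ)‖ ≤
      ‖w‖ ^ n / n.factorial * max 1 (Real.exp w.re) := by
  induction n generalizing w with
  | zero => simp [Complex.norm_exp]
  | succ n ih =>
    set R : ℕ → ℂ → ℂ := fun n w =>
      Complex.exp w - ∑ j ∈ Finset.range n, w ^ j / (j.factorial : ℂ) with hR
    -- The remainders satisfy R_{n+1}' = R_n and R_{n+1}(0) = 0, so the bound for n is integrated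
    -- along the segment from 0 to w.
    have hd : ∀ w, HasDerivAt (R (n + 1)) (R n w) w := by
      intro w
      have h1 : HasDerivAt (fun w : ℂ => ∑ j ∈ Finset.range (n + 1), w ^ j / (j.factorial : ℂ))
          (∑ j ∈ Finset.range (n + 1), (j * w ^ (j - 1)) / (j.factorial : ℂ)) w :=
        HasDerivAt.fun_sum fun j _ => (hasDerivAt_pow j w).div_const _
      have h2 : ∑ j ∈ Finset.range (n + 1), ((j : ℂ) * w ^ (j - 1)) / (j.factorial : ℂ) =
          ∑ j ∈ Finset.range n, w ^ j / (j.factorial : ℂ) := by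
        rw [Finset.sum_range_succ']
        simp only [Nat.cast_zero, zero_mul, zero_div, add_zero]
        refine Finset.sum_congr rfl fun j _ => ?_
        rw [Nat.factorial_succ, Nat.cast_mul, Nat.add_sub_cancel, mul_div_mul_left]
        exact_mod_cast j.succ_ne_zero
      rw [h2] at h1
      exact (Complex.hasDerivAt_exp w).sub h1
    set C := ‖w‖ ^ (n + 1) / n.factorial * max 1 (Real.exp w.re) with hC
    have h3 : ∀ t : ℝ, HasDerivAt (fun t : ℝ => R (n + 1) (t * w)) (w * R n (t * w)) t := by
      intro t
      have h4 : HasDerivAt (fun t : ℝ => (t : ℂ) * w) w t := by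
        simpa using (Complex.ofRealCLM.hasDerivAt (x := t)).mul_const w
      have h8 := (hd (t * w)).comp t h4
      rw [mul_comm] at h8
      exact h8
    have h5 : ∀ t ∈ Set.Icc (0 : ℝ) 1, ‖w * R n (t * w)‖ ≤ C * t ^ n := by
      intro t ht
      rw [norm_mul]
      refine (mul_le_mul_of_nonneg_left (ih (t * w)) (norm_nonneg w)).trans ?_
      -- The maximum with 1 makes the bound at the endpoint w valid on the whole segment, whatever
      -- the sign of Re w.
      have h6 : max 1 (Real.exp ((t : ℂ) * w).re) ≤ max 1 (Real.exp w.re) := by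
        rw [Complex.re_ofReal_mul]
        rcases le_total 0 w.re with h | h
        · exact max_le_max le_rfl (Real.exp_le_exp.2 (mul_le_of_le_one_left h ht.2))
        · refine max_le (le_max_left _ _) ((Real.exp_le_one_iff.2 ?_).trans (le_max_left _ _))
          exact mul_nonpos_of_nonneg_of_nonpos ht.1 h
      rw [norm_mul, Complex.norm_real, Real.norm_of_nonneg ht.1]
      calc ‖w‖ * ((t * ‖w‖) ^ n / n.factorial * max 1 (Real.exp ((t : ℂ) * w).re))
          ≤ ‖w‖ * ((t * ‖w‖) ^ n / n.factorial * max 1 (Real.exp w.re)) := by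
            have := ht.1
            gcongr
        _ = C * t ^ n := by rw [hC]; ring
    have h7 : ‖R (n + 1) ((1 : ℝ) * w)‖ ≤ C * 1 ^ (n + 1) / (n + 1) := by
      refine image_norm_le_of_norm_deriv_right_le_deriv_boundary (a := 0) (b := 1)
        (f := fun t : ℝ => R (n + 1) (t * w)) (f' := fun t => w * R n (t * w))
        (B := fun t => C * t ^ (n + 1) / (n + 1)) (B' := fun t => C * t ^ n)
        (fun t _ => (h3 t).continuousAt.continuousWithinAt)
        (fun t _ => (h3 t).hasDerivWithinAt) ?_ ?_ (fun t ht => h5 t ⟨ht.1, ht.2.le⟩)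
        ⟨zero_le_one, le_rfl⟩
      · simp only [hR, Complex.ofReal_zero, zero_mul, Complex.exp_zero]
        rw [Finset.sum_range_succ']
        simp
      · intro t
        have h8 := ((hasDerivAt_pow (n + 1) t).const_mul C).div_const ((n : ℝ) + 1)
        refine h8.congr_deriv ?_
        have : (n : ℝ) + 1 ≠ 0 := by positivity
        rw [Nat.add_sub_cancel, Nat.cast_add_one]
        field_simp
    rw [Complex.ofReal_one, one_mul] at h7
    refine h7.trans (le_of_eq ?_)
    rw [hC, Nat.factorial_succ]
    push_cast
    field_simp
    ring

end Exponential

/-! ### Norm bounds from matrix elements -/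

section Hilbert

variable {H : Type*} [NormedAddCommGroup H] [InnerProductSpace ℂ H]

theorem norm_le_of_norm_inner_le {T : H →L[ℂ] H} {C : ℝ} (hC : 0 ≤ C)
    (h : ∀ φ ψ, ‖⟪φ, T ψ⟫_ℂ‖ ≤ C * (‖φ‖ * ‖ψ‖)) : ‖T‖ ≤ C := by
  refine T.opNorm_le_bound hC fun ψ => ?_
  have h1 := h (T ψ) ψ
  rw [inner_self_eq_norm_sq_to_K, norm_pow, RCLike.norm_ofReal, abs_norm] at h1
  rcases (norm_nonneg (T ψ)).eq_or_lt with h2 | h2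
  · rw [← h2]; positivity
  · nlinarith

theorem inner_sub_sum_apply {ι : Type*} (s : Finset ι) (a : ι → ℂ) (T : H →L[ℂ] H)
    (S : ι → H →L[ℂ] H) (φ ψ : H) :
    ⟪φ, (T - ∑ i ∈ s, a i • S i) ψ⟫_ℂ = ⟪φ, T ψ⟫_ℂ - ∑ i ∈ s, a i * ⟪φ, S i ψ⟫_ℂ := by
  simp

theorem norm_inner_le_of_norm_le_one {T : H →L[ℂ] H} (hT : ‖T‖ ≤ 1) (φ ψ : H) : ‖⟪φ, T ψ⟫_ℂ‖ ≤ ‖φ‖ * ‖ψ‖ := by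
  refine (norm_inner_le_norm _ _).trans ?_
  have := T.le_of_opNorm_le hT ψ
  gcongr
  linarith

end Hilbert

/-! ### Toeplitz operators as Fourier superpositions of Weyl operators -/

section Fourier

open scoped FourierTransform LineDeriv

variable {V : Type*} [NormedAddCommGroup V] [InnerProductSpace ℝ V] [FiniteDimensional ℝ V]
variable {ω : SymplecticForm V} {ħ : ℝ}
variable {N : ℕ} (c : ComplexCoordinates ω N)

/-- The vector whose character is the plane wave of frequency `ξ`. -/
def frequency (ω : SymplecticForm V) : V →L[ℝ] V :=
  LinearMap.toContinuousLinearMap (-(2 * Real.pi) • ω.E.toLinearMap)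

theorem form_frequency (ξ x : V) : ω.form x (frequency ω ξ) = -(2 * Real.pi * ⟪ξ, x⟫_ℝ) := by
  have h := ω.inner_structureOperator x (ω.E ξ)
  rw [ω.structureOperator_E] at h
  simp [frequency, ← h, real_inner_comm ξ x]

/-- The frequency map is F = -2πE because h(x, Fξ) - h(Fξ, x) = -i ω(x, Fξ) = 2πi ⟨ξ, x⟩. -/
theorem ComplexCoordinates.fourierChar_eq (ξ x : V) :
    (Real.fourierChar ⟪ξ, x⟫_ℝ : ℂ) = c.character (frequency ω ξ) x := by
  rw [Real.fourierChar_apply, ComplexCoordinates.character]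
  congr 1
  have h := c.form_eq_herm x (frequency ω ξ)
  rw [form_frequency] at h
  have h2 : c.herm x (frequency ω ξ) - c.herm (frequency ω ξ) x =
      -Complex.I * (Complex.I * (c.herm x (frequency ω ξ) - c.herm (frequency ω ξ) x)) := by
    rw [← mul_assoc, neg_mul, Complex.I_mul_I, neg_neg, one_mul]
  rw [h2, ← h]
  push_cast
  ring

theorem ComplexCoordinates.z_frequency (ξ : V) (k : Fin N) :
    c.z (frequency ω ξ) k = Real.pi * ⟪ξ, c.z.symm (Pi.single k Complex.I)⟫_ℝ -
      Real.pi * ⟪ξ, c.z.symm (Pi.single k 1)⟫_ℝ * Complex.I := by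
  have h1 := c.form_single_one k (frequency ω ξ)
  have h2 := c.form_single_I k (frequency ω ξ)
  rw [form_frequency] at h1 h2
  apply Complex.ext
  · simp; linarith
  · simp; linarith

variable [MeasurableSpace V] [BorelSpace V]

/-- Parseval's identity for a Schwartz function and an integrable function. -/
theorem ComplexCoordinates.integral_mul_eq (μ : Measure V) [SigmaFinite μ] (f : 𝓢(V, ℂ))
    {h : V → ℂ} (hh : Integrable h μ) :
    ∫ x, f x * h x ∂μ = ∫ ξ, (𝓕 f : 𝓢(V, ℂ)) ξ * ∫ x, h x * c.character (frequency ω ξ) x ∂μ := by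
  -- The pairing carries a minus sign so that the flipped transform of 𝓕 f is the inverse transform,
  -- which returns f.
  have h1 := VectorFourier.integral_bilin_fourierIntegral_eq_flip (e := Real.fourierChar)
    (μ := μ) (ν := volume) (L := -(innerₗ V)) (f := h) (g := (𝓕 f : 𝓢(V, ℂ)))
    (ContinuousLinearMap.mul ℂ ℂ) Real.continuous_fourierChar
    (by
      have : Continuous fun p : V × V => -⟪p.1, p.2⟫_ℝ := by fun_prop
      exact this) hh (𝓕 f : 𝓢(V, ℂ)).integrable
  have h2 : ∀ x, VectorFourier.fourierIntegral Real.fourierChar volume (-(innerₗ V)).flip (𝓕 f : 𝓢(V, ℂ)) x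
      = f x := by
    intro x
    have h3 : (𝓕⁻ (𝓕 f) : 𝓢(V, ℂ)) x = f x := by rw [FourierTransform.fourierInv_fourier_eq]
    rw [← h3, SchwartzMap.fourierInv_coe, Real.fourierInv_eq]
    refine integral_congr_ae (Eventually.of_forall fun ξ => ?_)
    simp [real_inner_comm]
  simp only [ContinuousLinearMap.mul_apply', h2] at h1
  rw [show ∫ x, f x * h x ∂μ = ∫ x, h x * f x ∂μ by simp only [mul_comm], ← h1]
  refine integral_congr_ae (Eventually.of_forall fun ξ => ?_)
  simp only
  rw [mul_comm]
  congr 1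
  refine integral_congr_ae (Eventually.of_forall fun x => ?_)
  simp only [LinearMap.neg_apply, neg_neg, innerₗ_apply_apply, Circle.smul_def, smul_eq_mul]
  rw [real_inner_comm, c.fourierChar_eq, mul_comm]

/-- The matrix elements of the Weyl operators. -/
def ComplexCoordinates.matrixElement (φ ψ : physicalSpace ω ħ) (u : V) : ℂ :=
  ∫ x, (star ((φ : Lp ℂ 2 (symplecticVolume ω)) x) *
      (ψ : Lp ℂ 2 (symplecticVolume ω)) x) * c.character u x ∂(symplecticVolume ω)

theorem integrable_star_mul_coe (φ ψ : physicalSpace ω ħ) :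
    Integrable (fun x => star ((φ : Lp ℂ 2 (symplecticVolume ω)) x) *
      (ψ : Lp ℂ 2 (symplecticVolume ω)) x) (symplecticVolume ω) :=
  integrable_star_mul (Lp.memLp _) (Lp.memLp _)

theorem ComplexCoordinates.continuous_matrixElement (φ ψ : physicalSpace ω ħ) :
    Continuous (c.matrixElement φ ψ) := by
  have h := integrable_star_mul_coe φ ψ
  refine continuous_of_dominated (bound := fun x => ‖star ((φ : Lp ℂ 2 (symplecticVolume ω)) x) *
      (ψ : Lp ℂ 2 (symplecticVolume ω)) x‖) (fun u => ?_) (fun u => ?_) h.norm ?_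
  · exact h.1.mul (c.memLp_character u).1
  · refine Eventually.of_forall fun x => ?_
    rw [norm_mul, c.norm_character, mul_one]
  · refine Eventually.of_forall fun x => ?_
    exact continuous_const.mul (c.continuous_character.comp (Continuous.prodMk_left x))

theorem ComplexCoordinates.inner_weyl_eq (φ ψ : physicalSpace ω ħ) (u : V) :
    ⟪φ, c.weyl ħ u ψ⟫_ℂ = c.matrixElement φ ψ u := c.inner_weyl u φ ψ

theorem ComplexCoordinates.norm_matrixElement_le (φ ψ : physicalSpace ω ħ) (u : V) :
    ‖c.matrixElement φ ψ u‖ ≤ ‖φ‖ * ‖ψ‖ := by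
  rw [← c.inner_weyl_eq]
  exact norm_inner_le_of_norm_le_one (c.norm_weyl_le u) φ ψ

/-- Parseval's identity for the integrable function φ̄ψ. It is the weak form of T(f) = ∫ 𝓕f(ξ) W(Fξ)
dξ; all later expansions are made on matrix elements. -/
theorem ComplexCoordinates.inner_toeplitz_fourier (f : 𝓢(V, ℂ)) (φ ψ : physicalSpace ω ħ) :
    ⟪φ, toeplitz ω ħ f ψ⟫_ℂ = ∫ ξ, (𝓕 f : 𝓢(V, ℂ)) ξ * c.matrixElement φ ψ (frequency ω ξ) := by
  rw [inner_toeplitz, c.integral_mul_eq _ f (integrable_star_mul_coe φ ψ)]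
  rfl

end Fourier

/-! ### Star product coefficients in Fourier space -/

section Schwartz

open scoped FourierTransform LineDeriv

variable {V : Type*} [NormedAddCommGroup V] [InnerProductSpace ℝ V] [FiniteDimensional ℝ V]
variable {ω : SymplecticForm V} {ħ : ℝ}
variable {N : ℕ} (c : ComplexCoordinates ω N)

/-- The derivative `∂/∂z^k` of a Schwartz function. -/
def ComplexCoordinates.schwartzDz (k : Fin N) (f : 𝓢(V, ℂ)) : 𝓢(V, ℂ) :=
  (1 / 2 : ℂ) • (∂_{c.z.symm (Pi.single k 1)} f -
    Complex.I • ∂_{c.z.symm (Pi.single k Complex.I)} f)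

/-- The derivative `∂/∂z̄^k` of a Schwartz function. -/
def ComplexCoordinates.schwartzDzbar (k : Fin N) (f : 𝓢(V, ℂ)) : 𝓢(V, ℂ) :=
  (1 / 2 : ℂ) • (∂_{c.z.symm (Pi.single k 1)} f +
    Complex.I • ∂_{c.z.symm (Pi.single k Complex.I)} f)

theorem ComplexCoordinates.coe_schwartzDz (k : Fin N) (f : 𝓢(V, ℂ)) :
    ⇑(c.schwartzDz k f) = c.dz k f := by
  ext x
  simp [ComplexCoordinates.schwartzDz, ComplexCoordinates.dz,
    SchwartzMap.lineDerivOp_apply_eq_fderiv]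

theorem ComplexCoordinates.coe_schwartzDzbar (k : Fin N) (f : 𝓢(V, ℂ)) :
    ⇑(c.schwartzDzbar k f) = c.dzbar k f := by
  ext x
  simp [ComplexCoordinates.schwartzDzbar, ComplexCoordinates.dzbar,
    SchwartzMap.lineDerivOp_apply_eq_fderiv, mul_add]

theorem ComplexCoordinates.coe_foldr_schwartzDz (l : List (Fin N)) (f : 𝓢(V, ℂ)) :
    ⇑(l.foldr c.schwartzDz f) = l.foldr c.dz f := by
  induction l with
  | nil => rfl
  | cons k l ih => rw [List.foldr_cons, List.foldr_cons, c.coe_schwartzDz, ih]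

theorem ComplexCoordinates.coe_foldr_schwartzDzbar (l : List (Fin N)) (f : 𝓢(V, ℂ)) :
    ⇑(l.foldr c.schwartzDzbar f) = l.foldr c.dzbar f := by
  induction l with
  | nil => rfl
  | cons k l ih => rw [List.foldr_cons, List.foldr_cons, c.coe_schwartzDzbar, ih]

/-- The product of Schwartz functions. -/
def schwartzMul (f g : 𝓢(V, ℂ)) : 𝓢(V, ℂ) :=
  SchwartzMap.pairing (ContinuousLinearMap.mul ℂ ℂ) f g

theorem schwartzMul_apply (f g : 𝓢(V, ℂ)) (x : V) : schwartzMul f g x = f x * g x := by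
  simp [schwartzMul]

/-- The coefficients of the star product of Schwartz functions. -/
def ComplexCoordinates.schwartzStar (k : ℕ) (f g : 𝓢(V, ℂ)) : 𝓢(V, ℂ) :=
  ((-1) ^ k / (k.factorial : ℂ)) • ∑ i : Fin k → Fin N,
    schwartzMul ((List.ofFn i).foldr c.schwartzDz f) ((List.ofFn i).foldr c.schwartzDzbar g)

theorem ComplexCoordinates.coe_schwartzStar (k : ℕ) (f g : 𝓢(V, ℂ)) :
    ⇑(c.schwartzStar k f g) = c.starCoeff k f g := by
  ext x
  simp only [ComplexCoordinates.schwartzStar, ComplexCoordinates.starCoeff, smul_apply,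
    sum_apply, smul_eq_mul, schwartzMul_apply, c.coe_foldr_schwartzDz,
    c.coe_foldr_schwartzDzbar]

variable [MeasurableSpace V] [BorelSpace V]

theorem fourier_lineDeriv_apply (f : 𝓢(V, ℂ)) (m ξ : V) :
    (𝓕 (∂_{m} f) : 𝓢(V, ℂ)) ξ = 2 * Real.pi * Complex.I * ⟪ξ, m⟫_ℝ * (𝓕 f : 𝓢(V, ℂ)) ξ := by
  rw [SchwartzMap.fourier_lineDerivOp_eq, smul_apply, SchwartzMap.smulLeftCLM_apply_apply
    (by fun_prop)]
  simp [mul_assoc]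

/-- Directional derivatives become 2πi⟨ξ, ·⟩, and `z_frequency` recognises the combination as
z̄^k(Fξ), in accordance with ∂χ_u/∂z^k = z̄^k(u) χ_u. -/
theorem ComplexCoordinates.fourier_schwartzDz (k : Fin N) (f : 𝓢(V, ℂ)) (ξ : V) :
    (𝓕 (c.schwartzDz k f) : 𝓢(V, ℂ)) ξ =
      star (c.z (frequency ω ξ) k) * (𝓕 f : 𝓢(V, ℂ)) ξ := by
  have h : (𝓕 (c.schwartzDz k f) : 𝓢(V, ℂ)) =
      (1 / 2 : ℂ) • (𝓕 (∂_{c.z.symm (Pi.single k 1)} f) +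
        (-Complex.I) • 𝓕 (∂_{c.z.symm (Pi.single k Complex.I)} f)) := by
    rw [ComplexCoordinates.schwartzDz, FourierTransform.fourier_smul,
      sub_eq_add_neg, ← neg_smul, FourierTransform.fourier_add, FourierTransform.fourier_smul]
  rw [h, smul_apply, add_apply, smul_apply, fourier_lineDeriv_apply, fourier_lineDeriv_apply,
    c.z_frequency]
  simp only [smul_eq_mul, Complex.star_def, map_sub, map_mul, Complex.conj_ofReal, Complex.conj_I]
  linear_combination (-Real.pi * ⟪ξ, c.z.symm (Pi.single k Complex.I)⟫_ℝ *
    (𝓕 f : 𝓢(V, ℂ)) ξ) * Complex.I_mul_I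

theorem ComplexCoordinates.fourier_schwartzDzbar (k : Fin N) (f : 𝓢(V, ℂ)) (ξ : V) :
    (𝓕 (c.schwartzDzbar k f) : 𝓢(V, ℂ)) ξ =
      -c.z (frequency ω ξ) k * (𝓕 f : 𝓢(V, ℂ)) ξ := by
  have h : (𝓕 (c.schwartzDzbar k f) : 𝓢(V, ℂ)) =
      (1 / 2 : ℂ) • (𝓕 (∂_{c.z.symm (Pi.single k 1)} f) +
        Complex.I • 𝓕 (∂_{c.z.symm (Pi.single k Complex.I)} f)) := by
    rw [ComplexCoordinates.schwartzDzbar, FourierTransform.fourier_smul,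
      FourierTransform.fourier_add, FourierTransform.fourier_smul]
  rw [h, smul_apply, add_apply, smul_apply, fourier_lineDeriv_apply, fourier_lineDeriv_apply,
    c.z_frequency]
  simp only [smul_eq_mul]
  linear_combination (Real.pi * ⟪ξ, c.z.symm (Pi.single k Complex.I)⟫_ℝ *
    (𝓕 f : 𝓢(V, ℂ)) ξ) * Complex.I_mul_I

theorem ComplexCoordinates.fourier_foldr_schwartzDz (l : List (Fin N)) (f : 𝓢(V, ℂ)) (ξ : V) :
    (𝓕 (l.foldr c.schwartzDz f) : 𝓢(V, ℂ)) ξ =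
      (l.map fun k => star (c.z (frequency ω ξ) k)).prod * (𝓕 f : 𝓢(V, ℂ)) ξ := by
  induction l with
  | nil => simp
  | cons k l ih =>
    rw [List.foldr_cons, c.fourier_schwartzDz, ih, List.map_cons, List.prod_cons, mul_assoc]

theorem ComplexCoordinates.fourier_foldr_schwartzDzbar (l : List (Fin N)) (f : 𝓢(V, ℂ)) (ξ : V) :
    (𝓕 (l.foldr c.schwartzDzbar f) : 𝓢(V, ℂ)) ξ =
      (l.map fun k => -c.z (frequency ω ξ) k).prod * (𝓕 f : 𝓢(V, ℂ)) ξ := by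
  induction l with
  | nil => simp
  | cons k l ih =>
    rw [List.foldr_cons, c.fourier_schwartzDzbar, ih, List.map_cons, List.prod_cons, mul_assoc]

/-- Expanding the power of the sum h(v, u) over index tuples. The sign (-1)^j will cancel that of
the star product coefficient. -/
theorem ComplexCoordinates.sum_prod_ofFn (j : ℕ) (u v : V) :
    ∑ i : Fin j → Fin N, ((List.ofFn i).map fun k => star (c.z u k)).prod *
      ((List.ofFn i).map fun k => -c.z v k).prod = (-1) ^ j * c.herm v u ^ j := by
  rw [← mul_pow, ComplexCoordinates.herm, Finset.mul_sum, Finset.sum_pow', Fintype.piFinset_univ]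
  refine Finset.sum_congr rfl fun i _ => ?_
  rw [List.map_ofFn, List.map_ofFn, List.prod_ofFn, List.prod_ofFn, ← Finset.prod_mul_distrib]
  refine Finset.prod_congr rfl fun l _ => ?_
  simp only [Function.comp_apply]
  ring

theorem integrable_fourier_mul_fourier (f g : 𝓢(V, ℂ)) {K : V × V → ℂ} (hK : Continuous K) {C : ℝ}
    (n : ℕ) (hC : ∀ p, ‖K p‖ ≤ C * (‖p.1‖ ^ n * ‖p.2‖ ^ n)) :
    Integrable (fun p : V × V => (𝓕 f : 𝓢(V, ℂ)) p.1 * (𝓕 g : 𝓢(V, ℂ)) p.2 * K p)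
      (volume.prod volume) := by
  have h1 : Integrable (fun p : V × V => C * ((‖p.1‖ ^ n * ‖(𝓕 f : 𝓢(V, ℂ)) p.1‖) *
      (‖p.2‖ ^ n * ‖(𝓕 g : 𝓢(V, ℂ)) p.2‖))) (volume.prod volume) :=
    (((𝓕 f : 𝓢(V, ℂ)).integrable_pow_mul volume n).mul_prod
      ((𝓕 g : 𝓢(V, ℂ)).integrable_pow_mul volume n)).const_mul C
  refine h1.mono' ?_ (Eventually.of_forall fun p => ?_)
  · have := (𝓕 f : 𝓢(V, ℂ)).continuous
    have := (𝓕 g : 𝓢(V, ℂ)).continuous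
    exact Continuous.aestronglyMeasurable (by fun_prop)
  · rw [norm_mul, norm_mul]
    calc _ ≤ ‖(𝓕 f : 𝓢(V, ℂ)) p.1‖ * ‖(𝓕 g : 𝓢(V, ℂ)) p.2‖ *
          (C * (‖p.1‖ ^ n * ‖p.2‖ ^ n)) := by gcongr; exact hC p
      _ = _ := by ring

/-- Parseval's identity is applied twice: to f against g φ̄ψ, then, for each frequency of f, to g
against φ̄ψ times the corresponding character. -/
theorem ComplexCoordinates.integral_mul_mul_eq (f g : 𝓢(V, ℂ)) (φ ψ : physicalSpace ω ħ) :
    ⟪φ, toeplitz ω ħ (schwartzMul f g) ψ⟫_ℂ =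
      ∫ p : V × V, (𝓕 f : 𝓢(V, ℂ)) p.1 * (𝓕 g : 𝓢(V, ℂ)) p.2 *
        c.matrixElement φ ψ (frequency ω p.2 + frequency ω p.1) ∂(volume.prod volume) := by
  have hi := integrable_star_mul_coe φ ψ
  have hint := integrable_fourier_mul_fourier f g (C := ‖φ‖ * ‖ψ‖)
    (K := fun p => c.matrixElement φ ψ (frequency ω p.2 + frequency ω p.1))
    ((c.continuous_matrixElement φ ψ).comp (by fun_prop)) 0
    (fun p => by simpa using c.norm_matrixElement_le φ ψ _)
  rw [integral_prod _ hint, inner_toeplitz]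
  have h1 : Integrable (fun x => g x * (star ((φ : Lp ℂ 2 (symplecticVolume ω)) x) *
      (ψ : Lp ℂ 2 (symplecticVolume ω)) x)) (symplecticVolume ω) := by
    exact hi.bdd_mul g.continuous.aestronglyMeasurable
      (Eventually.of_forall g.toBoundedContinuousFunction.norm_coe_le_norm)
  have h2 := c.integral_mul_eq (symplecticVolume ω) f h1
  simp only [schwartzMul_apply, mul_assoc] at h2 ⊢
  rw [h2]
  refine integral_congr_ae (Eventually.of_forall fun ξ => ?_)
  simp only
  rw [integral_const_mul]
  congr 1
  have h3 := c.integral_mul_eq (symplecticVolume ω) g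
    (h := fun x => (star ((φ : Lp ℂ 2 (symplecticVolume ω)) x) *
      (ψ : Lp ℂ 2 (symplecticVolume ω)) x) * c.character (frequency ω ξ) x)
    (hi.mul_bdd (c := 1) (c.memLp_character _).1
      (Eventually.of_forall fun x => (c.norm_character _ x).le))
  simp only [mul_assoc] at h3
  rw [h3]
  refine integral_congr_ae (Eventually.of_forall fun η => ?_)
  simp only [ComplexCoordinates.matrixElement, c.character_add]
  congr 1
  refine integral_congr_ae (Eventually.of_forall fun x => ?_)
  simp only
  ring

end Schwartz

/-! ### Asymptotic expansion of products of Toeplitz operators -/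

section Remainder

open scoped FourierTransform

theorem inner_smul_sum_apply {H : Type*} [NormedAddCommGroup H] [InnerProductSpace ℂ H]
    {ι : Type*} (s : Finset ι) (a : ℂ) (S : ι → H →L[ℂ] H) (φ ψ : H) :
    ⟪φ, (a • ∑ i ∈ s, S i) ψ⟫_ℂ = a * ∑ i ∈ s, ⟪φ, S i ψ⟫_ℂ := by
  simp

theorem inner_smul_apply {H : Type*} [NormedAddCommGroup H] [InnerProductSpace ℂ H]
    (a : ℂ) (S : H →L[ℂ] H) (φ ψ : H) : ⟪φ, (a • S) ψ⟫_ℂ = a * ⟪φ, S ψ⟫_ℂ := by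
  simp

theorem norm_mul_le_one {H : Type*} [NormedAddCommGroup H] [InnerProductSpace ℂ H]
    {S T : H →L[ℂ] H} (hS : ‖S‖ ≤ 1) (hT : ‖T‖ ≤ 1) : ‖S * T‖ ≤ 1 :=
  (norm_mul_le S T).trans (mul_le_one₀ hS (norm_nonneg T) hT)

variable {V : Type*} [NormedAddCommGroup V] [InnerProductSpace ℝ V] [FiniteDimensional ℝ V]
variable [MeasurableSpace V] [BorelSpace V]
variable {ω : SymplecticForm V} {ħ : ℝ} {N : ℕ} (c : ComplexCoordinates ω N)

theorem ComplexCoordinates.continuous_matrixElement_add (φ ψ : physicalSpace ω ħ) :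
    Continuous fun p : V × V =>
      c.matrixElement φ ψ (frequency ω p.2 + frequency ω p.1) :=
  (c.continuous_matrixElement φ ψ).comp (by fun_prop)

theorem ComplexCoordinates.continuous_herm_frequency :
    Continuous fun p : V × V => c.herm (frequency ω p.2) (frequency ω p.1) :=
  c.continuous_herm (by fun_prop) (by fun_prop)

/-- In Fourier space the j-th coefficient is multiplication by h^j/j!, the j-th term of the
exponential series of the Weyl cocycle. -/
theorem ComplexCoordinates.inner_toeplitz_starCoeff (j : ℕ) (f g b : 𝓢(V, ℂ))
    (hb : ⇑b = c.starCoeff j f g) (φ ψ : physicalSpace ω ħ) :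
    ⟪φ, toeplitz ω ħ b ψ⟫_ℂ =
      ∫ p : V × V, (𝓕 f : 𝓢(V, ℂ)) p.1 * (𝓕 g : 𝓢(V, ℂ)) p.2 *
        (c.herm (frequency ω p.2) (frequency ω p.1) ^ j / (j.factorial : ℂ) *
        c.matrixElement φ ψ (frequency ω p.2 + frequency ω p.1)) ∂(volume.prod volume) := by
  have h1 : b = c.schwartzStar j f g := DFunLike.coe_injective (by rw [hb, c.coe_schwartzStar])
  rw [h1, ComplexCoordinates.schwartzStar, map_smul, map_sum, inner_smul_sum_apply]
  simp only [c.integral_mul_mul_eq]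
  rw [← integral_finsetSum]
  · rw [← integral_const_mul]
    refine integral_congr_ae (Eventually.of_forall fun p => ?_)
    simp only [c.fourier_foldr_schwartzDz, c.fourier_foldr_schwartzDzbar]
    have h2 := c.sum_prod_ofFn j (frequency ω p.1) (frequency ω p.2)
    have h3 : ((-1 : ℂ) ^ j) * (-1) ^ j = 1 := by rw [← mul_pow]; simp
    calc _ = ((-1) ^ j / (j.factorial : ℂ)) *
          ((∑ i : Fin j → Fin N, ((List.ofFn i).map fun k => star (c.z (frequency ω p.1) k)).prod *
            ((List.ofFn i).map fun k => -c.z (frequency ω p.2) k).prod) *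
            ((𝓕 f : 𝓢(V, ℂ)) p.1 * (𝓕 g : 𝓢(V, ℂ)) p.2 *
              c.matrixElement φ ψ (frequency ω p.2 + frequency ω p.1))) := by
          rw [Finset.sum_mul]
          congr 1
          exact Finset.sum_congr rfl fun i _ => by ring
      _ = _ := by
          rw [h2]
          linear_combination (c.herm (frequency ω p.2) (frequency ω p.1) ^ j / (j.factorial : ℂ) *
            ((𝓕 f : 𝓢(V, ℂ)) p.1 * (𝓕 g : 𝓢(V, ℂ)) p.2 *
              c.matrixElement φ ψ (frequency ω p.2 + frequency ω p.1))) * h3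
  · intro i _
    exact integrable_fourier_mul_fourier _ _ (C := ‖φ‖ * ‖ψ‖) (c.continuous_matrixElement_add φ ψ) 0
      (fun p => by simpa using c.norm_matrixElement_le φ ψ _)

theorem ComplexCoordinates.exp_mul_matrixElement (hħ : 0 < ħ) (u v : V) (φ ψ : physicalSpace ω ħ) :
    Complex.exp (ħ * c.herm v u) * c.matrixElement φ ψ (v + u) =
      ⟪φ, (c.weyl ħ u * c.weyl ħ v) ψ⟫_ℂ := by
  rw [c.weyl_mul_weyl hħ, ← c.inner_weyl_eq]
  exact (inner_smul_apply _ _ _ _).symm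

/-- The growth of the exponential is compensated by the decay of the matrix element, as together
they form a matrix element of a product of two contractions. No separate bound on Re h is needed. -/
theorem ComplexCoordinates.norm_exp_mul_matrixElement_le (hħ : 0 < ħ) (u v : V)
    (φ ψ : physicalSpace ω ħ) :
    ‖Complex.exp (ħ * c.herm v u) * c.matrixElement φ ψ (v + u)‖ ≤ ‖φ‖ * ‖ψ‖ := by
  rw [c.exp_mul_matrixElement hħ]
  refine norm_inner_le_of_norm_le_one ?_ φ ψ
  exact norm_mul_le_one (c.norm_weyl_le u) (c.norm_weyl_le v)

/-- The first factor is expanded in Weyl operators, which are moved onto φ by adjunction; then the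
second factor is expanded between the vectors so obtained, and the cocycle recombines the two Weyl
operators. -/
theorem ComplexCoordinates.inner_toeplitz_mul (hħ : 0 < ħ) (f g : 𝓢(V, ℂ))
    (φ ψ : physicalSpace ω ħ) :
    ⟪φ, (toeplitz ω ħ f * toeplitz ω ħ g) ψ⟫_ℂ =
      ∫ p : V × V, (𝓕 f : 𝓢(V, ℂ)) p.1 * (𝓕 g : 𝓢(V, ℂ)) p.2 *
        (Complex.exp (ħ * c.herm (frequency ω p.2) (frequency ω p.1)) *
        c.matrixElement φ ψ (frequency ω p.2 + frequency ω p.1)) ∂(volume.prod volume) := by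
  rw [integral_prod]
  · rw [mul_apply_eq_comp, c.inner_toeplitz_fourier]
    refine integral_congr_ae (Eventually.of_forall fun ξ => ?_)
    simp only [mul_assoc]
    rw [integral_const_mul]
    congr 1
    rw [← c.inner_weyl_eq]
    have h1 := c.adjoint_weyl (ħ := ħ) (-frequency ω ξ)
    rw [neg_neg] at h1
    rw [h1, ContinuousLinearMap.adjoint_inner_right, c.inner_toeplitz_fourier]
    refine integral_congr_ae (Eventually.of_forall fun η => ?_)
    simp only
    rw [c.exp_mul_matrixElement hħ, ← c.inner_weyl_eq, mul_apply_eq_comp, h1,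
      ContinuousLinearMap.adjoint_inner_right]
  · refine integrable_fourier_mul_fourier f g (C := ‖φ‖ * ‖ψ‖) ?_ 0
      (fun p => by simpa using c.norm_exp_mul_matrixElement_le hħ _ _ φ ψ)
    exact (Complex.continuous_exp.comp (continuous_const.mul c.continuous_herm_frequency)).mul
      (c.continuous_matrixElement_add φ ψ)

/-- The Fourier moments of a Schwartz function. -/
def fourierMoment (n : ℕ) (f : 𝓢(V, ℂ)) : ℝ := ∫ ξ, ‖ξ‖ ^ n * ‖(𝓕 f : 𝓢(V, ℂ)) ξ‖

theorem fourierMoment_nonneg (n : ℕ) (f : 𝓢(V, ℂ)) : 0 ≤ fourierMoment n f :=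
  integral_nonneg fun ξ => by positivity

/-- A bound on the form `h(E ξ, E η)` that enters the asymptotic expansion. -/
theorem ComplexCoordinates.exists_norm_herm_frequency_le :
    ∃ M : ℝ, 0 < M ∧ ∀ ξ η : V, ‖c.herm (frequency ω η) (frequency ω ξ)‖ ≤ M * (‖ξ‖ * ‖η‖) := by
  obtain ⟨M, hM0, hM⟩ := c.exists_norm_herm_le
  refine ⟨M * (‖frequency ω‖ * ‖frequency ω‖) + 1, by positivity, fun ξ η => ?_⟩
  refine (hM _ _).trans ?_
  have h1 := (frequency ω).le_opNorm ξ
  have h2 := (frequency ω).le_opNorm η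
  calc M * (‖frequency ω η‖ * ‖frequency ω ξ‖)
      ≤ M * ((‖frequency ω‖ * ‖η‖) * (‖frequency ω‖ * ‖ξ‖)) := by gcongr
    _ ≤ _ := by
      have : 0 ≤ ‖ξ‖ * ‖η‖ := by positivity
      linarith

/-- The remainder of the asymptotic expansion of the product of Toeplitz operators. -/
theorem ComplexCoordinates.norm_toeplitz_mul_sub_le (hħ : 0 < ħ) {M : ℝ} (hM : 0 ≤ M)
    (h : ∀ ξ η : V, ‖c.herm (frequency ω η) (frequency ω ξ)‖ ≤ M * (‖ξ‖ * ‖η‖))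
    (n : ℕ) (f g : 𝓢(V, ℂ)) (b : ℕ → 𝓢(V, ℂ)) (hb : ∀ j, ⇑(b j) = c.starCoeff j f g) :
    ‖toeplitz ω ħ f * toeplitz ω ħ g -
        ∑ j ∈ Finset.range n, (ħ : ℂ) ^ j • toeplitz ω ħ (b j)‖ ≤
      (ħ * M) ^ n / n.factorial * (fourierMoment n f * fourierMoment n g) := by
  have hm := mul_nonneg (fourierMoment_nonneg n f) (fourierMoment_nonneg n g)
  refine norm_le_of_norm_inner_le (by positivity) fun φ ψ => ?_
  have hint : ∀ j, Integrable (fun p : V × V => (𝓕 f : 𝓢(V, ℂ)) p.1 * (𝓕 g : 𝓢(V, ℂ)) p.2 *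
        (c.herm (frequency ω p.2) (frequency ω p.1) ^ j / (j.factorial : ℂ) *
        c.matrixElement φ ψ (frequency ω p.2 + frequency ω p.1))) (volume.prod volume) := by
    intro j
    refine integrable_fourier_mul_fourier f g (C := M ^ j / j.factorial * (‖φ‖ * ‖ψ‖))
      (((c.continuous_herm_frequency.pow j).div_const _).mul (c.continuous_matrixElement_add φ ψ)) j
      (fun p => ?_)
    rw [norm_mul, norm_div, norm_pow, Complex.norm_natCast]
    have h1 := h p.1 p.2
    have h2 := c.norm_matrixElement_le φ ψ (frequency ω p.2 + frequency ω p.1)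
    calc _ ≤ (M * (‖p.1‖ * ‖p.2‖)) ^ j / j.factorial * (‖φ‖ * ‖ψ‖) := by gcongr
      _ = _ := by rw [mul_pow, mul_pow]; ring
  have hint2 : Integrable (fun p : V × V => (𝓕 f : 𝓢(V, ℂ)) p.1 * (𝓕 g : 𝓢(V, ℂ)) p.2 *
        (Complex.exp (ħ * c.herm (frequency ω p.2) (frequency ω p.1)) *
        c.matrixElement φ ψ (frequency ω p.2 + frequency ω p.1))) (volume.prod volume) := by
    refine integrable_fourier_mul_fourier f g (C := ‖φ‖ * ‖ψ‖) ?_ 0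
      (fun p => by simpa using c.norm_exp_mul_matrixElement_le hħ _ _ φ ψ)
    exact (Complex.continuous_exp.comp (continuous_const.mul c.continuous_herm_frequency)).mul
      (c.continuous_matrixElement_add φ ψ)
  rw [inner_sub_sum_apply, c.inner_toeplitz_mul hħ]
  simp only [fun j => c.inner_toeplitz_starCoeff j f g (b j) (hb j) φ ψ, ← integral_const_mul]
  rw [← integral_finsetSum _ fun j _ => (hint j).const_mul _,
    ← integral_sub hint2 (integrable_finsetSum _ fun j _ => (hint j).const_mul _)]
  have h1 : Integrable (fun p : V × V => (ħ * M) ^ n / n.factorial * (‖φ‖ * ‖ψ‖) *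
      ((‖p.1‖ ^ n * ‖(𝓕 f : 𝓢(V, ℂ)) p.1‖) * (‖p.2‖ ^ n * ‖(𝓕 g : 𝓢(V, ℂ)) p.2‖)))
      (volume.prod volume) :=
    (((𝓕 f : 𝓢(V, ℂ)).integrable_pow_mul volume n).mul_prod
      ((𝓕 g : 𝓢(V, ℂ)).integrable_pow_mul volume n)).const_mul _
  have h2 : ∫ p : V × V, (ħ * M) ^ n / n.factorial * (‖φ‖ * ‖ψ‖) *
      ((‖p.1‖ ^ n * ‖(𝓕 f : 𝓢(V, ℂ)) p.1‖) * (‖p.2‖ ^ n * ‖(𝓕 g : 𝓢(V, ℂ)) p.2‖))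
      ∂(volume.prod volume) = (ħ * M) ^ n / n.factorial * (fourierMoment n f * fourierMoment n g) *
        (‖φ‖ * ‖ψ‖) := by
    rw [integral_const_mul, integral_prod_mul (fun ξ : V => ‖ξ‖ ^ n * ‖(𝓕 f : 𝓢(V, ℂ)) ξ‖)
      (fun ξ : V => ‖ξ‖ ^ n * ‖(𝓕 g : 𝓢(V, ℂ)) ξ‖), fourierMoment, fourierMoment]
    ring
  rw [← h2]
  refine norm_integral_le_of_norm_le h1 (Eventually.of_forall fun p => ?_)
  set w : ℂ := ħ * c.herm (frequency ω p.2) (frequency ω p.1) with hw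
  set m := c.matrixElement φ ψ (frequency ω p.2 + frequency ω p.1) with hm
  have h3 : (𝓕 f : 𝓢(V, ℂ)) p.1 * (𝓕 g : 𝓢(V, ℂ)) p.2 * (Complex.exp w * m) -
      ∑ j ∈ Finset.range n, (ħ : ℂ) ^ j * ((𝓕 f : 𝓢(V, ℂ)) p.1 * (𝓕 g : 𝓢(V, ℂ)) p.2 *
        (c.herm (frequency ω p.2) (frequency ω p.1) ^ j / (j.factorial : ℂ) * m)) =
      (𝓕 f : 𝓢(V, ℂ)) p.1 * (𝓕 g : 𝓢(V, ℂ)) p.2 *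
        ((Complex.exp w - ∑ j ∈ Finset.range n, w ^ j / (j.factorial : ℂ)) * m) := by
    rw [sub_mul, mul_sub, Finset.sum_mul, Finset.mul_sum]
    congr 1
    refine Finset.sum_congr rfl fun j _ => ?_
    rw [hw, mul_pow]
    ring
  rw [h3, norm_mul, norm_mul, norm_mul]
  -- Both alternatives of the maximum, multiplied by the matrix element, are bounded by ‖φ‖‖ψ‖: one
  -- is the bound on a single Weyl operator, the other that on a product of two.
  have h4 : max 1 (Real.exp w.re) * ‖m‖ ≤ ‖φ‖ * ‖ψ‖ := by
    rw [max_mul_of_nonneg _ _ (norm_nonneg _), one_mul, ← Complex.norm_exp, ← norm_mul]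
    exact max_le (c.norm_matrixElement_le φ ψ _) (c.norm_exp_mul_matrixElement_le hħ _ _ φ ψ)
  have h5 : ‖w‖ ≤ ħ * M * (‖p.1‖ * ‖p.2‖) := by
    rw [hw, norm_mul, Complex.norm_real, Real.norm_of_nonneg hħ.le, mul_assoc]
    exact mul_le_mul_of_nonneg_left (h _ _) hħ.le
  calc _ ≤ ‖(𝓕 f : 𝓢(V, ℂ)) p.1‖ * ‖(𝓕 g : 𝓢(V, ℂ)) p.2‖ *
        (‖w‖ ^ n / n.factorial * max 1 (Real.exp w.re) * ‖m‖) := by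
        gcongr
        exact norm_exp_sub_sum_le n w
    _ = ‖(𝓕 f : 𝓢(V, ℂ)) p.1‖ * ‖(𝓕 g : 𝓢(V, ℂ)) p.2‖ *
        (‖w‖ ^ n / n.factorial * (max 1 (Real.exp w.re) * ‖m‖)) := by ring
    _ ≤ ‖(𝓕 f : 𝓢(V, ℂ)) p.1‖ * ‖(𝓕 g : 𝓢(V, ℂ)) p.2‖ *
        ((ħ * M * (‖p.1‖ * ‖p.2‖)) ^ n / n.factorial * (‖φ‖ * ‖ψ‖)) := by gcongr
    _ = _ := by
        rw [mul_pow, mul_pow ‖p.1‖]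
        ring

end Remainder

/-! ### Continuous fields generated by local uniform approximation -/

section Field

variable {I : Type*} [TopologicalSpace I] {𝔄 : I → Type*} [∀ i, NonUnitalCStarAlgebra (𝔄 i)]
variable {F : Type*} [AddCommGroup F] [Module ℂ F]

/-- `A` is locally uniformly approximated by the generators `q f`. -/
def LocallyApprox (q : F → ∀ i, 𝔄 i) (A : ∀ i, 𝔄 i) : Prop :=
  ∀ i, ∀ δ > (0 : ℝ), ∃ f, ∀ᶠ j in 𝓝 i, ‖A j - q f j‖ ≤ δ

variable {q : F →ₗ[ℂ] ∀ i, 𝔄 i}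

theorem LocallyApprox.add {A B : ∀ i, 𝔄 i} (hA : LocallyApprox q A) (hB : LocallyApprox q B) :
    LocallyApprox q (A + B) := by
  intro i δ hδ
  obtain ⟨f, hf⟩ := hA i (δ / 2) (half_pos hδ)
  obtain ⟨g, hg⟩ := hB i (δ / 2) (half_pos hδ)
  refine ⟨f + g, ?_⟩
  filter_upwards [hf, hg] with j h1 h2
  rw [map_add, Pi.add_apply, Pi.add_apply, add_sub_add_comm]
  linarith [norm_add_le (A j - q f j) (B j - q g j)]

theorem LocallyApprox.smul (a : ℂ) {A : ∀ i, 𝔄 i} (hA : LocallyApprox q A) :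
    LocallyApprox q (a • A) := by
  intro i δ hδ
  obtain ⟨f, hf⟩ := hA i (δ / (‖a‖ + 1)) (by positivity)
  refine ⟨a • f, ?_⟩
  filter_upwards [hf] with j h1
  rw [map_smul, Pi.smul_apply, Pi.smul_apply, ← smul_sub, norm_smul]
  calc ‖a‖ * ‖A j - q f j‖ ≤ (‖a‖ + 1) * (δ / (‖a‖ + 1)) := by gcongr; linarith
    _ = δ := by field_simp

theorem LocallyApprox.star (hstar : ∀ f, ∃ g, q g = star (q f)) {A : ∀ i, 𝔄 i}
    (hA : LocallyApprox q A) : LocallyApprox q (star A) := by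
  intro i δ hδ
  obtain ⟨f, hf⟩ := hA i δ hδ
  obtain ⟨g, hg⟩ := hstar f
  refine ⟨g, ?_⟩
  filter_upwards [hf] with j h1
  rw [hg, Pi.star_apply, Pi.star_apply, ← star_sub, norm_star]
  exact h1

theorem LocallyApprox.eventually_norm_le (hcont : ∀ f, Continuous fun i => ‖q f i‖) {A : ∀ i, 𝔄 i}
    (hA : LocallyApprox q A) (i : I) : ∃ K : ℝ, 0 < K ∧ ∀ᶠ j in 𝓝 i, ‖A j‖ ≤ K := by
  obtain ⟨f, hf⟩ := hA i 1 one_pos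
  refine ⟨‖q f i‖ + 2, by positivity, ?_⟩
  filter_upwards [hf, ((hcont f).tendsto i).eventually_lt_const (lt_add_one ‖q f i‖)] with j h1 h2
  have h3 := norm_add_le (A j - q f j) (q f j)
  rw [sub_add_cancel] at h3
  linarith

theorem LocallyApprox.mul (hcont : ∀ f, Continuous fun i => ‖q f i‖)
    (hmul : ∀ f g, LocallyApprox q (q f * q g)) {A B : ∀ i, 𝔄 i} (hA : LocallyApprox q A)
    (hB : LocallyApprox q B) : LocallyApprox q (A * B) := by
  intro i δ hδ
  obtain ⟨K, hK0, hK⟩ := hA.eventually_norm_le hcont i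
  obtain ⟨L, hL0, hL⟩ := hB.eventually_norm_le hcont i
  -- The two factor errors add up to η L + (K + 1) η, where K + 1 bounds q f because η ≤ 1; the
  -- choice makes this at most δ/3.
  have hη : 0 < min 1 (δ / (3 * (K + L + 1))) := by positivity
  set η := min 1 (δ / (3 * (K + L + 1))) with hηdef
  obtain ⟨f, hf⟩ := hA i η hη
  obtain ⟨g, hg⟩ := hB i η hη
  obtain ⟨h, hh⟩ := hmul f g i (δ / 3) (by positivity)
  refine ⟨h, ?_⟩
  filter_upwards [hK, hL, hf, hg, hh] with j h1 h2 h3 h4 h5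
  have hη1 : η ≤ 1 := min_le_left _ _
  have hη2 : η * (K + L + 1) ≤ δ / 3 := by
    have : η ≤ δ / (3 * (K + L + 1)) := min_le_right _ _
    calc η * (K + L + 1) ≤ δ / (3 * (K + L + 1)) * (K + L + 1) := by gcongr
      _ = δ / 3 := by field_simp
  have h6 : ‖q f j‖ ≤ K + 1 := by
    have := norm_sub_le (A j) (A j - q f j)
    rw [sub_sub_cancel] at this
    linarith
  have h7 : (A * B) j - q h j = (A j - q f j) * B j + q f j * (B j - q g j) +
      ((q f * q g) j - q h j) := by
    simp only [Pi.mul_apply, sub_mul, mul_sub]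
    abel
  rw [h7]
  have h8 : ‖(A j - q f j) * B j‖ ≤ η * L :=
    (norm_mul_le _ _).trans (mul_le_mul h3 h2 (norm_nonneg _) hη.le)
  have h9 : ‖q f j * (B j - q g j)‖ ≤ (K + 1) * η :=
    (norm_mul_le _ _).trans (mul_le_mul h6 h4 (norm_nonneg _) (by positivity))
  have h10 := norm_add₃_le (a := (A j - q f j) * B j) (b := q f j * (B j - q g j))
    (c := (q f * q g) j - q h j)
  nlinarith

theorem LocallyApprox.continuous_norm (hcont : ∀ f, Continuous fun i => ‖q f i‖) {A : ∀ i, 𝔄 i}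
    (hA : LocallyApprox q A) : Continuous fun i => ‖A i‖ := by
  rw [continuous_iff_continuousAt]
  intro i
  rw [ContinuousAt, Metric.tendsto_nhds]
  intro ε hε
  obtain ⟨f, hf⟩ := hA i (ε / 4) (by positivity)
  filter_upwards [hf, Metric.tendsto_nhds.1 ((hcont f).tendsto i) (ε / 4) (by positivity)]
    with j h1 h2
  have h3 := hf.self_of_nhds
  have h4 := (abs_norm_sub_norm_le (A j) (q f j)).trans h1
  have h5 := (abs_norm_sub_norm_le (A i) (q f i)).trans h3
  rw [Real.dist_eq] at h2 ⊢
  rw [abs_le] at h4 h5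
  rw [abs_lt] at h2 ⊢
  constructor <;> linarith [h2.1, h2.2, h4.1, h4.2, h5.1, h5.2]

/-- A family of sections that is, up to local approximation, closed under the algebraic operations
generates a continuous field of C*-algebras. -/
theorem exists_continuousField (hstar : ∀ f, ∃ g, q g = star (q f))
    (hmul : ∀ f g, LocallyApprox q (q f * q g)) (hcont : ∀ f, Continuous fun i => ‖q f i‖)
    (hdense : ∀ i, Dense (Set.range fun f => q f i)) :
    ∃ Γ : ContinuousField I 𝔄, ∀ f, q f ∈ Γ.sections := by
  have hq : ∀ f, LocallyApprox q (q f) := fun f i δ hδ =>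
    ⟨f, Eventually.of_forall fun j => by simpa using hδ.le⟩
  let S : NonUnitalStarSubalgebra ℂ (∀ i, 𝔄 i) :=
    { carrier := {A | LocallyApprox q A}
      add_mem' := fun hA hB => hA.add hB
      zero_mem' := by simpa using hq 0
      mul_mem' := fun hA hB => hA.mul hcont hmul hB
      smul_mem' := fun a _ hA => hA.smul a
      star_mem' := fun hA => hA.star hstar }
  refine ⟨⟨S, fun i => (hdense i).mono ?_, fun A hA => LocallyApprox.continuous_norm hcont hA, ?_⟩,
    hq⟩
  · rintro _ ⟨f, rfl⟩
    exact ⟨q f, hq f, rfl⟩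
  · intro A' h i δ hδ
    obtain ⟨U, hU, A, hA, hAU⟩ := h i (δ / 2) (half_pos hδ)
    obtain ⟨f, hf⟩ := hA i (δ / 2) (half_pos hδ)
    refine ⟨f, ?_⟩
    filter_upwards [hU, hf] with j h1 h2
    have h3 := norm_add_le (A' j - A j) (A j - q f j)
    rw [sub_add_sub_cancel] at h3
    linarith [hAU j h1]

end Field

/-! ### Density, band limiting and dilation of Schwartz functions -/

section Approximation

open scoped FourierTransform

variable {V : Type*} [NormedAddCommGroup V] [InnerProductSpace ℝ V] [FiniteDimensional ℝ V]

/-- The supremum norm of a Schwartz function. -/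
def supNorm (f : 𝓢(V, ℂ)) : ℝ := ‖f.toBoundedContinuousFunction‖

theorem supNorm_nonneg (f : 𝓢(V, ℂ)) : 0 ≤ supNorm f := norm_nonneg _

theorem norm_le_supNorm (f : 𝓢(V, ℂ)) (x : V) : ‖f x‖ ≤ supNorm f :=
  f.toBoundedContinuousFunction.norm_coe_le_norm x

theorem supNorm_le {f : 𝓢(V, ℂ)} {C : ℝ} (hC : 0 ≤ C) (h : ∀ x, ‖f x‖ ≤ C) : supNorm f ≤ C :=
  (BoundedContinuousFunction.norm_le hC).2 h

/-- Schwartz functions are dense in the continuous functions vanishing at infinity. -/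
theorem dense_schwartz : Dense (Set.range (SchwartzMap.toZeroAtInftyCLM ℂ V ℂ)) := by
  rw [Metric.dense_iff]
  intro g r hr
  have h1 : ∀ᶠ x in cocompact V, ‖g x‖ < r / 4 := by
    have := g.zero_at_infty'.norm
    simp only [norm_zero] at this
    exact this.eventually_lt_const (by positivity)
  obtain ⟨R, hR0, hR⟩ : ∃ R : ℝ, 0 < R ∧ ∀ x, R < ‖x‖ → ‖g x‖ < r / 4 := by
    rw [← Metric.cobounded_eq_cocompact, Filter.HasBasis.eventually_iff
      (Filter.hasBasis_cobounded_norm)] at h1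
    obtain ⟨R, -, hR⟩ := h1
    exact ⟨max R 1, by positivity, fun x hx => hR ((le_max_left _ _).trans hx.le)⟩
  obtain ⟨h, hh, happ, -⟩ := (g.continuous).exists_contDiff_approx ⊤ (ε := fun _ => r / 4)
    continuous_const (fun _ => by positivity)
  let χ : ContDiffBump (0 : V) := ⟨R, R + 1, hR0, by linarith⟩
  have hsm : ContDiff ℝ ((⊤ : ℕ∞) : WithTop ℕ∞) fun x => (χ x : ℂ) * h x :=
    (Complex.ofRealCLM.contDiff.comp χ.contDiff).mul hh
  have hcs : HasCompactSupport fun x => (χ x : ℂ) * h x :=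
    (χ.hasCompactSupport.comp_left (g := fun t : ℝ => (t : ℂ)) Complex.ofReal_zero).mul_right
  refine ⟨SchwartzMap.toZeroAtInftyCLM ℂ V ℂ (hcs.toSchwartzMap hsm), ?_, ⟨_, rfl⟩⟩
  rw [Metric.mem_ball]
  refine lt_of_le_of_lt ((ZeroAtInftyContinuousMap.dist_toBCF_eq_dist
    (f := SchwartzMap.toZeroAtInftyCLM ℂ V ℂ (hcs.toSchwartzMap hsm)) (g := g)).symm.trans_le
    ((BoundedContinuousFunction.dist_le (by positivity : 0 ≤ r / 2)).2 fun x => ?_)) (half_lt_self hr)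
  have h2 : (SchwartzMap.toZeroAtInftyCLM ℂ V ℂ (hcs.toSchwartzMap hsm)).toBCF x =
    (χ x : ℂ) * h x := rfl
  have h3 : g.toBCF x = g x := rfl
  rw [h2, h3, dist_eq_norm]
  -- The first term is small everywhere because h approximates g uniformly, the second because g is
  -- small wherever the cutoff χ differs from 1.
  have h4 : (χ x : ℂ) * h x - g x = (χ x : ℂ) * (h x - g x) - ((1 - χ x : ℝ) : ℂ) * g x := by
    push_cast
    ring
  rw [h4]
  refine (norm_sub_le _ _).trans ?_
  rw [norm_mul, norm_mul, Complex.norm_real, Complex.norm_real, Real.norm_of_nonneg χ.nonneg,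
    Real.norm_of_nonneg (sub_nonneg.2 χ.le_one)]
  have h5 : ‖h x - g x‖ ≤ r / 4 := by
    rw [← dist_eq_norm]
    exact (happ x).le
  have h6 : (1 - χ x) * ‖g x‖ ≤ r / 4 := by
    rcases le_or_gt ‖x‖ R with hx | hx
    · rw [χ.one_of_mem_closedBall (by simpa using hx)]
      simp
      positivity
    · exact (mul_le_of_le_one_left (norm_nonneg _) (by linarith [χ.nonneg (x := x)])).trans
        (hR x hx).le
  have h7 : χ x * ‖h x - g x‖ ≤ r / 4 :=
    (mul_le_of_le_one_left (norm_nonneg _) χ.le_one).trans h5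
  linarith

variable [MeasurableSpace V] [BorelSpace V]

/-- Approximation by band limited Schwartz functions. -/
theorem exists_bandLimited (f : 𝓢(V, ℂ)) {ε : ℝ} (hε : 0 < ε) : ∃ g : 𝓢(V, ℂ),
    supNorm (f - g) ≤ ε ∧ ∃ R K : ℝ, 0 ≤ R ∧ 0 ≤ K ∧ ∀ n, fourierMoment n g ≤ R ^ n * K := by
  have hm := fourierMoment_nonneg 1 f
  -- Cutting off frequencies above R costs at most (first Fourier moment)/R in supremum norm, which
  -- this R makes at most ε. In exchange the n-th moments grow only geometrically, which n! will
  -- beat.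
  set R := fourierMoment 1 f / ε + 1 with hR
  have hR0 : 0 < R := by positivity
  let χ : ContDiffBump (0 : V) := ⟨R, R + 1, hR0, by linarith⟩
  have hsm : ContDiff ℝ ((⊤ : ℕ∞) : WithTop ℕ∞) fun x => (χ x : ℂ) * (𝓕 f : 𝓢(V, ℂ)) x :=
    (Complex.ofRealCLM.contDiff.comp χ.contDiff).mul ((𝓕 f : 𝓢(V, ℂ)).smooth _)
  have hcs : HasCompactSupport fun x => (χ x : ℂ) * (𝓕 f : 𝓢(V, ℂ)) x :=
    (χ.hasCompactSupport.comp_left (g := fun t : ℝ => (t : ℂ)) Complex.ofReal_zero).mul_right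
  set G : 𝓢(V, ℂ) := hcs.toSchwartzMap hsm with hG
  have hGa : ∀ ξ, G ξ = (χ ξ : ℂ) * (𝓕 f : 𝓢(V, ℂ)) ξ := fun ξ => rfl
  refine ⟨𝓕⁻ G, supNorm_le hε.le fun x => ?_, R + 1, fourierMoment 0 f, by positivity,
    fourierMoment_nonneg _ _, fun n => ?_⟩
  · have h1 : f - 𝓕⁻ G = 𝓕⁻ (𝓕 f - G) := by
      rw [sub_eq_add_neg, sub_eq_add_neg, FourierTransform.fourierInv_add,
        FourierTransform.fourierInv_fourier_eq]
      congr 1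
      rw [← neg_one_smul ℂ, ← neg_one_smul ℂ G, FourierTransform.fourierInv_smul]
    rw [h1, SchwartzMap.fourierInv_coe, Real.fourierInv_eq]
    have h2 : Integrable (fun ξ : V => R⁻¹ * (‖ξ‖ ^ 1 * ‖(𝓕 f : 𝓢(V, ℂ)) ξ‖)) :=
      ((𝓕 f : 𝓢(V, ℂ)).integrable_pow_mul volume 1).const_mul _
    refine (norm_integral_le_of_norm_le h2 (Eventually.of_forall fun ξ => ?_)).trans ?_
    · rw [Circle.norm_smul, sub_apply, hGa]
      have h3 : (𝓕 f : 𝓢(V, ℂ)) ξ - (χ ξ : ℂ) * (𝓕 f : 𝓢(V, ℂ)) ξ =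
          ((1 - χ ξ : ℝ) : ℂ) * (𝓕 f : 𝓢(V, ℂ)) ξ := by
        push_cast
        ring
      rw [h3, norm_mul, Complex.norm_real, Real.norm_of_nonneg (sub_nonneg.2 χ.le_one), ← mul_assoc,
        pow_one]
      refine mul_le_mul_of_nonneg_right ?_ (norm_nonneg _)
      rcases le_or_gt ‖ξ‖ R with hx | hx
      · rw [χ.one_of_mem_closedBall (by simpa using hx), sub_self]
        positivity
      · have : 1 ≤ R⁻¹ * ‖ξ‖ := by
          rw [← div_eq_inv_mul, one_le_div hR0]
          exact hx.le
        linarith [χ.nonneg (x := ξ)]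
    · rw [integral_const_mul, ← fourierMoment, ← div_eq_inv_mul, div_le_iff₀ hR0, hR, mul_add,
        mul_div_cancel₀ _ hε.ne']
      linarith
  · have h1 : (𝓕 (𝓕⁻ G) : 𝓢(V, ℂ)) = G := FourierTransform.fourier_fourierInv_eq _
    rw [fourierMoment, fourierMoment, h1, ← integral_const_mul]
    refine integral_mono (G.integrable_pow_mul volume n)
      (((𝓕 f : 𝓢(V, ℂ)).integrable_pow_mul volume 0).const_mul _) fun ξ => ?_
    simp only [hGa, norm_mul, Complex.norm_real, Real.norm_of_nonneg χ.nonneg, pow_zero, one_mul]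
    rw [← mul_assoc]
    refine mul_le_mul_of_nonneg_right ?_ (norm_nonneg _)
    rcases le_or_gt ‖ξ‖ (R + 1) with hx | hx
    · calc ‖ξ‖ ^ n * χ ξ ≤ (R + 1) ^ n * 1 := by
            have := χ.nonneg (x := ξ)
            have := χ.le_one (x := ξ)
            gcongr
        _ = _ := mul_one _
    · rw [χ.zero_of_le_dist (by simpa using hx.le), mul_zero]
      positivity

/-- The dilation `f(s ·)` of a Schwartz function. -/
def dilation (s : ℝˣ) (f : 𝓢(V, ℂ)) : 𝓢(V, ℂ) :=
  SchwartzMap.compCLMOfContinuousLinearEquiv ℂ (ContinuousLinearEquiv.smulLeft s) f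

theorem dilation_apply (s : ℝˣ) (f : 𝓢(V, ℂ)) (x : V) : dilation s f x = f ((s : ℝ) • x) := rfl

/-- Along the ray t ↦ f(tx) the derivative is df(tx)x, and Schwartz decay bounds ‖y‖‖df(y)‖ by a
constant C. For t ≥ 1/2 this gives 2C uniformly in x, and the mean value inequality applies. -/
theorem exists_supNorm_dilation_sub_le (f : 𝓢(V, ℂ)) : ∃ C : ℝ, ∀ s : ℝˣ, 1 / 2 ≤ (s : ℝ) →
    supNorm (dilation s f - f) ≤ C * |(s : ℝ) - 1| := by
  obtain ⟨C, hC0, hC⟩ := f.decay 1 1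
  refine ⟨2 * C, fun s hs => supNorm_le (by positivity) fun x => ?_⟩
  rw [sub_apply, dilation_apply]
  have h1 : ∀ t : ℝ, HasDerivAt (fun t : ℝ => f (t • x)) (fderiv ℝ f (t • x) x) t := by
    intro t
    have h2 : HasDerivAt (fun t : ℝ => t • x) x t := by
      simpa using (hasDerivAt_id t).smul_const x
    exact (f.differentiableAt.hasFDerivAt (x := t • x)).comp_hasDerivAt t h2
  have h2 : ∀ t ∈ Set.Ici (1 / 2 : ℝ), ‖fderiv ℝ f (t • x) x‖ ≤ 2 * C := by
    intro t ht
    have h3 := hC (t • x)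
    rw [norm_iteratedFDeriv_one, pow_one, norm_smul, Real.norm_eq_abs] at h3
    have h4 := (fderiv ℝ f (t • x)).le_opNorm x
    have h5 : (1 / 2 : ℝ) ≤ |t| := ht.trans (le_abs_self t)
    have h6 : 0 ≤ ‖x‖ * ‖fderiv ℝ f (t • x)‖ := by positivity
    nlinarith
  have h3 := (convex_Ici (1 / 2 : ℝ)).norm_image_sub_le_of_norm_hasDerivWithin_le
    (f := fun t : ℝ => f (t • x)) (fun t _ => (h1 t).hasDerivWithinAt) h2
    (x := 1) (y := (s : ℝ)) (by norm_num) hs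
  simpa using h3

end Approximation

/-! ### Density of Toeplitz operators in the compact operators -/

section Compact

open InnerProductSpace

variable {H : Type*} [NormedAddCommGroup H] [InnerProductSpace ℂ H]

/-- Extension by linearity and closure, one argument at a time; the second argument enters
antilinearly. -/
theorem rankOne_mem_of_total {X : Type*} {S : Submodule ℂ (H →L[ℂ] H)}
    (hS : IsClosed (S : Set (H →L[ℂ] H))) {e : X → H}
    (he : (Submodule.span ℂ (Set.range e)).topologicalClosure = ⊤)
    (h : ∀ x y, rankOne ℂ (e x) (e y) ∈ S) (a b : H) : rankOne ℂ a b ∈ S := by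
  have h1 : ∀ a y, rankOne ℂ a (e y) ∈ S := by
    intro a y
    let L : H →L[ℂ] H →L[ℂ] H := ContinuousLinearMap.smulRightL ℂ H H (innerSL ℂ (e y))
    have h2 : (Submodule.span ℂ (Set.range e)).topologicalClosure ≤ S.comap L.toLinearMap := by
      refine Submodule.topologicalClosure_minimal _ (Submodule.span_le.2 ?_)
        (hS.preimage L.continuous)
      rintro _ ⟨x, rfl⟩
      exact h x y
    rw [he] at h2
    exact h2 (Submodule.mem_top (x := a))
  have h2 : (Submodule.span ℂ (Set.range e)).topologicalClosure ≤
      S.comap (rankOne ℂ a : H →L⋆[ℂ] H →L[ℂ] H).toLinearMap := by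
    refine Submodule.topologicalClosure_minimal _ (Submodule.span_le.2 ?_)
      (hS.preimage (rankOne ℂ a : H →L⋆[ℂ] H →L[ℂ] H).continuous)
    rintro _ ⟨x, rfl⟩
    exact h1 a x
  rw [he] at h2
  exact h2 (Submodule.mem_top (x := b))

variable [CompleteSpace H]

/-- A closed subspace that contains the rank one operators contains the compact operators. -/
theorem mem_of_isCompactOperator {S : Submodule ℂ (H →L[ℂ] H)}
    (hS : IsClosed (S : Set (H →L[ℂ] H))) (h : ∀ a b, rankOne ℂ a b ∈ S) {T : H →L[ℂ] H}
    (hT : IsCompactOperator T) : T ∈ S := by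
  have h1 : TotallyBounded (T.toLinearMap '' Metric.closedBall 0 1) :=
    ((isCompactOperator_iff_isCompact_closure_image_closedBall T.toLinearMap one_pos).1
      hT).totallyBounded.subset subset_closure
  have h2 : T ∈ closure (S : Set (H →L[ℂ] H)) := by
    rw [Metric.mem_closure_iff]
    intro ε hε
    obtain ⟨t, htf, ht⟩ := Metric.totallyBounded_iff.1 h1 (ε / 2) (half_pos hε)
    let K := Submodule.span ℂ t
    haveI : FiniteDimensional ℂ K := FiniteDimensional.span_of_finite ℂ htf
    let b := stdOrthonormalBasis ℂ K
    -- T is compressed to the span of a finite ε/2-net of the image of the unit ball. The projection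
    -- minimises the distance to that span, so it is at least as close as the net.
    refine ⟨K.starProjection * T, ?_, ?_⟩
    · have h3 : K.starProjection * T =
          ∑ i, rankOne ℂ (b i : H) (ContinuousLinearMap.adjoint T (b i)) := by
        ext x
        rw [mul_apply_eq_comp, sum_apply]
        simp only [rankOne_apply, ContinuousLinearMap.adjoint_inner_left]
        have h4 := b.sum_repr (K.orthogonalProjectionOnto (T x))
        have h5 := congrArg (fun y : K => (y : H)) h4
        simp only [Submodule.coe_sum, Submodule.coe_smul, OrthonormalBasis.repr_apply_apply] at h5
        rw [Submodule.starProjection_apply, ← h5]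
        refine Finset.sum_congr rfl fun i _ => ?_
        rw [Submodule.inner_orthogonalProjectionOnto_eq_of_mem_left]
      rw [h3]
      exact S.sum_mem fun i _ => h _ _
    · rw [dist_eq_norm]
      refine (ContinuousLinearMap.opNorm_le_of_unit_norm (𝕜 := ℂ) (half_pos hε).le
        fun x hx => ?_).trans_lt (half_lt_self hε)
      obtain ⟨y, hy, hxy⟩ := Set.mem_iUnion₂.1
        (ht ⟨x, mem_closedBall_zero_iff.2 hx.le, rfl⟩)
      rw [Metric.mem_ball, dist_eq_norm] at hxy
      rw [sub_apply, mul_apply_eq_comp, K.starProjection_minimal]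
      exact (ciInf_le ⟨0, by rintro _ ⟨z, rfl⟩; exact norm_nonneg _⟩
        (⟨y, Submodule.subset_span hy⟩ : K)).trans hxy.le
  rwa [hS.closure_eq] at h2

theorem mul_mem_topologicalClosure {R : Submodule ℂ (H →L[ℂ] H)}
    (hR : ∀ A ∈ R, ∀ B ∈ R, A * B ∈ R.topologicalClosure) {A B : H →L[ℂ] H}
    (hA : A ∈ R.topologicalClosure) (hB : B ∈ R.topologicalClosure) :
    A * B ∈ R.topologicalClosure := by
  have h := map_mem_closure₂ (f := fun A B : H →L[ℂ] H => A * B)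
    (u := (R.topologicalClosure : Set (H →L[ℂ] H))) continuous_mul hA hB
    (fun A hA B hB => hR A hA B hB)
  rwa [R.isClosed_topologicalClosure.closure_eq] at h

variable {V : Type*} [NormedAddCommGroup V] [InnerProductSpace ℝ V] [FiniteDimensional ℝ V]
variable [MeasurableSpace V] [BorelSpace V]

/-- Normalised bump functions concentrating at x give integrals that converge in norm to the
operator at x, by norm continuity of y ↦ |e_y⟩⟨e_y|. -/
theorem rankOne_mem_of_integral_mem {S : Submodule ℂ (H →L[ℂ] H)}
    (hS : IsClosed (S : Set (H →L[ℂ] H))) (μ : Measure V) [μ.IsAddHaarMeasure] {e : V → H}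
    (he : Continuous e) {m : ℝ} (hm : ∀ x, ‖e x‖ ^ 2 = m)
    (h : ∀ f : 𝓢(V, ℂ), ∫ x, f x • rankOne ℂ (e x) (e x) ∂μ ∈ S) (x : V) :
    rankOne ℂ (e x) (e x) ∈ S := by
  have h2 : rankOne ℂ (e x) (e x) ∈ closure (S : Set (H →L[ℂ] H)) := by
    rw [Metric.mem_closure_iff]
    intro ε hε
    obtain ⟨δ, hδ, hδε⟩ := Metric.continuous_iff.1 (continuous_rankOne he) x (ε / 2) (half_pos hε)
    let χ : ContDiffBump x := ⟨δ / 4, δ / 2, by positivity, by linarith⟩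
    have hsm : ContDiff ℝ ((⊤ : ℕ∞) : WithTop ℕ∞) fun y => (χ.normed μ y : ℂ) :=
      Complex.ofRealCLM.contDiff.comp χ.contDiff_normed
    have hcs : HasCompactSupport fun y => (χ.normed μ y : ℂ) :=
      χ.hasCompactSupport_normed.comp_left (g := fun t : ℝ => (t : ℂ)) Complex.ofReal_zero
    set f := hcs.toSchwartzMap hsm with hf
    have hfa : ∀ y, f y = (χ.normed μ y : ℂ) := fun y => rfl
    refine ⟨_, h f, ?_⟩
    have h3 : ∫ y, f y ∂μ = 1 := by
      simp only [hfa]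
      rw [integral_complex_ofReal, χ.integral_normed, Complex.ofReal_one]
    have h4 : rankOne ℂ (e x) (e x) - ∫ y, f y • rankOne ℂ (e y) (e y) ∂μ =
        ∫ y, f y • (rankOne ℂ (e x) (e x) - rankOne ℂ (e y) (e y)) ∂μ := by
      simp only [smul_sub]
      rw [integral_sub (f.integrable.smul_const _) (integrable_smul_rankOne he hm f.integrable),
        integral_smul_const, h3, one_smul]
    rw [dist_eq_norm, h4]
    have h5 : ∀ y, ‖f y • (rankOne ℂ (e x) (e x) - rankOne ℂ (e y) (e y))‖ ≤
        χ.normed μ y * (ε / 2) := by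
      intro y
      rw [norm_smul, hfa, Complex.norm_real, Real.norm_of_nonneg (χ.nonneg_normed y)]
      rcases lt_or_ge (dist y x) δ with hy | hy
      · refine mul_le_mul_of_nonneg_left ?_ (χ.nonneg_normed y)
        have := (hδε y hy).le
        rwa [dist_comm, dist_eq_norm] at this
      · have h6 : χ.normed μ y = 0 := by
          rw [← Function.notMem_support, χ.support_normed_eq, Metric.mem_ball, not_lt]
          show δ / 2 ≤ _
          linarith
        rw [h6, zero_mul, zero_mul]
    refine (norm_integral_le_of_norm_le (χ.integrable_normed.mul_const _)
      (Eventually.of_forall h5)).trans_lt ?_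
    rw [integral_mul_const, χ.integral_normed, one_mul]
    exact half_lt_self hε
  rwa [hS.closure_eq] at h2

/-- If integrals of coherent state projections span, up to closure, an algebra, then they are dense
in the compact operators. -/
theorem mem_topologicalClosure_of_isCompactOperator {R : Submodule ℂ (H →L[ℂ] H)}
    (hR : ∀ A ∈ R, ∀ B ∈ R, A * B ∈ R.topologicalClosure) (μ : Measure V) [μ.IsAddHaarMeasure]
    {e : V → H} (he : Continuous e) {m : ℝ} (hm : ∀ x, ‖e x‖ ^ 2 = m)
    (htot : (Submodule.span ℂ (Set.range e)).topologicalClosure = ⊤)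
    (hne : ∀ x y, ⟪e x, e y⟫_ℂ ≠ 0)
    (h : ∀ f : 𝓢(V, ℂ), ∫ x, f x • rankOne ℂ (e x) (e x) ∂μ ∈ R) {T : H →L[ℂ] H}
    (hT : IsCompactOperator T) : T ∈ R.topologicalClosure := by
  have hS := R.isClosed_topologicalClosure
  have h1 := rankOne_mem_of_integral_mem hS μ he hm fun f => R.le_topologicalClosure (h f)
  refine mem_of_isCompactOperator hS (rankOne_mem_of_total hS htot fun x y => ?_) hT
  -- The product of the operators at x and y is ⟪e x, e y⟫ |e_x⟩⟨e_y|. Since coherent states are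
  -- never orthogonal, the scalar can be divided out, which yields the off-diagonal rank one
  -- operators.
  have h2 := mul_mem_topologicalClosure hR (h1 x) (h1 y)
  have h3 : rankOne ℂ (e x) (e x) * rankOne ℂ (e y) (e y) =
      ⟪e x, e y⟫_ℂ • rankOne ℂ (e x) (e y) := by
    ext z
    simp [smul_smul, mul_comm]
  rw [h3] at h2
  have h4 := R.topologicalClosure.smul_mem (⟪e x, e y⟫_ℂ)⁻¹ h2
  rwa [smul_smul, inv_mul_cancel₀ (hne x y), one_smul] at h4

end Compact

/-! ### Approximating products uniformly in ħ -/

section Product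

variable {V : Type*} [NormedAddCommGroup V] [InnerProductSpace ℝ V] [FiniteDimensional ℝ V]
variable [MeasurableSpace V] [BorelSpace V]
variable {ω : SymplecticForm V} {N : ℕ} (c : ComplexCoordinates ω N)

/-- A linear map from the Schwartz functions to a normed algebra which is bounded by the supremum
norm and whose products are given by the star product, with the standard remainder estimate. -/
structure ComplexCoordinates.HasStarBound (M ħ : ℝ) {𝔅 : Type*} [NonUnitalNormedRing 𝔅]
    [NormedSpace ℂ 𝔅] (Q : 𝓢(V, ℂ) →ₗ[ℂ] 𝔅) : Prop where
  norm_le : ∀ f, ‖Q f‖ ≤ supNorm f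
  norm_mul_sub_le : ∀ n, 0 < n → ∀ f g,
    ‖Q f * Q g - ∑ j ∈ Finset.range n, (ħ : ℂ) ^ j • Q (c.schwartzStar j f g)‖ ≤
      (ħ * M) ^ n / n.factorial * (fourierMoment n f * fourierMoment n g)

universe v

/-- Products of quantized functions are, locally uniformly in `ħ`, approximated by quantized
functions. -/
theorem ComplexCoordinates.exists_mul_approx {M : ℝ} (hM : 0 ≤ M) (f g : 𝓢(V, ℂ)) {ħ₀ δ : ℝ}
    (hħ₀ : 0 ≤ ħ₀) (hδ : 0 < δ) : ∃ h : 𝓢(V, ℂ), ∀ᶠ ħ : ℝ in 𝓝 ħ₀, 0 ≤ ħ →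
      ∀ (𝔅 : Type v) [NonUnitalNormedRing 𝔅] [NormedSpace ℂ 𝔅] (Q : 𝓢(V, ℂ) →ₗ[ℂ] 𝔅),
        c.HasStarBound M ħ Q → ‖Q f * Q g - Q h‖ ≤ δ := by
  have hsf := supNorm_nonneg f
  have hsg := supNorm_nonneg g
  have hε : 0 < min 1 (δ / (3 * (supNorm f + supNorm g + 1))) := by positivity
  set ε := min 1 (δ / (3 * (supNorm f + supNorm g + 1))) with hεdef
  have hε1 : ε ≤ 1 := min_le_left _ _
  have hε2 : ε * (supNorm f + supNorm g + 1) ≤ δ / 3 := by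
    have : ε ≤ δ / (3 * (supNorm f + supNorm g + 1)) := min_le_right _ _
    calc ε * (supNorm f + supNorm g + 1)
        ≤ δ / (3 * (supNorm f + supNorm g + 1)) * (supNorm f + supNorm g + 1) := by gcongr
      _ = δ / 3 := by field_simp
  obtain ⟨f', hf', R, K, hR, hK, hfm⟩ := exists_bandLimited f hε
  obtain ⟨g', hg', R', K', hR', hK', hgm⟩ := exists_bandLimited g hε
  -- For the band limited f' and g' the remainder is a geometric sequence over n!, so some n makes
  -- it small. The constant ħ₀ + 1 leaves room for all ħ near ħ₀.
  obtain ⟨n, hn0, hn⟩ : ∃ n, 0 < n ∧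
      ((ħ₀ + 1) * M * R * R') ^ n / n.factorial * (K * K') ≤ δ / 3 := by
    have h1 := (FloorSemiring.tendsto_pow_div_factorial_atTop ((ħ₀ + 1) * M * R * R')).mul_const
      (K * K')
    rw [zero_mul] at h1
    obtain ⟨n, h2, h3⟩ := ((h1.eventually_le_const (by positivity : 0 < δ / 3)).and
      (eventually_gt_atTop 0)).exists
    exact ⟨n, h3, h2⟩
  set b : ℕ → 𝓢(V, ℂ) := fun j => c.schwartzStar j f' g' with hb
  -- The approximant may not depend on ħ, so the powers are frozen at ħ₀; the resulting error is
  -- controlled by continuity of ħ^j and the supremum norms of the coefficients.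
  refine ⟨∑ j ∈ Finset.range n, (ħ₀ : ℂ) ^ j • b j, ?_⟩
  have hev : ∀ᶠ ħ : ℝ in 𝓝 ħ₀,
      ∑ j ∈ Finset.range n, ‖(ħ : ℂ) ^ j - (ħ₀ : ℂ) ^ j‖ * supNorm (b j) < δ / 3 := by
    have h1 : Continuous fun ħ : ℝ =>
        ∑ j ∈ Finset.range n, ‖(ħ : ℂ) ^ j - (ħ₀ : ℂ) ^ j‖ * supNorm (b j) := by fun_prop
    refine (h1.tendsto ħ₀).eventually_lt_const ?_
    simpa using hδ
  filter_upwards [hev, eventually_lt_nhds (lt_add_one ħ₀)] with ħ h1 h2 h3 𝔅 _ _ Q hQ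
  have h4 : Q f * Q g - Q (∑ j ∈ Finset.range n, (ħ₀ : ℂ) ^ j • b j) =
      (Q (f - f') * Q g + Q f' * Q (g - g')) +
      (Q f' * Q g' - ∑ j ∈ Finset.range n, (ħ : ℂ) ^ j • Q (b j)) +
      ∑ j ∈ Finset.range n, ((ħ : ℂ) ^ j - (ħ₀ : ℂ) ^ j) • Q (b j) := by
    simp only [map_sub, map_sum, map_smul, sub_smul, Finset.sum_sub_distrib, sub_mul, mul_sub]
    abel
  have hf's : ‖Q f'‖ ≤ supNorm f + 1 := by
    have h5 := norm_sub_le (Q f) (Q (f - f'))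
    rw [map_sub, sub_sub_cancel, ← map_sub] at h5
    linarith [hQ.norm_le f, hQ.norm_le (f - f')]
  have h5 : ‖Q (f - f') * Q g‖ ≤ ε * supNorm g :=
    (norm_mul_le _ _).trans (mul_le_mul ((hQ.norm_le _).trans hf') (hQ.norm_le g) (norm_nonneg _)
      hε.le)
  have h6 : ‖Q f' * Q (g - g')‖ ≤ (supNorm f + 1) * ε :=
    (norm_mul_le _ _).trans (mul_le_mul hf's ((hQ.norm_le _).trans hg') (norm_nonneg _)
      (by positivity))
  have h7 : ‖Q f' * Q g' - ∑ j ∈ Finset.range n, (ħ : ℂ) ^ j • Q (b j)‖ ≤ δ / 3 := by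
    refine (hQ.norm_mul_sub_le n hn0 f' g').trans (le_trans ?_ hn)
    have h8 := fourierMoment_nonneg n f'
    have h9 := fourierMoment_nonneg n g'
    calc (ħ * M) ^ n / n.factorial * (fourierMoment n f' * fourierMoment n g')
        ≤ ((ħ₀ + 1) * M) ^ n / n.factorial * ((R ^ n * K) * (R' ^ n * K')) := by
          gcongr
          · exact hfm n
          · exact hgm n
      _ = _ := by
          simp only [mul_pow]
          ring
  have h8 : ‖∑ j ∈ Finset.range n, ((ħ : ℂ) ^ j - (ħ₀ : ℂ) ^ j) • Q (b j)‖ ≤ δ / 3 := by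
    refine (norm_sum_le _ _).trans (le_trans (Finset.sum_le_sum fun j _ => ?_) h1.le)
    rw [norm_smul]
    exact mul_le_mul_of_nonneg_left (hQ.norm_le _) (norm_nonneg _)
  rw [h4]
  refine (norm_add₃_le).trans ?_
  have h9 := norm_add_le (Q (f - f') * Q g) (Q f' * Q (g - g'))
  nlinarith

end Product

/-! ### Dilations and continuity of the norm for ħ > 0 -/

section Dilation

open Module

variable {V : Type*} [NormedAddCommGroup V] [InnerProductSpace ℝ V] [FiniteDimensional ℝ V]
variable [MeasurableSpace V] [BorelSpace V]
variable {ω : SymplecticForm V} {N : ℕ} (c : ComplexCoordinates ω N) {ħ ħ' : ℝ}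

theorem quasiMeasurePreserving_smul (μ : Measure V) [μ.IsAddHaarMeasure] {s : ℝ} (hs : s ≠ 0) :
    Measure.QuasiMeasurePreserving (fun x : V => s • x) μ μ :=
  ⟨measurable_const_smul s, by
    rw [Measure.map_addHaar_smul μ hs]
    exact Measure.smul_absolutelyContinuous⟩

theorem memLp_comp_smul (μ : Measure V) [μ.IsAddHaarMeasure] {s : ℝ} (hs : s ≠ 0) {f : V → ℂ}
    (hf : MemLp f 2 μ) : MemLp (fun x => f (s • x)) 2 μ := by
  have h1 : MemLp f 2 (Measure.map (s • ·) μ) := by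
    rw [Measure.map_addHaar_smul μ hs]
    exact hf.smul_measure ENNReal.ofReal_ne_top
  exact h1.comp_of_map (measurable_const_smul s).aemeasurable

theorem ComplexCoordinates.coh_smul (h : ħ' * s ^ 2 = ħ) (hs : s ≠ 0) (x y : V) :
    c.coh ħ (s • x) (s • y) = c.coh ħ' x y := by
  rw [ComplexCoordinates.coh, ComplexCoordinates.coh]
  congr 1
  have hs' : (s : ℂ) ≠ 0 := by exact_mod_cast hs
  simp only [c.herm_smul_left, c.herm_smul_right, ← h]
  push_cast
  rcases eq_or_ne ħ' 0 with h0 | h0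
  · simp [h0]
  have h0' : (ħ' : ℂ) ≠ 0 := by exact_mod_cast h0
  field_simp

theorem ComplexCoordinates.mass_eq_of_dilation (h : ħ' * s ^ 2 = ħ) (hs : s ≠ 0) :
    c.mass ħ' = |(s ^ finrank ℝ V)⁻¹| * c.mass ħ := by
  rw [ComplexCoordinates.mass, ComplexCoordinates.mass, ← smul_eq_mul,
    ← Measure.integral_comp_smul (symplecticVolume ω)]
  refine integral_congr_ae (Eventually.of_forall fun x => ?_)
  simp only [c.normSq_smul, ← h]
  congr 1
  rcases eq_or_ne ħ' 0 with h0 | h0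
  · simp [h0]
  field_simp

/-- Dilation maps the physical Hilbert space for `ħ` to that for `ħ / s²`. -/
theorem exists_dilation (hħ : 0 < ħ) (hħ' : 0 < ħ') (h : ħ' * s ^ 2 = ħ)
    (hs : s ≠ 0) (ψ : physicalSpace ω ħ) : ∃ ψ' : physicalSpace ω ħ',
      (ψ' : Lp ℂ 2 (symplecticVolume ω)) =ᵐ[symplecticVolume ω]
        fun x => ((√|(s ^ finrank ℝ V)⁻¹|)⁻¹ : ℂ) * (ψ : Lp ℂ 2 (symplecticVolume ω)) (s • x) := by
  obtain ⟨N, ⟨c⟩⟩ := ω.exists_complexCoordinates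
  set j : ℝ := |(s ^ finrank ℝ V)⁻¹| with hj
  have hj0 : 0 < j := by positivity
  set a : ℂ := ((√j)⁻¹ : ℂ) with ha
  have hm : MemLp (fun x => a * (ψ : Lp ℂ 2 (symplecticVolume ω)) (s • x)) 2 (symplecticVolume ω) :=
    (memLp_comp_smul _ hs (Lp.memLp _)).const_mul a
  -- Membership is tested by the reproducing property. Coherent states for ħ' at (x, y) equal those
  -- for ħ at (sx, sy), so a change of variables reduces it to the property of ψ.
  refine ⟨⟨hm.toLp, c.mem_physicalSpace hħ' _ ?_⟩, hm.coeFn_toLp⟩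
  have h1 := (quasiMeasurePreserving_smul (symplecticVolume ω) hs).ae (c.ae_eq_inner_cohVec hħ ψ)
  filter_upwards [h1, hm.coeFn_toLp] with x hx hx'
  rw [hx', inner_eq_integral_of_ae (c.coeFn_cohVec hħ' x) hm.coeFn_toLp]
  set F : V → ℂ := fun y => star (c.coh ħ (s • x) y) * (ψ : Lp ℂ 2 (symplecticVolume ω)) y with hF
  have h2 : ∀ y, star (c.coh ħ' x y) * (a * (ψ : Lp ℂ 2 (symplecticVolume ω)) (s • y)) =
      a * F (s • y) := by
    intro y
    simp only [hF, c.coh_smul h hs]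
    ring
  simp only [h2]
  rw [integral_const_mul, Measure.integral_comp_smul, ← inner_eq_integral_of_ae
    (c.coeFn_cohVec hħ _) ae_eq_rfl]
  rw [Submodule.coe_inner] at hx
  rw [← hx, c.mass_eq_of_dilation h hs, ← hj, Complex.real_smul]
  push_cast
  ring

/-- Matrix elements of multiplication operators under dilations. -/
theorem integral_dilation (μ : Measure V) [μ.IsAddHaarMeasure] {s : ℝ} (hs : s ≠ 0)
    (f φ ψ : V → ℂ) {φ' ψ' : V → ℂ}
    (hφ : φ' =ᵐ[μ] fun x => ((√|(s ^ finrank ℝ V)⁻¹|)⁻¹ : ℂ) * φ (s • x))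
    (hψ : ψ' =ᵐ[μ] fun x => ((√|(s ^ finrank ℝ V)⁻¹|)⁻¹ : ℂ) * ψ (s • x)) :
    ∫ x, f (s • x) * (star (φ' x) * ψ' x) ∂μ = ∫ x, f x * (star (φ x) * ψ x) ∂μ := by
  set j : ℝ := |(s ^ finrank ℝ V)⁻¹| with hj
  have hj0 : 0 < j := by positivity
  set F : V → ℂ := fun x => f x * (star (φ x) * ψ x) with hF
  have h1 : ∫ x, f (s • x) * (star (φ' x) * ψ' x) ∂μ =
      ∫ x, (j : ℂ)⁻¹ * F (s • x) ∂μ := by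
    refine integral_congr_ae ?_
    filter_upwards [hφ, hψ] with x h1 h2
    have h3 : (j : ℂ)⁻¹ = ((√j)⁻¹ : ℂ) * ((√j)⁻¹ : ℂ) := by
      rw [← mul_inv, ← Complex.ofReal_mul, Real.mul_self_sqrt hj0.le]
    rw [h1, h2, h3, star_mul']
    simp only [hF, Complex.star_def, map_inv₀, Complex.conj_ofReal]
    ring
  have hj1 : (j : ℂ) ≠ 0 := by exact_mod_cast hj0.ne'
  rw [h1, integral_const_mul, Measure.integral_comp_smul, ← hj, Complex.real_smul, ← mul_assoc,
    inv_mul_cancel₀ hj1, one_mul]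

theorem norm_eq_of_inner_self {H H' : Type*} [NormedAddCommGroup H] [InnerProductSpace ℂ H]
    [NormedAddCommGroup H'] [InnerProductSpace ℂ H'] {x : H} {y : H'} (h : ⟪x, x⟫_ℂ = ⟪y, y⟫_ℂ) :
    ‖x‖ = ‖y‖ := by
  rw [@norm_eq_sqrt_re_inner ℂ, @norm_eq_sqrt_re_inner ℂ, h]

/-- Only preservation of norms and of matrix elements is used, so U needs neither linearity nor
surjectivity; for dilations, the reverse inequality comes from the inverse dilation. -/
theorem norm_le_of_intertwining {H H' : Type*} [NormedAddCommGroup H] [InnerProductSpace ℂ H]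
    [NormedAddCommGroup H'] [InnerProductSpace ℂ H'] {T : H →L[ℂ] H} {T' : H' →L[ℂ] H'}
    (U : H → H') (hU : ∀ x, ‖U x‖ = ‖x‖) (h : ∀ x y, ⟪x, T y⟫_ℂ = ⟪U x, T' (U y)⟫_ℂ) :
    ‖T‖ ≤ ‖T'‖ := by
  refine norm_le_of_norm_inner_le (norm_nonneg _) fun x y => ?_
  rw [h, ← hU x, ← hU y]
  refine (norm_inner_le_norm _ _).trans ?_
  have := T'.le_opNorm (U y)
  calc ‖U x‖ * ‖T' (U y)‖ ≤ ‖U x‖ * (‖T'‖ * ‖U y‖) := by gcongr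
    _ = _ := by ring

theorem norm_toeplitz_le_dilation (hħ : 0 < ħ) (hħ' : 0 < ħ') (s : ℝˣ)
    (h : ħ' * (s : ℝ) ^ 2 = ħ) (f : 𝓢(V, ℂ)) :
    ‖toeplitz ω ħ f‖ ≤ ‖toeplitz ω ħ' (dilation s f)‖ := by
  choose U hU using fun ψ => exists_dilation (ω := ω) hħ hħ' h s.ne_zero ψ
  refine norm_le_of_intertwining U (fun ψ => norm_eq_of_inner_self ?_) fun φ ψ => ?_
  · rw [Submodule.coe_inner, Submodule.coe_inner, inner_eq_integral, inner_eq_integral]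
    simpa using integral_dilation (symplecticVolume ω) s.ne_zero 1 _ _ (hU ψ) (hU ψ)
  · rw [inner_toeplitz, inner_toeplitz]
    exact (integral_dilation (symplecticVolume ω) s.ne_zero f _ _ (hU φ) (hU ψ)).symm

theorem norm_toeplitz_dilation (hħ : 0 < ħ) (hħ' : 0 < ħ') (s : ℝˣ)
    (h : ħ' * (s : ℝ) ^ 2 = ħ) (f : 𝓢(V, ℂ)) :
    ‖toeplitz ω ħ' (dilation s f)‖ = ‖toeplitz ω ħ f‖ := by
  refine le_antisymm ?_ (norm_toeplitz_le_dilation hħ hħ' s h f)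
  have h1 := norm_toeplitz_le_dilation (ω := ω) hħ' hħ s⁻¹ (by
    rw [← h, mul_assoc, ← mul_pow, Units.mul_inv, one_pow, mul_one]) (dilation s f)
  have h2 : dilation s⁻¹ (dilation s f) = f := by
    ext x
    rw [dilation_apply, dilation_apply, smul_smul, Units.mul_inv, one_smul]
  rwa [h2] at h1

theorem norm_toeplitz_le_supNorm (f : 𝓢(V, ℂ)) : ‖toeplitz ω ħ f‖ ≤ supNorm f :=
  norm_toeplitz_le f (supNorm_nonneg f) (norm_le_supNorm f)

theorem abs_norm_sub_norm_le_norm_map_sub {F H : Type*} [AddCommGroup F] [Module ℂ F]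
    [NormedAddCommGroup H] [InnerProductSpace ℂ H] (Q : F →ₗ[ℂ] H →L[ℂ] H) (f g : F) :
    |‖Q f‖ - ‖Q g‖| ≤ ‖Q (f - g)‖ := by
  rw [map_sub]
  exact abs_norm_sub_norm_le _ _

/-- The norm of a Toeplitz operator depends continuously on `ħ > 0`. -/
theorem tendsto_norm_toeplitz (hħ : 0 < ħ) (f : 𝓢(V, ℂ)) :
    Tendsto (fun t => ‖toeplitz ω t f‖) (𝓝 ħ) (𝓝 ‖toeplitz ω ħ f‖) := by
  obtain ⟨C, hC⟩ := exists_supNorm_dilation_sub_le f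
  have h1 : Tendsto (fun t : ℝ => √(t / ħ)) (𝓝 ħ) (𝓝 1) := by
    have h : Continuous fun t : ℝ => √(t / ħ) := by fun_prop
    simpa [hħ.ne'] using h.tendsto ħ
  have h2 : Tendsto (fun t : ℝ => C * |√(t / ħ) - 1|) (𝓝 ħ) (𝓝 0) := by
    simpa using ((h1.sub_const 1).abs).const_mul C
  rw [tendsto_iff_norm_sub_tendsto_zero]
  refine squeeze_zero' (Eventually.of_forall fun _ => norm_nonneg _) ?_ h2
  filter_upwards [h1.eventually_const_le (by norm_num : (1 / 2 : ℝ) < 1), eventually_gt_nhds hħ]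
    with t ht ht0
  have hs : √(t / ħ) ≠ 0 := by positivity
  -- With s = √(t/ħ), the norm of T_t(f) is that of T_ħ(f(s·)). Both operators now act on the same
  -- Hilbert space, and the difference is bounded by the supremum norm of f(s·) - f.
  have h3 := norm_toeplitz_dilation (ω := ω) ht0 hħ (Units.mk0 _ hs) (by
    rw [Units.val_mk0, Real.sq_sqrt (by positivity), mul_div_cancel₀ _ hħ.ne']) f
  rw [← h3, Real.norm_eq_abs]
  exact (abs_norm_sub_norm_le_norm_map_sub _ _ _).trans
    ((norm_toeplitz_le_supNorm _).trans (hC _ ht))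

end Dilation

/-! ### The Berezin transform and the classical limit of norms -/

section Classical

open scoped FourierTransform

variable {V : Type*} [NormedAddCommGroup V] [InnerProductSpace ℝ V] [FiniteDimensional ℝ V]
variable [MeasurableSpace V] [BorelSpace V]
variable {ω : SymplecticForm V} {N : ℕ} (c : ComplexCoordinates ω N) {ħ : ℝ}

theorem ComplexCoordinates.matrixElement_cohVec (hħ : 0 < ħ) (x u : V) :
    c.matrixElement (c.cohVec hħ x) (c.cohVec hħ x) u =
      c.mass ħ * (c.character u x * Real.exp (-ħ * c.normSq u)) := by
  have hħ0 : (ħ : ℂ) ≠ 0 := by exact_mod_cast hħ.ne'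
  rw [← c.inner_weyl_eq, c.weyl_cohVec]
  refine (inner_smul_right (𝕜 := ℂ) (E := physicalSpace ω ħ) _ _ _).trans ?_
  rw [c.inner_cohVec, mul_left_comm]
  congr 1
  rw [ComplexCoordinates.coh, ComplexCoordinates.character, Complex.ofReal_exp, ← Complex.exp_add,
    ← Complex.exp_add]
  congr 1
  push_cast
  rw [← c.herm_self]
  simp only [c.herm_add_left, c.herm_add_right, c.herm_smul_left, c.herm_smul_right]
  field_simp
  ring

theorem fourier_inversion (f : 𝓢(V, ℂ)) (x : V) :
    ∫ ξ, (𝓕 f : 𝓢(V, ℂ)) ξ * c.character (frequency ω ξ) x = f x := by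
  have h3 : (𝓕⁻ (𝓕 f) : 𝓢(V, ℂ)) x = f x := by rw [FourierTransform.fourierInv_fourier_eq]
  rw [← h3, SchwartzMap.fourierInv_coe, Real.fourierInv_eq]
  refine integral_congr_ae (Eventually.of_forall fun ξ => ?_)
  simp only [Circle.smul_def, smul_eq_mul]
  rw [c.fourierChar_eq, mul_comm]

/-- The Berezin transform. -/
theorem ComplexCoordinates.norm_integral_le_norm_toeplitz (hħ : 0 < ħ) (f : 𝓢(V, ℂ)) (x : V) :
    ‖∫ ξ, (𝓕 f : 𝓢(V, ℂ)) ξ * (c.character (frequency ω ξ) x *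
      Real.exp (-ħ * c.normSq (frequency ω ξ)))‖ ≤ ‖toeplitz ω ħ f‖ := by
  -- The integral is the expectation of T(f) in the normalised coherent state at x, because the
  -- diagonal matrix elements of Weyl operators are characters damped by exp(-ħ|u|²).
  have h1 := c.inner_toeplitz_fourier f (c.cohVec hħ x) (c.cohVec hħ x)
  simp only [c.matrixElement_cohVec hħ, mul_left_comm _ (c.mass ħ : ℂ)] at h1
  rw [integral_const_mul] at h1
  have hm := c.mass_pos hħ
  have h2 := norm_inner_le_norm (𝕜 := ℂ) (c.cohVec hħ x) (toeplitz ω ħ f (c.cohVec hħ x))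
  rw [h1, norm_mul, Complex.norm_real, Real.norm_of_nonneg hm.le] at h2
  have h3 := (toeplitz ω ħ f).le_opNorm (c.cohVec hħ x)
  have h4 := c.norm_cohVec_sq hħ x
  have h5 := mul_le_mul_of_nonneg_left h3 (norm_nonneg (c.cohVec hħ x))
  refine le_of_mul_le_mul_left (h2.trans (h5.trans (le_of_eq ?_))) hm
  rw [← h4]
  ring

/-- As t → 0 the damping factor tends to 1, being at most 1 throughout; dominated convergence with
the integrable 𝓕 f leaves the Fourier inversion formula. -/
theorem ComplexCoordinates.tendsto_berezin (f : 𝓢(V, ℂ)) (x : V) :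
    Tendsto (fun t : ℝ => ∫ ξ, (𝓕 f : 𝓢(V, ℂ)) ξ * (c.character (frequency ω ξ) x *
      Real.exp (-t * c.normSq (frequency ω ξ)))) (𝓝[≥] 0) (𝓝 (f x)) := by
  have hch : Continuous fun ξ => c.character (frequency ω ξ) x :=
    c.continuous_character.comp (by fun_prop : Continuous fun ξ : V => (frequency ω ξ, x))
  have hn : Continuous fun ξ => c.normSq (frequency ω ξ) :=
    c.continuous_normSq.comp (frequency ω).continuous
  rw [← fourier_inversion c f x]
  refine tendsto_integral_filter_of_dominated_convergence
    (fun ξ => ‖(𝓕 f : 𝓢(V, ℂ)) ξ‖) (Eventually.of_forall fun t => ?_) ?_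
    (𝓕 f : 𝓢(V, ℂ)).integrable.norm (Eventually.of_forall fun ξ => ?_)
  · have := (𝓕 f : 𝓢(V, ℂ)).continuous
    exact Continuous.aestronglyMeasurable (by fun_prop)
  · filter_upwards [self_mem_nhdsWithin] with t ht
    refine Eventually.of_forall fun ξ => ?_
    rw [norm_mul, norm_mul, c.norm_character, one_mul, Complex.norm_real,
      Real.norm_of_nonneg (Real.exp_pos _).le]
    refine mul_le_of_le_one_right (norm_nonneg _) (Real.exp_le_one_iff.2 ?_)
    rw [neg_mul, neg_nonpos]
    exact mul_nonneg ht (c.normSq_nonneg _)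
  · have h : Continuous fun t : ℝ => (𝓕 f : 𝓢(V, ℂ)) ξ * (c.character (frequency ω ξ) x *
      Real.exp (-t * c.normSq (frequency ω ξ))) := by fun_prop
    have h2 := (h.tendsto 0).mono_left (nhdsWithin_le_nhds (s := Set.Ici 0))
    simpa using h2

/-- The norms of Toeplitz operators converge to the supremum norm in the classical limit. -/
theorem eventually_lt_norm_toeplitz (f : 𝓢(V, ℂ)) {r : ℝ} (hr : r < supNorm f) :
    ∀ᶠ t : ℝ in 𝓝[≥] 0, 0 < t → r < ‖toeplitz ω t f‖ := by
  obtain ⟨N, ⟨c⟩⟩ := ω.exists_complexCoordinates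
  -- For r ≥ 0 some value of |f| exceeds r and the Berezin transform at that point is used; a
  -- negative r lies below every norm.
  obtain ⟨x, hx⟩ : ∃ x, max r 0 < ‖f x‖ ∨ r < 0 := by
    by_contra! h
    exact absurd (supNorm_le (le_max_right r 0) fun x => (h x).1) (not_le.2 (by
      rw [max_eq_left (h 0).2]; exact hr))
  rcases hx with hx | hx
  · filter_upwards [(c.tendsto_berezin f x).norm.eventually_const_lt
      ((le_max_left _ _).trans_lt hx)] with t ht ht0
    exact ht.trans_le (c.norm_integral_le_norm_toeplitz ht0 f x)
  · exact Eventually.of_forall fun t _ => hx.trans_le (ContinuousLinearMap.opNorm_nonneg _)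

end Classical

/-! ### Toeplitz quantization satisfies the star product estimate -/

section StarBound

universe u

variable {V : Type u} [NormedAddCommGroup V] [InnerProductSpace ℝ V] [FiniteDimensional ℝ V]
variable [MeasurableSpace V] [BorelSpace V]
variable {ω : SymplecticForm V} {N : ℕ} {c : ComplexCoordinates ω N} {M ħ : ℝ}

theorem ComplexCoordinates.HasStarBound.of_isometry {𝔅 𝔅' : Type*} [NonUnitalNormedRing 𝔅]
    [NormedSpace ℂ 𝔅] [NonUnitalNormedRing 𝔅'] [NormedSpace ℂ 𝔅'] (ι : 𝔅 →ₗ[ℂ] 𝔅')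
    (hmul : ∀ a b, ι (a * b) = ι a * ι b) (hι : ∀ a, ‖ι a‖ = ‖a‖) {Q : 𝓢(V, ℂ) →ₗ[ℂ] 𝔅}
    (hQ : c.HasStarBound M ħ (ι ∘ₗ Q)) : c.HasStarBound M ħ Q where
  norm_le f := by
    rw [← hι]
    exact hQ.norm_le f
  norm_mul_sub_le n hn f g := by
    rw [← hι]
    simpa only [map_sub, hmul, map_sum, map_smul, LinearMap.comp_apply] using hQ.norm_mul_sub_le n hn f g

/-- The uniform approximation of products is used here at a single value of ħ: the closure of the
range is then an algebra, as the density argument requires. -/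
theorem ComplexCoordinates.HasStarBound.mul_mem_closure {H : Type u} [NormedAddCommGroup H]
    [InnerProductSpace ℂ H] {Q : 𝓢(V, ℂ) →ₗ[ℂ] H →L[ℂ] H} (hM : 0 ≤ M) (hħ : 0 ≤ ħ)
    (hQ : c.HasStarBound M ħ Q) : ∀ A ∈ LinearMap.range Q, ∀ B ∈ LinearMap.range Q,
      A * B ∈ (LinearMap.range Q).topologicalClosure := by
  rintro _ ⟨f, rfl⟩ _ ⟨g, rfl⟩
  refine Metric.mem_closure_iff.2 fun ε hε => ?_
  obtain ⟨h, hh⟩ := c.exists_mul_approx hM f g hħ (half_pos hε)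
  refine ⟨Q h, ⟨h, rfl⟩, ?_⟩
  rw [dist_eq_norm]
  exact (hh.self_of_nhds hħ _ Q hQ).trans_lt (half_lt_self hε)

theorem ComplexCoordinates.hasStarBound_toeplitz (hM : 0 ≤ M) (hħ : 0 < ħ)
    (h : ∀ ξ η : V, ‖c.herm (frequency ω η) (frequency ω ξ)‖ ≤ M * (‖ξ‖ * ‖η‖)) :
    c.HasStarBound (𝔅 := physicalSpace ω ħ →L[ℂ] physicalSpace ω ħ) M ħ (toeplitz ω ħ) where
  norm_le := norm_toeplitz_le_supNorm
  norm_mul_sub_le n _ f g :=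
    c.norm_toeplitz_mul_sub_le hħ hM h n f g _ fun j => c.coe_schwartzStar j f g

/-- At ħ = 0 only the term j = 0 survives and B_0 is the pointwise product, so for n > 0 both sides
vanish. This lets ħ = 0 be treated together with ħ > 0. -/
theorem ComplexCoordinates.hasStarBound_classical :
    c.HasStarBound M 0 (SchwartzMap.toZeroAtInftyCLM ℂ V ℂ).toLinearMap where
  norm_le f := (SchwartzMap.norm_toZeroAtInfty f).le
  norm_mul_sub_le n hn f g := by
    have h1 : (SchwartzMap.toZeroAtInftyCLM ℂ V ℂ).toLinearMap f *
        (SchwartzMap.toZeroAtInftyCLM ℂ V ℂ).toLinearMap g -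
        ∑ j ∈ Finset.range n, ((0 : ℝ) : ℂ) ^ j •
          (SchwartzMap.toZeroAtInftyCLM ℂ V ℂ).toLinearMap (c.schwartzStar j f g) = 0 := by
      obtain ⟨n, rfl⟩ := Nat.exists_eq_succ_of_ne_zero hn.ne'
      rw [Finset.sum_range_succ', Finset.sum_eq_zero (fun j _ => by simp), zero_add, sub_eq_zero]
      ext x
      have h2 := congrFun (c.coe_schwartzStar 0 f g) x
      simp [ComplexCoordinates.starCoeff] at h2
      simp [h2]
    rw [h1, norm_zero, zero_mul, zero_pow hn.ne', zero_div, zero_mul]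

theorem toeplitz_mem_range (c : ComplexCoordinates ω N) (hħ : 0 < ħ) (f : 𝓢(V, ℂ)) :
    ∫ x, f x • InnerProductSpace.rankOne ℂ (c.cohVec hħ x) (c.cohVec hħ x) ∂(symplecticVolume ω) ∈
      LinearMap.range (toeplitz ω ħ) := by
  refine ⟨(c.mass ħ : ℂ) ^ 2 • f, ?_⟩
  rw [c.toeplitz_eq_integral hħ]
  have hm : (c.mass ħ : ℂ) ≠ 0 := by exact_mod_cast (c.mass_pos hħ).ne'
  congr 1
  ext1 x
  congr 1
  rw [smul_apply, smul_eq_mul]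
  field_simp

/-- Toeplitz operators are dense in the compact operators. -/
theorem mem_closure_range_toeplitz (hħ : 0 < ħ)
    {T : physicalSpace ω ħ →L[ℂ] physicalSpace ω ħ} (hT : IsCompactOperator T) :
    T ∈ (LinearMap.range (toeplitz ω ħ)).topologicalClosure := by
  obtain ⟨N, ⟨c⟩⟩ := ω.exists_complexCoordinates
  obtain ⟨M, hM, h⟩ := c.exists_norm_herm_frequency_le
  refine mem_topologicalClosure_of_isCompactOperator
    ((c.hasStarBound_toeplitz hM.le hħ h).mul_mem_closure hM.le hħ.le) (symplecticVolume ω)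
    (c.continuous_cohVec hħ) (c.norm_cohVec_sq hħ) (c.span_cohVec hħ) (fun x y => ?_)
    (toeplitz_mem_range c hħ) hT
  rw [c.inner_cohVec]
  exact mul_ne_zero (by exact_mod_cast (c.mass_pos hħ).ne') (Complex.exp_ne_zero _)

end StarBound

/-! ### From families of quantization maps to continuous fields -/

section Quantization

universe u

variable {V : Type u} [NormedAddCommGroup V] [InnerProductSpace ℝ V] [FiniteDimensional ℝ V]

/-- The complex conjugate of a Schwartz function. -/
theorem exists_conj (f : 𝓢(V, ℂ)) : ∃ g : 𝓢(V, ℂ), ∀ x, g x = star (f x) :=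
  ⟨SchwartzMap.postcompCLM (𝕜 := ℝ) Complex.conjCLE.toContinuousLinearMap f, fun _ => rfl⟩

theorem eq_one_of_forall_mul_eq (e : 𝓢(V, ℂ)) (h : ∀ (f : 𝓢(V, ℂ)) x, e x * f x = f x) (x : V) :
    e x = 1 := by
  let χ : ContDiffBump x := ⟨1, 2, one_pos, one_lt_two⟩
  have hsm : ContDiff ℝ ((⊤ : ℕ∞) : WithTop ℕ∞) fun y => (χ y : ℂ) :=
    Complex.ofRealCLM.contDiff.comp χ.contDiff
  have hcs : HasCompactSupport fun y => (χ y : ℂ) :=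
    χ.hasCompactSupport.comp_left (g := fun t : ℝ => (t : ℂ)) Complex.ofReal_zero
  have h1 := h (hcs.toSchwartzMap hsm) x
  have h2 : hcs.toSchwartzMap hsm x = 1 := by
    show (χ x : ℂ) = 1
    rw [χ.one_of_mem_closedBall (Metric.mem_closedBall_self zero_le_one), Complex.ofReal_one]
  rwa [h2, mul_one] at h1

section Sections

variable {𝔄 : PosParam → Type u} [∀ ħ, NonUnitalCStarAlgebra (𝔄 ħ)]

/-- The quantization maps into the fibres, as linear maps. -/
def quantizationAux (Q : ∀ ħ, 𝓢(V, ℂ) →ₗ[ℂ] 𝔄 ħ) (ħ : ℝ≥0) :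
    ∀ d : Decidable (0 < ħ), 𝓢(V, ℂ) →ₗ[ℂ] FibreAux V 𝔄 ħ d
  | .isTrue h => Q ⟨ħ, h⟩
  | .isFalse _ => (SchwartzMap.toZeroAtInftyCLM ℂ V ℂ).toLinearMap

/-- Fibres are defined by matching on a `Decidable` instance; statements about them are proved for
every instance by cases and then specialised to the classical one. -/
theorem quantizationAux_apply (Q : ∀ ħ, 𝓢(V, ℂ) →ₗ[ℂ] 𝔄 ħ) (f : 𝓢(V, ℂ)) (ħ : ℝ≥0)
    (d : Decidable (0 < ħ)) : quantizationAux Q ħ d f = quantizationSectionAux Q f ħ d := by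
  cases d <;> rfl

/-- The quantization map into the fibre at `ħ`. -/
def quantizationMap (Q : ∀ ħ, 𝓢(V, ℂ) →ₗ[ℂ] 𝔄 ħ) (ħ : ℝ≥0) : 𝓢(V, ℂ) →ₗ[ℂ] Fibre V 𝔄 ħ :=
  quantizationAux Q ħ _

theorem quantizationMap_apply (Q : ∀ ħ, 𝓢(V, ℂ) →ₗ[ℂ] 𝔄 ħ) (f : 𝓢(V, ℂ)) (ħ : ℝ≥0) :
    quantizationMap Q ħ f = quantizationSection Q f ħ :=
  quantizationAux_apply Q f ħ _

theorem norm_quantizationMap_of_pos (Q : ∀ ħ, 𝓢(V, ℂ) →ₗ[ℂ] 𝔄 ħ) (f : 𝓢(V, ℂ)) {ħ : ℝ≥0}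
    (hħ : 0 < ħ) : ‖quantizationMap Q ħ f‖ = ‖Q ⟨ħ, hħ⟩ f‖ := by
  have h : ∀ d : Decidable (0 < ħ), ‖quantizationAux Q ħ d f‖ = ‖Q ⟨ħ, hħ⟩ f‖ := by
    intro d
    cases d with
    | isTrue _ => rfl
    | isFalse h => exact absurd hħ h
  exact h _

theorem norm_quantizationMap_zero (Q : ∀ ħ, 𝓢(V, ℂ) →ₗ[ℂ] 𝔄 ħ) (f : 𝓢(V, ℂ)) :
    ‖quantizationMap Q 0 f‖ = supNorm f := by
  have h : ∀ d : Decidable ((0 : ℝ≥0) < 0), ‖quantizationAux Q 0 d f‖ = supNorm f := by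
    intro d
    cases d with
    | isTrue h => exact absurd h (lt_irrefl _)
    | isFalse _ => exact SchwartzMap.norm_toZeroAtInfty f
  exact h _

theorem quantizationMap_star (Q : ∀ ħ, 𝓢(V, ℂ) →ₗ[ℂ] 𝔄 ħ) {f g : 𝓢(V, ℂ)}
    (h : ∀ x, g x = star (f x)) (hQ : ∀ ħ, Q ħ g = star (Q ħ f)) (ħ : ℝ≥0) :
    quantizationMap Q ħ g = star (quantizationMap Q ħ f) := by
  have h : ∀ d : Decidable (0 < ħ), quantizationAux Q ħ d g = star (quantizationAux Q ħ d f) := by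
    intro d
    cases d with
    | isTrue hħ => exact hQ ⟨ħ, hħ⟩
    | isFalse _ =>
      have h1 : SchwartzMap.toZeroAtInftyCLM ℂ V ℂ g =
          star (SchwartzMap.toZeroAtInftyCLM ℂ V ℂ f) := by
        ext x
        exact h x
      exact h1
  exact h _

theorem dense_range_quantizationMap (Q : ∀ ħ, 𝓢(V, ℂ) →ₗ[ℂ] 𝔄 ħ)
    (hQ : ∀ ħ, Dense (Set.range (Q ħ))) (ħ : ℝ≥0) :
    Dense (Set.range (quantizationMap Q ħ)) := by
  have h : ∀ d : Decidable (0 < ħ), Dense (Set.range (quantizationAux Q ħ d)) := by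
    intro d
    cases d with
    | isTrue hħ => exact hQ ⟨ħ, hħ⟩
    | isFalse _ => exact dense_schwartz
  exact h _

variable [MeasurableSpace V] [BorelSpace V]
variable {ω : SymplecticForm V} {N : ℕ} {c : ComplexCoordinates ω N} {M : ℝ}

theorem ComplexCoordinates.hasStarBound_quantizationMap (Q : ∀ ħ, 𝓢(V, ℂ) →ₗ[ℂ] 𝔄 ħ)
    (hQ : ∀ ħ : PosParam, c.HasStarBound M (ħ : ℝ≥0) (Q ħ)) (ħ : ℝ≥0) :
    c.HasStarBound M ħ (quantizationMap Q ħ) := by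
  have h : ∀ d : Decidable (0 < ħ), c.HasStarBound M ħ (quantizationAux Q ħ d) := by
    intro d
    cases d with
    | isTrue hħ => exact hQ ⟨ħ, hħ⟩
    | isFalse h =>
      obtain rfl : ħ = 0 := by simpa using h
      exact c.hasStarBound_classical
  exact h _

/-- A quantization with the standard remainder estimate, dense image, and norms that depend
continuously on `ħ`, gives a continuous field of C*-algebras. -/
theorem ComplexCoordinates.exists_field_of_hasStarBound (Q : ∀ ħ, 𝓢(V, ℂ) →ₗ[ℂ] 𝔄 ħ) (hM : 0 ≤ M)
    (hQ : ∀ ħ : PosParam, c.HasStarBound M (ħ : ℝ≥0) (Q ħ))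
    (hstar : ∀ (f g : 𝓢(V, ℂ)), (∀ x, g x = star (f x)) → ∀ ħ, Q ħ g = star (Q ħ f))
    (hdense : ∀ ħ, Dense (Set.range (Q ħ)))
    (hcont : ∀ f, Continuous fun ħ => ‖quantizationMap Q ħ f‖) :
    ∃ Γ : ContinuousField ℝ≥0 (Fibre V 𝔄),
      ∀ f : 𝓢(V, ℂ), quantizationSection Q f ∈ Γ.sections := by
  refine (exists_continuousField (q := LinearMap.pi fun ħ => quantizationMap Q ħ)
    (fun f => ?_) (fun f g ħ₀ δ hδ => ?_) hcont
    fun ħ => dense_range_quantizationMap Q hdense ħ).imp fun Γ hΓ f => ?_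
  · obtain ⟨g, hg⟩ := exists_conj f
    exact ⟨g, funext fun ħ => quantizationMap_star Q hg (hstar f g hg) ħ⟩
  · obtain ⟨h, hh⟩ := c.exists_mul_approx hM f g ħ₀.2 hδ
    refine ⟨h, ?_⟩
    filter_upwards [(NNReal.continuous_coe.tendsto ħ₀).eventually hh] with ħ h1
    exact h1 ħ.2 _ _ (c.hasStarBound_quantizationMap Q hQ ħ)
  · have h : quantizationSection Q f = (LinearMap.pi fun ħ => quantizationMap Q ħ) f :=
      funext fun ħ => (quantizationMap_apply Q f ħ).symm
    rw [h]
    exact hΓ f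

end Sections

end Quantization

/-! ### Assembly of the deformation quantization -/

section Main

universe u

theorem dense_range_of_mem_closure {H : Type u} [NormedAddCommGroup H] [InnerProductSpace ℂ H]
    [CompleteSpace H] {F : Type*} [AddCommGroup F] [Module ℂ F] (T : F →ₗ[ℂ] H →L[ℂ] H)
    (Q : F → CompactOperators H) (hQ : ∀ f, (Q f : H →L[ℂ] H) = T f)
    (h : ∀ A : H →L[ℂ] H, IsCompactOperator A → A ∈ (LinearMap.range T).topologicalClosure) :
    Dense (Set.range Q) := by
  intro A
  rw [Metric.mem_closure_iff]
  intro ε hε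
  obtain ⟨_, ⟨f, rfl⟩, hf⟩ := Metric.mem_closure_iff.1 (h A A.2) ε hε
  refine ⟨Q f, ⟨f, rfl⟩, ?_⟩
  rw [Subtype.dist_eq, hQ]
  exact hf

variable {V : Type u} [NormedAddCommGroup V] [InnerProductSpace ℝ V] [FiniteDimensional ℝ V]
variable [MeasurableSpace V] [BorelSpace V]
variable {ω : SymplecticForm V} {N : ℕ} {c : ComplexCoordinates ω N} {M ħ : ℝ}

theorem ComplexCoordinates.HasStarBound.compactOperators {H : Type u} [NormedAddCommGroup H]
    [InnerProductSpace ℂ H] [CompleteSpace H] {T : 𝓢(V, ℂ) →ₗ[ℂ] H →L[ℂ] H}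
    {Q : 𝓢(V, ℂ) →ₗ[ℂ] CompactOperators H} (hQ : ∀ f, (Q f : H →L[ℂ] H) = T f)
    (h : c.HasStarBound (𝔅 := H →L[ℂ] H) M ħ T) :
    c.HasStarBound (𝔅 := CompactOperators H) M ħ Q := by
  obtain rfl : T = (BerezinToeplitz.compactOperators H).toNonUnitalSubalgebra.toSubmodule.subtype
      ∘ₗ Q := LinearMap.ext fun f => (hQ f).symm
  exact ComplexCoordinates.HasStarBound.of_isometry (𝔅 := CompactOperators H) _ (fun _ _ => rfl)
    (fun _ => rfl) h

variable {H : PosParam → Type u} [∀ ħ, NormedAddCommGroup (H ħ)] [∀ ħ, InnerProductSpace ℂ (H ħ)]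
  [∀ ħ, CompleteSpace (H ħ)]

theorem isQuantization_compactOperators {Q : ∀ ħ, 𝓢(V, ℂ) →ₗ[ℂ] CompactOperators (H ħ)}
    (hstar : ∀ (f g : 𝓢(V, ℂ)), (∀ x, g x = star (f x)) → ∀ ħ, (Q ħ g : H ħ →L[ℂ] H ħ) =
      ContinuousLinearMap.adjoint (Q ħ f : H ħ →L[ℂ] H ħ))
    (hone : ∀ f : 𝓢(V, ℂ), (∀ x, f x = 1) → ∀ ħ, (Q ħ f : H ħ →L[ℂ] H ħ) = 1) :
    IsQuantization (𝔄 := fun ħ => CompactOperators (H ħ)) Q where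
  star_eq ħ f g h := Subtype.ext (hstar f g h ħ)
  unital e he ħ a := by
    have h1 := hone e (eq_one_of_forall_mul_eq e he) ħ
    constructor
    · refine Subtype.ext ?_
      show (Q ħ e : H ħ →L[ℂ] H ħ) * (a : H ħ →L[ℂ] H ħ) = a
      rw [h1, one_mul]
    · refine Subtype.ext ?_
      show (a : H ħ →L[ℂ] H ħ) * (Q ħ e : H ħ →L[ℂ] H ħ) = a
      rw [h1, mul_one]

section CStar

variable {𝔄 : PosParam → Type u} [∀ ħ, NonUnitalCStarAlgebra (𝔄 ħ)]

/-- Away from 0 the norm coincides locally with q. At 0 the bound by the supremum norm gives upper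
semicontinuity, and the eventual lower bound gives the other half. -/
theorem continuous_norm_quantizationMap {Q : ∀ ħ, 𝓢(V, ℂ) →ₗ[ℂ] 𝔄 ħ} {f : 𝓢(V, ℂ)} {q : ℝ → ℝ}
    (hq : ∀ ħ : PosParam, ‖Q ħ f‖ = q (ħ : ℝ≥0)) (hle : ∀ ħ : ℝ, 0 < ħ → q ħ ≤ supNorm f)
    (hlt : ∀ r < supNorm f, ∀ᶠ t : ℝ in 𝓝[≥] 0, 0 < t → r < q t)
    (hcont : ∀ ħ : ℝ, 0 < ħ → ContinuousAt q ħ) :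
    Continuous fun ħ => ‖quantizationMap Q ħ f‖ := by
  have hpos : ∀ ħ : ℝ≥0, 0 < ħ → ‖quantizationMap Q ħ f‖ = q ħ :=
    fun ħ hħ => (norm_quantizationMap_of_pos _ f hħ).trans (hq ⟨ħ, hħ⟩)
  rw [continuous_iff_continuousAt]
  intro ħ₀
  rcases eq_zero_or_pos ħ₀ with rfl | hħ₀
  · rw [ContinuousAt, norm_quantizationMap_zero, tendsto_order]
    have h1 : ∀ ħ : ℝ≥0, ‖quantizationMap Q ħ f‖ ≤ supNorm f := by
      intro ħ
      rcases eq_zero_or_pos ħ with rfl | hħ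
      · exact (norm_quantizationMap_zero _ f).le
      · exact (hpos ħ hħ).trans_le (hle ħ hħ)
    refine ⟨fun r hr => ?_, fun r hr => Eventually.of_forall fun ħ => (h1 ħ).trans_lt hr⟩
    have h2 : Tendsto (fun ħ : ℝ≥0 => (ħ : ℝ)) (𝓝 0) (𝓝[≥] 0) :=
      tendsto_nhdsWithin_iff.2 ⟨by simpa using NNReal.continuous_coe.tendsto 0,
        Eventually.of_forall fun ħ => ħ.2⟩
    filter_upwards [h2.eventually (hlt r hr)] with ħ h3
    rcases eq_zero_or_pos ħ with rfl | hħ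
    · rwa [norm_quantizationMap_zero]
    · rw [hpos ħ hħ]
      exact h3 hħ
  · rw [ContinuousAt, hpos ħ₀ hħ₀]
    refine ((hcont ħ₀ hħ₀).tendsto.comp (NNReal.continuous_coe.tendsto ħ₀)).congr' ?_
    filter_upwards [eventually_gt_nhds hħ₀] with ħ hħ
    exact (hpos ħ hħ).symm

/-- The sum up to j = k has n = k + 1 terms, so the remainder estimate carries one more power of ħ
than is divided out. -/
theorem ComplexCoordinates.tendsto_remainder {Q : ∀ ħ, 𝓢(V, ℂ) →ₗ[ℂ] 𝔄 ħ}
    (hQ : ∀ ħ : PosParam, c.HasStarBound M (ħ : ℝ≥0) (Q ħ)) (k : ℕ) (f g : 𝓢(V, ℂ))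
    (b : ℕ → 𝓢(V, ℂ)) (hb : ∀ j, ⇑(b j) = c.starCoeff j f g) :
    Tendsto (fun ħ : PosParam => 1 / ((ħ : ℝ≥0) : ℝ) ^ k *
      ‖Q ħ f * Q ħ g -
        ∑ j ∈ Finset.range (k + 1), ((((ħ : ℝ≥0) : ℝ) : ℂ) ^ j) • Q ħ (b j)‖)
      (comap (fun ħ : PosParam => (ħ : ℝ≥0)) (𝓝 0)) (𝓝 0) := by
  obtain rfl : b = fun j => c.schwartzStar j f g :=
    funext fun j => DFunLike.coe_injective (by rw [hb, c.coe_schwartzStar])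
  set C := M ^ (k + 1) / (k + 1).factorial * (fourierMoment (k + 1) f * fourierMoment (k + 1) g)
    with hC
  have h1 : Tendsto (fun ħ : PosParam => ((ħ : ℝ≥0) : ℝ) * C)
      (comap (fun ħ : PosParam => (ħ : ℝ≥0)) (𝓝 0)) (𝓝 0) := by
    have h2 := ((NNReal.continuous_coe.tendsto 0).comp
      (tendsto_comap (f := fun ħ : PosParam => (ħ : ℝ≥0)))).mul_const C
    simpa using h2
  refine squeeze_zero (fun ħ => by positivity) (fun ħ => ?_) h1
  have h3 : (0 : ℝ) < ((ħ : ℝ≥0) : ℝ) := NNReal.coe_pos.2 ħ.2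
  rw [one_div_mul_eq_div, div_le_iff₀ (by positivity)]
  refine ((hQ ħ).norm_mul_sub_le (k + 1) k.succ_pos f g).trans (le_of_eq ?_)
  rw [hC, mul_pow]
  ring

end CStar

/-- Criterion for a quantization by compact operators to be an infinite order strict deformation
quantization for the star product of the complex coordinates `c`. -/
theorem ComplexCoordinates.isInfiniteOrderStrictDeformationQuantization (hM : 0 ≤ M)
    {T : ∀ ħ, 𝓢(V, ℂ) →ₗ[ℂ] H ħ →L[ℂ] H ħ} {Q : ∀ ħ, 𝓢(V, ℂ) →ₗ[ℂ] CompactOperators (H ħ)}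
    (hQT : ∀ ħ f, (Q ħ f : H ħ →L[ℂ] H ħ) = T ħ f)
    (hT : ∀ ħ : PosParam, c.HasStarBound (𝔅 := H ħ →L[ℂ] H ħ) M (ħ : ℝ≥0) (T ħ))
    (hstar : ∀ (f g : 𝓢(V, ℂ)), (∀ x, g x = star (f x)) → ∀ ħ,
      T ħ g = ContinuousLinearMap.adjoint (T ħ f))
    (hone : ∀ f : 𝓢(V, ℂ), (∀ x, f x = 1) → ∀ ħ, T ħ f = 1)
    (hdense : ∀ ħ (A : H ħ →L[ℂ] H ħ), IsCompactOperator A →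
      A ∈ (LinearMap.range (T ħ)).topologicalClosure)
    {q : 𝓢(V, ℂ) → ℝ → ℝ} (hq : ∀ f (ħ : PosParam), ‖T ħ f‖ = q f (ħ : ℝ≥0))
    (hlt : ∀ f, ∀ r < supNorm f, ∀ᶠ t : ℝ in 𝓝[≥] 0, 0 < t → r < q f t)
    (hcont : ∀ f, ∀ ħ : ℝ, 0 < ħ → ContinuousAt (q f) ħ) :
    IsInfiniteOrderStrictDeformationQuantization (𝔄 := fun ħ => CompactOperators (H ħ)) ω
      Q c.starCoeff where
  isQuantization := isQuantization_compactOperators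
    (fun f g h ħ => by rw [hQT, hQT, hstar f g h]) fun f h ħ => by rw [hQT, hone f h]
  exists_field := by
    refine c.exists_field_of_hasStarBound (𝔄 := fun ħ => CompactOperators (H ħ)) Q hM
      (fun ħ => (hT ħ).compactOperators (hQT ħ))
      (fun f g h ħ => Subtype.ext (by
        rw [hQT, hstar f g h, ← hQT]
        rfl))
      (fun ħ => dense_range_of_mem_closure (T ħ) _ (hQT ħ) (hdense ħ))
      fun f => continuous_norm_quantizationMap (q := q f) (fun ħ => ?_) (fun ħ hħ => ?_) (hlt f)
        (hcont f)
    · rw [← hq f ħ, ← hQT]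
      rfl
    · exact (hq f ⟨⟨ħ, hħ.le⟩, hħ⟩).symm.trans_le ((hT _).norm_le f)
  isQuantizationStarProduct :=
    { isStarProduct := c.isStarProduct
      schwartz := fun k f g => ⟨c.schwartzStar k f g, c.coe_schwartzStar k f g⟩
      tendsto_remainder := ComplexCoordinates.tendsto_remainder
        (𝔄 := fun ħ => CompactOperators (H ħ)) fun ħ => (hT ħ).compactOperators (hQT ħ) }
  poisson_compatible f g _ _ := c.poisson_compatible f g

end Main

end BerezinToeplitz

end

theorem mainTheorem3 {V : Type*} [NormedAddCommGroup V] [InnerProductSpace ℝ V]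
    [FiniteDimensional ℝ V] [MeasurableSpace V] [BorelSpace V] (ω : SymplecticForm V) :
    ∃ hT : ∀ (ħ : PosParam) (f : 𝓢(V, ℂ)), IsCompactOperator (toeplitz ω (ħ : ℝ≥0) f),
      (∃ N : ℕ, Nonempty (ComplexCoordinates ω N)) ∧
      ∀ (N : ℕ) (c : ComplexCoordinates ω N),
        IsInfiniteOrderStrictDeformationQuantization (𝔄 := QuantumAlgebra ω) ω
          (toeplitzQuantization ω hT) c.starCoeff := by
  refine ⟨fun ħ f => isCompactOperator_toeplitz (NNReal.coe_pos.2 ħ.2) f,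
    ω.exists_complexCoordinates, fun N c => ?_⟩
  obtain ⟨M, hM, h⟩ := c.exists_norm_herm_frequency_le
  exact c.isInfiniteOrderStrictDeformationQuantization (H := fun ħ => physicalSpace ω (ħ : ℝ≥0))
    (T := fun ħ => toeplitz ω (ħ : ℝ≥0)) (q := fun f ħ => ‖toeplitz ω ħ f‖) hM.le
    (fun _ _ => rfl) (fun ħ => c.hasStarBound_toeplitz hM.le (NNReal.coe_pos.2 ħ.2) h)
    (fun f g h _ => adjoint_toeplitz f g h) (fun f h _ => toeplitz_one f h)
    (fun ħ _ hA => mem_closure_range_toeplitz (NNReal.coe_pos.2 ħ.2) hA) (fun _ _ => rfl)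
    (fun f _ hr => eventually_lt_norm_toeplitz f hr) fun f _ hħ => tendsto_norm_toeplitz hħ f
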